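/- **Setting.** Let $n=me$ with $e\ge 1$, $r\ge 0$, $F=\mathbb{C}((z))$, $\mathfrak o=\mathbb{C}[[z]]$. Let $\varpi_T\in\mathfrak{gl}_n(F)$ be block diagonal with $m$ equal $e\times e$ blocks having $1$'s on the superdiagonal, $z$ in the lower left corner and $0$ elsewhere (the block is $(z)$ if $e=1$); let $\chi_j$ be the identity of the $j$-th block, $\mathfrak t^\flat=\bigoplus_j\mathbb{C}\chi_j$, $\mathfrak t=\bigoplus_{j}\bigoplus_{0\le i<e}F\chi_j\varpi_T^i$ the Cartan subalgebra and $T=\mathfrak t^\times$, $T(\mathfrak o)=\big(\bigoplus_{j}\bigoplus_{0\le i<e}\mathfrak o\chi_j\varpi_T^i\big)^\times$. Let $H_T$ be block diagonal with blocks $\mathrm{diag}(\frac{e-1}{2e},\frac{e-3}{2e},\dots,\frac{1-e}{2e})$. Put $L^i=\varpi_T^i\mathfrak o^n$, $\mathfrak P^\ell=\{X\in\mathfrak{gl}_n(F): XL^i\subset L^{i+\ell}\ \forall i\}$, $\mathfrak P=\mathfrak P^0$, $P$ the stabilizer of the chain $(L^i)$, and $P^1=1+\mathfrak P^1$. Matrices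 of connections are written with respect to $\frac{dz}{z}$, and functionals $\beta$ on $\mathfrak P^r/\mathfrak P^{r+1}$ are identified through $(X,Y)\mapsto\mathrm{Res}\,\mathrm{Tr}(XY\frac{dz}{z})$ with cosets $b+\mathfrak P^{-r+1}$, $b\in\mathfrak P^{-r}$. A coset $b+\mathfrak P^{-r+1}$ gives a *regular stratum $(P,r,\beta)$ centralized by $T$* if $\gcd(r,e)=1$; the coset contains no nilpotent matrix; $T(\mathfrak o)\subset P$; for every $s\in\mathbb{Z}$ the kernel of $\mathfrak P^s/\mathfrak P^{s+1}\to\mathfrak P^{s-r}/\mathfrak P^{s-r+1}$, $X\mapsto[X,b]$, is the image of $\mathfrak t\cap\mathfrak P^s$; $z^rb^e+\mathfrak P^1$ is a semisimple element of $\mathfrak P/\mathfrak P^1$; and, if $r=0$ (so $e=1$), its eigenvalues are distinct modulo $\mathbb{Z}$. A connection $d+a\frac{dz}{z}$ on $F^n$, with $\nabla_\tau=z\partial_z+a$, *contains* $(P,r,\beta)$ if $\nabla_\tau L^i\subset L^{i-r}$ and $(\nabla_\tau-b)L^i\subset L^{i-r+1}$ for all $i$ when $r\ge1$, and if $(\nabla_\tau-b)\mathfrak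 o^n\subset z\mathfrak o^n$ when $r=0$. Its *formal type* (with respect to $P,T$) is $A+\mathfrak P^1$, $A\in\mathfrak P^{-r}\cap(\mathfrak t+\mathfrak P^1)$, if it contains the regular stratum given by $A+\mathfrak P^{-r+1}$ and some $q\in P^1$ satisfies $qaq^{-1}-(z\partial_zq)q^{-1}\in A+\mathfrak P^1$. Let $\Delta\subset\mathbb{C}^d$ be an open polydisk with ring of holomorphic functions $R$. Let $\mathfrak P^\ell_\Delta\subset\mathfrak{gl}_n(R((z)))$ be defined as $\mathfrak P^\ell$, with coefficients in $R$, and let $P^1_\Delta=1+\mathfrak P^1_\Delta$, $\mathfrak t^\flat_\Delta=\bigoplus_jR\chi_j$. A *framed flat formal deformation* is a flat meromorphic connection $\bar\nabla=d+\alpha\frac{dz}{z}+\sum_sB_s\,dy_s$, with $\alpha,B_s\in\mathfrak{gl}_n(R((z)))$, on the trivial rank $n$ bundle on $\mathrm{Spec}(\mathfrak o)\times\Delta$, that has a *compatible framing*: a trivialization $g\in GL_n(R)$ such that for each $y\in\Delta$ the restriction of $\bar\nabla$ to the fibre over $y$, written in the trivialization $g(y)$, contains a regular stratum $(P,r,\beta_y)$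 centralized by $T$. Write $[\bar\nabla]_g$ for the total connection matrix in the trivialization $g$. **Proposition 4.4.** Every framed flat formal deformation has a good compatible framing. That is, there are a compatible framing $g\in GL_n(R)$, elements $t_0,\dots,t_{r}\in\mathfrak t^\flat_\Delta$ and $p\in P^1_\Delta$ such that, with $$A=t_0-\sum_{k=1}^{r}\tfrac{k}{e}\,t_{k}\varpi_T^{-k},\qquad A_\Delta=\sum_{k=1}^{r}\varpi_T^{-k}\,d_\Delta t_{k},$$ for every $y\in\Delta$ the formal type of the fibre over $y$ in the trivialization $g(y)$ is $A(y)+\mathfrak P^1$, and $$p\,[\bar\nabla]_g\,p^{-1}-(z\partial_zp)p^{-1}\tfrac{dz}{z}-(d_\Delta p)p^{-1}=(A+H_T)\tfrac{dz}{z}+A_\Delta .$$ -/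

import Mathlib

/-!
Conventions.  The rank is `n = m * e`; matrices are indexed by `Fin m × Fin e` (block `j`,
position `a` inside the block).  `S⸨X⸩` is the ring of Laurent series with coefficients in `S`,
with `X = z`.  We take `S = ℂ` for a single formal connection, and `S = R` (the ring of
holomorphic functions on the parameter polydisk) for families.  All `dz`-parts are written as
multiples of `dz / z`, i.e. the auxiliary one-form is `ν = dz / z` and `τ_ν = z ∂_z`.
-/

namespace FormalDeformation

open scoped LaurentSeries PowerSeries Matrix

noncomputable section

/-! ### Laurent series and matrices of Laurent series -/

section Algebra

variable {S : Type*} [CommRing S] {m e : ℕ}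

/-- `n × n` matrices of Laurent series, `n = m * e`. -/
abbrev Mat (S : Type*) [CommRing S] (m e : ℕ) : Type _ :=
  Matrix (Fin m × Fin e) (Fin m × Fin e) S⸨X⸩

/-- The group `GL_n` over Laurent series. -/
abbrev GLF (S : Type*) [CommRing S] (m e : ℕ) : Type _ :=
  GL (Fin m × Fin e) S⸨X⸩

/-- The uniformizer `z`. -/
def zVar (S : Type*) [CommRing S] : S⸨X⸩ := HahnSeries.single 1 1

/-- The derivation `z ∂_z` on Laurent series. -/
def zDeriv (f : S⸨X⸩) : S⸨X⸩ := zVar S * LaurentSeries.derivative S f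

/-- The `dz / z` part of the gauge transformation: `p · a = p a p⁻¹ - (z ∂_z p) p⁻¹`. -/
def gaugeZ (p : GLF S m e) (a : Mat S m e) : Mat S m e :=
  (p : Mat S m e) * a * ((p⁻¹ : GLF S m e) : Mat S m e)
    - (p : Mat S m e).map zDeriv * ((p⁻¹ : GLF S m e) : Mat S m e)

/-! ### The standard torus -/

/-- The block diagonal matrix `ϖ_T`, each of whose `m` blocks of size `e` has ones just above
the diagonal, `z` in the lower left corner, and zeros elsewhere (the block is `(z)` if `e = 1`). -/
def varpi (S : Type*) [CommRing S] (m e : ℕ) : Mat S m e := Matrix.of fun p q =>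
  if p.1 = q.1 then
    (if (p.2 : ℕ) + 1 = q.2 then 1
     else if (p.2 : ℕ) + 1 = e ∧ (q.2 : ℕ) = 0 then zVar S else 0)
  else 0

/-- The element `∑ c_j χ_j` of `𝔱^♭`, where `χ_j` is the identity of the `j`-th block. -/
def flat (c : Fin m → S) : Mat S m e :=
  Matrix.diagonal fun p => HahnSeries.C (c p.1)

/-- The diagonal matrix `H_T` with blocks `diag ((e-1)/2e, (e-3)/2e, …, (1-e)/2e)`. -/
def HT (S : Type*) [CommRing S] [Algebra ℂ S] (m e : ℕ) : Mat S m e :=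
  Matrix.diagonal fun p =>
    HahnSeries.C (algebraMap ℂ S (((e : ℂ) - 1 - 2 * ((p.2 : ℕ) : ℂ)) / (2 * (e : ℂ))))

/-- The products `χ_j ϖ_T^i`, `0 ≤ i < e`: a basis of the Cartan subalgebra `𝔱 = E^m` over the
Laurent series field and of `𝔱(𝔬) = 𝔬_E^m` over the power series ring. -/
def torusBasis (m e : ℕ) (p : Fin m × Fin e) : Mat ℂ m e :=
  flat (Pi.single p.1 1) * varpi ℂ m e ^ (p.2 : ℕ)

/-- The Cartan subalgebra `𝔱 ≅ E^m` of `gl_n(ℂ((z)))`, with `E = ℂ((z))(ϖ)`, `ϖ ^ e = z`. -/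
def torus (m e : ℕ) : Submodule ℂ⸨X⸩ (Mat ℂ m e) :=
  Submodule.span ℂ⸨X⸩ (Set.range (torusBasis m e))

/-- The order `𝔱(𝔬) ≅ 𝔬_E^m`; the group `T(𝔬)` is its group of units. -/
def torusInt (m e : ℕ) : Submodule ℂ⟦X⟧ (Mat ℂ m e) :=
  Submodule.span ℂ⟦X⟧ (Set.range (torusBasis m e))

/-! ### The standard uniform lattice chain and its parahoric -/

/-- The lattice `L^i = ϖ_T^i 𝔬^n` of the standard uniform chain of period `e`.  It consists of
the vectors all of whose monomials `z^k e_{(j,a)}` satisfy `e k + (e - 1 - a) ≥ i`. Thus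
`L^0 = 𝔬^n` and `z L^i = L^{i+e}`. -/
def lattice (S : Type*) [CommRing S] (m e : ℕ) (i : ℤ) :
    Submodule S (Fin m × Fin e → S⸨X⸩) where
  carrier := {v | ∀ p k, (e : ℤ) * k + ((e : ℤ) - 1 - ((p.2 : ℕ) : ℤ)) < i → (v p).coeff k = 0}
  zero_mem' := by intro p k _; simp
  add_mem' := by
    intro v w hv hw p k h
    simp [hv p k h, hw p k h]
  smul_mem' := by
    intro c v hv p k h
    simp [hv p k h]

/-- `𝔓^l`: the matrices with `X L^i ⊆ L^{i+l}` for all `i`.  For `S = R` this is `𝔓^l_Δ`. -/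
def parahoric (S : Type*) [CommRing S] (m e : ℕ) (l : ℤ) : Submodule S (Mat S m e) where
  carrier := {Y | ∀ i, ∀ v ∈ lattice S m e i, Y *ᵥ v ∈ lattice S m e (i + l)}
  zero_mem' := by intro i v _; simp
  add_mem' := by
    intro Y Z hY hZ i v hv
    rw [Matrix.add_mulVec]
    exact Submodule.add_mem _ (hY i v hv) (hZ i v hv)
  smul_mem' := by
    intro c Y hY i v hv
    have h : (c • Y) *ᵥ v = c • (Y *ᵥ v) := by
      funext p
      simp only [Matrix.mulVec, dotProduct, Matrix.smul_apply, Pi.smul_apply, Finset.smul_sum,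
        ← HahnSeries.C_mul_eq_smul, mul_assoc]
    rw [h]
    exact Submodule.smul_mem _ _ (hY i v hv)

/-- Membership in the congruence subgroup `P^1 = I + 𝔓^1`. -/
def InP1 (p : GLF S m e) : Prop := (p : Mat S m e) - 1 ∈ parahoric S m e 1

end Algebra

/-! ### Regular strata and formal types over `ℂ((z))` -/

section Strata

variable {m e : ℕ}

/-- `(P, r, β)` is a regular stratum centralized by `T`, where `P`, `T` are the standard uniform
parahoric subgroup and the standard torus.  The functional `β` on `𝔓^r / 𝔓^{r+1}` is given, via
the pairing `Res Tr (X Y dz/z)`, by a representative `b` of a coset in `𝔓^{-r} / 𝔓^{-r+1}`; every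
condition depends on the coset only. -/
structure IsRegularStratum (r : ℕ) (b : Mat ℂ m e) : Prop where
  coprime : Nat.gcd r e = 1
  mem : b ∈ parahoric ℂ m e (-r)
  /-- the stratum is uniform: the coset contains no nilpotent element -/
  not_nilpotent : ∀ Y ∈ parahoric ℂ m e (-r + 1), ¬ IsNilpotent (b + Y)
  /-- `T(𝔬) ⊆ P` -/
  torus_le : ∀ t ∈ torusInt m e, ∀ t' ∈ torusInt m e, t * t' = 1 →
    ∀ i, (fun v => t *ᵥ v) '' (lattice ℂ m e i : Set (Fin m × Fin e → ℂ⸨X⸩)) = lattice ℂ m e i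
  /-- the kernel of `X ↦ [X, b] : 𝔓^s/𝔓^{s+1} → 𝔓^{s-r}/𝔓^{s-r+1}` is `𝔱 ∩ 𝔓^s + 𝔓^{s+1}` -/
  ker_ad : ∀ s : ℤ, ∀ Y ∈ parahoric ℂ m e s,
    (Y * b - b * Y ∈ parahoric ℂ m e (s - r + 1) ↔
      ∃ t ∈ torus m e, t ∈ parahoric ℂ m e s ∧ Y - t ∈ parahoric ℂ m e (s + 1))
  /-- `y = z^r b^e + 𝔓^1` is semisimple in the finite-dimensional `ℂ`-algebra `𝔓 / 𝔓^1`, i.e. it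
  is annihilated by a squarefree polynomial -/
  semisimple : ∃ q : Polynomial ℂ, Squarefree q ∧
    Polynomial.aeval (zVar ℂ ^ r • b ^ e) (q.map (HahnSeries.C : ℂ →+* ℂ⸨X⸩))
      ∈ parahoric ℂ m e 1
  /-- if `r = 0` (so `e = 1` and `𝔓 / 𝔓^1 = gl_n(ℂ)`), the eigenvalues of `y`
  (with multiplicity) are distinct modulo `ℤ` -/
  nonresonant : r = 0 →
    (Multiset.map (QuotientAddGroup.mk : ℂ → ℂ ⧸ AddSubgroup.zmultiples (1 : ℂ))
      ((zVar ℂ ^ r • b ^ e).map fun f => f.coeff 0).charpoly.roots).Nodup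

/-- The operator `∇_τ = z ∂_z + a` on `ℂ((z))^n`. -/
def nablaTau (a : Mat ℂ m e) (v : Fin m × Fin e → ℂ⸨X⸩) : Fin m × Fin e → ℂ⸨X⸩ :=
  (fun p => zDeriv (v p)) + a *ᵥ v

/-- The connection `d + a dz/z` on `ℂ((z))^n` contains the stratum `(P, r, b)`.  If `r = 0`
(so `e = 1`), the lattice is the one given by the trivialization, `L^0 = 𝔬^n`. -/
def ContainsStratum (r : ℕ) (a b : Mat ℂ m e) : Prop :=
  (1 ≤ r → ∀ i, ∀ v ∈ lattice ℂ m e i,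
    nablaTau a v ∈ lattice ℂ m e (i - r) ∧
    nablaTau a v - b *ᵥ v ∈ lattice ℂ m e (i - r + 1)) ∧
  (r = 0 → ∀ v ∈ lattice ℂ m e 0, nablaTau a v - b *ᵥ v ∈ lattice ℂ m e 1)

/-- `A + 𝔓^1` is the formal type of the connection `d + a dz/z` (in its given trivialization)
with respect to `P` and `T`: the connection contains the regular stratum `(P, r, A + 𝔓^{-r+1})`
centralized by `T`, `A ∈ 𝔱 + 𝔓^1`, and `a` is gauge equivalent, by an element of `P^1`, to an
element of `A + 𝔓^1`. -/
def IsFormalType (r : ℕ) (a A : Mat ℂ m e) : Prop :=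
  IsRegularStratum r A ∧ ContainsStratum r a A ∧
  (∃ t ∈ torus m e, A - t ∈ parahoric ℂ m e 1) ∧
  ∃ q : GLF ℂ m e, InP1 q ∧ gaugeZ q a - A ∈ parahoric ℂ m e 1

end Strata

/-! ### The ring of holomorphic functions on the parameter space -/

section Hol

variable {d : ℕ}

open TopologicalSpace

/-- The open polydisk with centre `c` and polyradius `ρ`. -/
def polydisk (c : Fin d → ℂ) (ρ : Fin d → ℝ) : Opens (Fin d → ℂ) :=
  ⟨Set.univ.pi fun s => Metric.ball (c s) (ρ s),
    isOpen_set_pi Set.finite_univ fun _ _ => Metric.isOpen_ball⟩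

/-- The ring `R` of holomorphic (i.e. complex analytic) functions on the open set `Δ ⊆ ℂ^d`. -/
def Hol (Δ : Opens (Fin d → ℂ)) : Subalgebra ℂ (Δ → ℂ) where
  carrier := {f | ∃ G : (Fin d → ℂ) → ℂ, AnalyticOnNhd ℂ G Δ ∧ ∀ y : Δ, f y = G y}
  mul_mem' := by
    rintro f g ⟨F, hF, hf⟩ ⟨G, hG, hg⟩
    exact ⟨F * G, hF.mul hG, fun y => by simp [hf, hg]⟩
  add_mem' := by
    rintro f g ⟨F, hF, hf⟩ ⟨G, hG, hg⟩
    exact ⟨F + G, hF.add hG, fun y => by simp [hf, hg]⟩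
  algebraMap_mem' := fun a => ⟨fun _ => a, analyticOnNhd_const, fun _ => rfl⟩

variable {Δ : Opens (Fin d → ℂ)}

/-- Extension by zero of a function on `Δ`. -/
def extend (f : Hol Δ) : (Fin d → ℂ) → ℂ := Function.extend Subtype.val (f : Δ → ℂ) 0

theorem extend_apply (f : Hol Δ) (y : Δ) : extend f y = (f : Δ → ℂ) y :=
  Subtype.val_injective.extend_apply _ _ _

theorem extend_analytic (f : Hol Δ) : AnalyticOnNhd ℂ (extend f) Δ := by
  obtain ⟨G, hG, hf⟩ := f.2
  refine hG.congr Δ.isOpen fun y hy => ?_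
  rw [← hf ⟨y, hy⟩]
  exact (extend_apply f ⟨y, hy⟩).symm

/-- The partial derivative `∂ / ∂y_s` on `R`. -/
def pderiv (s : Fin d) : Hol Δ →ₗ[ℂ] Hol Δ where
  toFun f := ⟨fun y => fderiv ℂ (extend f) y (Pi.single s 1),
    fun x => fderiv ℂ (extend f) x (Pi.single s 1),
    fun x hx => ((ContinuousLinearMap.apply ℂ ℂ (Pi.single s (1 : ℂ) : Fin d → ℂ)).analyticAt
      _).comp (extend_analytic f x hx).fderiv,
    fun _ => rfl⟩
  map_add' f g := by
    ext y
    have hf := (extend_analytic f y y.2).differentiableAt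
    have hg := (extend_analytic g y y.2).differentiableAt
    have h : extend (f + g) = extend f + extend g := by
      funext x
      by_cases hx : x ∈ Δ
      · have h1 := extend_apply (f + g) ⟨x, hx⟩
        have h2 := extend_apply f ⟨x, hx⟩
        have h3 := extend_apply g ⟨x, hx⟩
        simp only [Pi.add_apply] at *
        rw [h1, h2, h3]; rfl
      · have hx' : ¬ ∃ a : Δ, (a : Fin d → ℂ) = x := by rintro ⟨a, rfl⟩; exact hx a.2
        simp [extend, Function.extend_apply' _ _ _ hx']
    simp [h, fderiv_add hf hg]
  map_smul' a f := by
    ext y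
    have hf := (extend_analytic f y y.2).differentiableAt
    have h : extend (a • f) = a • extend f := by
      funext x
      by_cases hx : x ∈ Δ
      · have h1 := extend_apply (a • f) ⟨x, hx⟩
        have h2 := extend_apply f ⟨x, hx⟩
        simp only [Pi.smul_apply] at *
        rw [h1, h2]; rfl
      · have hx' : ¬ ∃ a : Δ, (a : Fin d → ℂ) = x := by rintro ⟨a, rfl⟩; exact hx a.2
        simp [extend, Function.extend_apply' _ _ _ hx']
    simp [h, fderiv_const_smul hf]

/-- Evaluation of a holomorphic function at a point of `Δ`. -/
def evalAt (y : Δ) : Hol Δ →+* ℂ := (Pi.evalRingHom (fun _ : Δ => ℂ) y).comp (Hol Δ).val.toRingHom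

/-- Entrywise, coefficientwise partial derivative `∂ / ∂y_s` of a matrix over `R((z))`. -/
def matPderiv {m e : ℕ} (s : Fin d) (Y : Mat (Hol Δ) m e) : Mat (Hol Δ) m e :=
  Y.map fun f => f.map (pderiv s)

/-- Restriction of a matrix over `R((z))` to the fibre over `y ∈ Δ`. -/
def matEval {m e : ℕ} (y : Δ) (Y : Mat (Hol Δ) m e) : Mat ℂ m e :=
  Y.map fun f => f.map (evalAt y)

end Hol

/-! ### Families of formal connections -/

section Families

open TopologicalSpace

variable {d : ℕ} {Δ : Opens (Fin d → ℂ)} {m e r : ℕ}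

/-- The matrix `dzPart · dz/z + ∑_s dyPart s · dy_s`, in a fixed trivialization, of a meromorphic
connection (with poles along `z = 0`) on the trivial bundle of rank `m * e` on
`Spec ℂ[[z]] × Δ`. -/
@[ext]
structure Conn (Δ : Opens (Fin d → ℂ)) (m e : ℕ) where
  dzPart : Mat (Hol Δ) m e
  dyPart : Fin d → Mat (Hol Δ) m e

/-- Vanishing of the curvature `dM + M ∧ M` of the connection `d + M`: the coefficients of
`dz/z ∧ dy_s` and of `dy_s ∧ dy_t` are zero. -/
def Conn.IsFlat (N : Conn Δ m e) : Prop :=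
  (∀ s, (N.dyPart s).map zDeriv - matPderiv s N.dzPart
      + (N.dzPart * N.dyPart s - N.dyPart s * N.dzPart) = 0) ∧
  ∀ s t, matPderiv s (N.dyPart t) - matPderiv t (N.dyPart s)
      + (N.dyPart s * N.dyPart t - N.dyPart t * N.dyPart s) = 0

/-- The total gauge transformation `M ↦ p M p⁻¹ - (dp) p⁻¹`. -/
def Conn.gauge (p : GLF (Hol Δ) m e) (N : Conn Δ m e) : Conn Δ m e where
  dzPart := gaugeZ p N.dzPart
  dyPart s := (p : Mat (Hol Δ) m e) * N.dyPart s * ((p⁻¹ : GLF (Hol Δ) m e) : Mat (Hol Δ) m e)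
    - matPderiv s (p : Mat (Hol Δ) m e) * ((p⁻¹ : GLF (Hol Δ) m e) : Mat (Hol Δ) m e)

/-- An element of `GL_n(R)`, seen in `GL_n(R((z)))`. -/
def constGL (g : GL (Fin m × Fin e) (Hol Δ)) : GLF (Hol Δ) m e :=
  Matrix.GeneralLinearGroup.map (HahnSeries.C : Hol Δ →+* (Hol Δ)⸨X⸩) g

/-- The matrix of the connection in the trivialization `g ∈ GL_n(R)`. -/
def Conn.inFrame (N : Conn Δ m e) (g : GL (Fin m × Fin e) (Hol Δ)) : Conn Δ m e :=
  N.gauge (constGL g)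

/-- `g ∈ GL_n(R)` is a compatible framing: for every `y ∈ Δ` the restriction of the connection to
the fibre over `y`, in the trivialization `g(y)`, contains a stratum `(P, r, β)` that is regular
and centralized by `T`. -/
def Conn.IsCompatibleFraming (N : Conn Δ m e) (r : ℕ) (g : GL (Fin m × Fin e) (Hol Δ)) : Prop :=
  ∀ y : Δ, ∃ b : Mat ℂ m e, IsRegularStratum r b ∧
    ContainsStratum r (matEval y (N.inFrame g).dzPart) b

/-- A framed flat formal deformation (given by its matrix in some trivialization): a flat
connection that has a compatible framing.  In particular every fibre contains a regular
stratum. -/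
def Conn.IsFramedFlatDeformation (N : Conn Δ m e) (r : ℕ) : Prop :=
  N.IsFlat ∧ ∃ g, N.IsCompatibleFraming r g

/-- The representative `A = t_0 + ∑_{k=1}^r (-k/e) t_k ϖ_T^{-k}`, with `t_k ∈ 𝔱^♭_Δ`, of a family
of formal types. -/
def formalTypeRep (r : ℕ) (t : ℕ → Fin m → Hol Δ) : Mat (Hol Δ) m e :=
  flat (t 0) + ∑ k ∈ Finset.Icc 1 r,
    flat (fun j => (-(k : ℂ) / (e : ℂ)) • t k j) * varpi (Hol Δ) m e ^ (-(k : ℤ))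

/-- The `∂/∂y_s` component of `A_Δ = ∑_{k=1}^r ϖ_T^{-k} d_Δ t_k`. -/
def ADelta (r : ℕ) (t : ℕ → Fin m → Hol Δ) (s : Fin d) : Mat (Hol Δ) m e :=
  ∑ k ∈ Finset.Icc 1 r, flat (fun j => pderiv s (t k j)) * varpi (Hol Δ) m e ^ (-(k : ℤ))

/-- The connection matrix `(A + H_T) dz/z + A_Δ`. -/
def normalForm (r : ℕ) (t : ℕ → Fin m → Hol Δ) : Conn Δ m e where
  dzPart := formalTypeRep r t + HT (Hol Δ) m e
  dyPart := ADelta r t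

/-- `g` is a good compatible framing: it is a compatible framing and, `A(y)` being the formal type
of the fibre over `y` in the trivialization `g(y)`, some `p ∈ P^1_Δ` transforms the matrix of the
connection in the trivialization `g` into `(A + H_T) dz/z + A_Δ`. -/
def Conn.IsGoodFraming (N : Conn Δ m e) (r : ℕ) (g : GL (Fin m × Fin e) (Hol Δ)) : Prop :=
  N.IsCompatibleFraming r g ∧
  ∃ t : ℕ → Fin m → Hol Δ,
    (∀ y : Δ, IsFormalType r (matEval y (N.inFrame g).dzPart) (matEval y (formalTypeRep r t))) ∧
    ∃ p : GLF (Hol Δ) m e, InP1 p ∧ (N.inFrame g).gauge p = normalForm r t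

end Families

end

end FormalDeformation

set_option linter.unusedSectionVars false

namespace FormalDeformation

open scoped LaurentSeries PowerSeries Matrix

noncomputable section

/-! ### Affine coefficients of matrices of Laurent series -/

section Coefficients

variable {S : Type*} [CommRing S] {m e : ℕ}

/-! Read a matrix over S((z)) as an infinite matrix indexed by ℤ, e-periodic along its diagonals,
with m × m matrices as entries; `cf X ℓ α` is the entry at (α, α + ℓ). Then 𝔓^l consists of the
matrices in degrees ≥ l, ϖ_T is the shift by one, the torus consists of the matrices whose diagonals
are constant with diagonal values (`IsToral`), and δ = z∂_z + ad H_T multiplies degree ℓ by ℓ/e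
(`cf_gradDeriv`). A gauge equation with target A + H_T becomes p(a − H_T) − δp = Ap
(`gaugeZ_eq_iff`), which explains the presence of H_T in the normal form.

Regularity of the stratum makes the leading coefficient a constant diagonal matrix c with distinct
c_i^e, nonzero c_i if e ≠ 1, and c_i distinct modulo ℤ if r = 0. Bracketing with the leading term is
then, entry by entry, a cyclic difference operator. Constant diagonals complement its image
sufficiently (`RegularLeading.exists_preimage`), and only constant diagonals are sent to constant
diagonals (`RegularLeading.eq_diagonal`). Conditions valid at every y give units of R, so all this
works over R. Solving degree by degree moves the dz/z part into the torus, after which its positive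
degrees are removed (`RegularLeading.exists_gaugeZ`).

Flatness in dz/z ∧ dy_s reads δB_s + [A, B_s] = ∂_s A. It forces B_s to be toral
(`RegularLeading.isToral_of_flat`) and then determines B_s in all degrees except 0. By the remaining
flatness equations the degree-zero parts are closed holomorphic one-forms; on a polydisk they have
primitives, and exponentiating these gives a block-constant diagonal u in GL_n(R) that gauges them
away (`exists_gauge_eq_normalForm`). Since u need not lie in P^1, it is absorbed into the framing: g
becomes ug and p becomes upu⁻¹.

The formal type is A rather than A + H_T. The blocks of H_T have trace zero, so bracketing A with a
suitable element of degree r cancels H_T modulo 𝔓^1 (`RegularLeading.exists_remove_HT`). -/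

theorem coeff_mul_eq_finsum (x y : S⸨X⸩) (n : ℤ) :
    (x * y).coeff n = ∑ᶠ u : ℤ, x.coeff u * y.coeff (n - u) := by
  classical
  rw [HahnSeries.coeff_mul]
  rw [finsum_eq_sum_of_support_subset (s := (Finset.antidiagonal
    x.isPWO_support y.isPWO_support n).image Prod.fst)]
  · rw [Finset.sum_image]
    · refine Finset.sum_congr rfl fun ij hij => ?_
      have := (Finset.mem_antidiagonal.1 hij).2.2
      rw [← this, add_sub_cancel_left]
    · rintro ⟨a, b⟩ hab ⟨a', b'⟩ hab' (rfl : a = a')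
      have h1 := (Finset.mem_antidiagonal.1 hab).2.2
      have h2 := (Finset.mem_antidiagonal.1 hab').2.2
      simp only [Prod.mk.injEq, true_and]
      simp only at h1 h2
      omega
  · intro u hu
    rw [Function.mem_support] at hu
    simp only [Finset.coe_image, Set.mem_image, Finset.mem_coe, Finset.mem_antidiagonal]
    refine ⟨(u, n - u), ⟨?_, ?_, ?_⟩, rfl⟩
    · exact fun h => hu (by rw [h, zero_mul])
    · exact fun h => hu (by rw [h, mul_zero])
    · simp

theorem finite_support_coeff_mul (x y : S⸨X⸩) (n : ℤ) :
    (Function.support fun u : ℤ => x.coeff u * y.coeff (n - u)).Finite := by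
  refine ((Finset.antidiagonal x.isPWO_support y.isPWO_support n).image
    Prod.fst).finite_toSet.subset ?_
  intro u hu
  rw [Function.mem_support] at hu
  simp only [Finset.coe_image, Set.mem_image, Finset.mem_coe, Finset.mem_antidiagonal]
  refine ⟨(u, n - u), ⟨?_, ?_, ?_⟩, rfl⟩
  · exact fun h => hu (by rw [h, zero_mul])
  · exact fun h => hu (by rw [h, mul_zero])
  · simp

variable [NeZero e]

/-- The residue of an integer modulo `e`. -/
def res (e : ℕ) [NeZero e] (α : ℤ) : Fin e :=
  ⟨(α % e).toNat, by
    have h0 : (0 : ℤ) < e := by exact_mod_cast Nat.pos_of_ne_zero (NeZero.ne e)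
    have h1 := Int.emod_lt_of_pos α h0
    have h2 := Int.emod_nonneg α h0.ne'
    omega⟩

theorem cast_pos_of_neZero (e : ℕ) [NeZero e] : (0 : ℤ) < e := by
  exact_mod_cast Nat.pos_of_ne_zero (NeZero.ne e)

theorem coe_res (α : ℤ) : (((res e α : Fin e) : ℕ) : ℤ) = α % e := by
  have h2 := Int.emod_nonneg α (cast_pos_of_neZero e).ne'
  simp [res, h2]

theorem res_add_mul_ediv (α : ℤ) : ((res e α : ℕ) : ℤ) + e * (α / e) = α := by
  rw [coe_res]; exact Int.emod_add_mul_ediv α e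

theorem res_fin_add (a : Fin e) (k : ℤ) : res e ((a : ℕ) + e * k) = a := by
  apply Fin.ext
  have : (((res e ((a : ℕ) + e * k) : Fin e) : ℕ) : ℤ) = (a : ℕ) := by
    rw [coe_res, Int.add_mul_emod_self_left, Int.emod_eq_of_lt (by positivity)]
    exact_mod_cast a.2
  exact_mod_cast this

theorem fin_add_ediv (a : Fin e) (k : ℤ) : (((a : ℕ) : ℤ) + e * k) / e = k := by
  rw [Int.add_mul_ediv_left _ _ (cast_pos_of_neZero e).ne',
    Int.ediv_eq_zero_of_lt (by positivity) (by exact_mod_cast a.2), zero_add]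

theorem res_add_self (α : ℤ) : res e (α + e) = res e α := by
  apply Fin.ext
  have : (((res e (α + e) : Fin e) : ℕ) : ℤ) = (res e α : ℕ) := by
    rw [coe_res, coe_res, Int.add_emod_right]
  exact_mod_cast this

theorem add_self_ediv (α : ℤ) : (α + (e : ℤ)) / e = α / e + 1 :=
  Int.add_ediv_of_dvd_right (dvd_refl _) |>.trans (by
    rw [Int.ediv_self (cast_pos_of_neZero e).ne'])

/-- The coefficient of degree `ℓ` of `X` in row `α`: regard `X` as an infinite `e`-periodic matrix
indexed by `ℤ`, with entries in `m × m` matrices; this is the entry at `(α, α + ℓ)`. -/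
def cf (X : Mat S m e) (ℓ α : ℤ) : Matrix (Fin m) (Fin m) S :=
  Matrix.of fun i j => (X (i, res e α) (j, res e (α + ℓ))).coeff ((α + ℓ) / e - α / e)

theorem cf_apply (X : Mat S m e) (ℓ α : ℤ) (i j : Fin m) : cf X ℓ α i j =
    (X (i, res e α) (j, res e (α + ℓ))).coeff ((α + ℓ) / e - α / e) := rfl

/-- Rows 0 ≤ α < e already exhaust all entries, so the coefficients `cf` determine the matrix. The
monomial z^k in position (a, b) has degree e·k + b − a. -/
theorem coeff_eq_cf (X : Mat S m e) (i j : Fin m) (a b : Fin e) (k : ℤ) :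
    (X (i, a) (j, b)).coeff k = cf X (e * k + (b : ℕ) - (a : ℕ)) (a : ℕ) i j := by
  have h1 : ((a : ℕ) : ℤ) + (e * k + (b : ℕ) - (a : ℕ)) = (b : ℕ) + e * k := by ring
  have h2 := res_fin_add a 0
  have h3 := fin_add_ediv a 0
  rw [mul_zero, add_zero] at h2 h3
  rw [cf_apply, h1, h2, h3, res_fin_add, fin_add_ediv, sub_zero]

theorem cf_ext {X Y : Mat S m e} (h : ∀ ℓ α, cf X ℓ α = cf Y ℓ α) : X = Y := by
  ext ⟨i, a⟩ ⟨j, b⟩ k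
  rw [coeff_eq_cf, coeff_eq_cf, h]

theorem cf_periodic (X : Mat S m e) (ℓ : ℤ) : Function.Periodic (cf X ℓ) (e : ℤ) := by
  intro α
  ext i j
  rw [cf_apply, cf_apply, add_right_comm, res_add_self, res_add_self, add_self_ediv,
    add_self_ediv, add_sub_add_right_eq_sub]

@[simp] theorem cf_zero (ℓ α : ℤ) : cf (0 : Mat S m e) ℓ α = 0 := by
  ext i j; simp [cf_apply]

theorem cf_add (X Y : Mat S m e) (ℓ α : ℤ) : cf (X + Y) ℓ α = cf X ℓ α + cf Y ℓ α := by
  ext i j; simp [cf_apply]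

theorem cf_sub (X Y : Mat S m e) (ℓ α : ℤ) : cf (X - Y) ℓ α = cf X ℓ α - cf Y ℓ α := by
  ext i j; simp [cf_apply]

theorem cf_sum {ι : Type*} (s : Finset ι) (X : ι → Mat S m e) (ℓ α : ℤ) :
    cf (∑ i ∈ s, X i) ℓ α = ∑ i ∈ s, cf (X i) ℓ α := by
  classical
  induction s using Finset.induction_on with
  | empty => simp
  | insert a s ha ih => rw [Finset.sum_insert ha, Finset.sum_insert ha, cf_add, ih]

/-! ### The parahoric filtration -/

theorem single_mem_lattice (j : Fin m) (b : Fin e) :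
    (Pi.single (j, b) 1 : Fin m × Fin e → S⸨X⸩) ∈ lattice S m e (e - 1 - (b : ℕ)) := by
  rintro p k h
  by_cases hp : p = (j, b)
  · subst hp
    rw [Pi.single_eq_same, HahnSeries.coeff_one, if_neg]
    rintro rfl
    simp at h
  · rw [Pi.single_eq_of_ne hp]; rfl

/-- The lattice L^i is cut out by the grade e·k + e − 1 − a of the monomials z^k e_(j,a), and a
matrix monomial of degree ℓ raises this grade by exactly ℓ. -/
theorem mem_parahoric_iff_coeff {X : Mat S m e} {l : ℤ} : X ∈ parahoric S m e l ↔
    ∀ i j (a b : Fin e) k, (e : ℤ) * k + (b : ℕ) - (a : ℕ) < l → (X (i, a) (j, b)).coeff k = 0 := by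
  constructor
  · intro h i j a b k hk
    have := h _ _ (single_mem_lattice j b) (i, a) k (by simp only; linarith)
    rwa [Matrix.mulVec_single_one] at this
  · rintro h s v hv ⟨i, a⟩ k hk
    rw [Matrix.mulVec, dotProduct, HahnSeries.coeff_sum]
    refine Finset.sum_eq_zero fun ⟨j, b⟩ _ => ?_
    rw [coeff_mul_eq_finsum]
    refine (finsum_congr fun u => ?_).trans finsum_zero
    by_cases hu : (e : ℤ) * u + (b : ℕ) - (a : ℕ) < l
    · rw [h i j a b u hu, zero_mul]
    · rw [hv (j, b) (k - u), mul_zero]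
      simp only at hk ⊢
      have : (e : ℤ) * (k - u) = e * k - e * u := by ring
      linarith

theorem mem_parahoric_iff {X : Mat S m e} {l : ℤ} :
    X ∈ parahoric S m e l ↔ ∀ ℓ < l, ∀ α, cf X ℓ α = 0 := by
  rw [mem_parahoric_iff_coeff]
  constructor
  · intro h ℓ hℓ α
    ext i j
    rw [cf_apply]
    refine (h i j _ _ _ ?_).trans rfl
    have h1 := res_add_mul_ediv (e := e) α
    have h2 := res_add_mul_ediv (e := e) (α + ℓ)
    have : (e : ℤ) * ((α + ℓ) / e - α / e) = e * ((α + ℓ) / e) - e * (α / e) := by ring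
    linarith
  · intro h i j a b k hk
    rw [coeff_eq_cf, h _ hk]; rfl

theorem parahoric_anti {k l : ℤ} (h : k ≤ l) : parahoric S m e l ≤ parahoric S m e k := by
  intro X hX
  rw [mem_parahoric_iff] at *
  exact fun ℓ hℓ => hX ℓ (hℓ.trans_le h)

theorem mul_mem_parahoric {X Y : Mat S m e} {k l : ℤ} (hX : X ∈ parahoric S m e k)
    (hY : Y ∈ parahoric S m e l) : X * Y ∈ parahoric S m e (k + l) := by
  intro i v hv
  rw [← Matrix.mulVec_mulVec, add_comm k l, ← add_assoc]
  exact hX _ _ (hY _ _ hv)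

theorem one_mem_parahoric : (1 : Mat S m e) ∈ parahoric S m e 0 := by
  intro i v hv
  rwa [Matrix.one_mulVec, add_zero]

theorem exists_mem_parahoric (X : Mat S m e) : ∃ N : ℤ, X ∈ parahoric S m e N := by
  obtain ⟨M, hM⟩ : ∃ M : ℤ, ∀ p q k, k < M → (X p q).coeff k = 0 := by
    let f : (Fin m × Fin e) × (Fin m × Fin e) → ℤ := fun pq => (X pq.1 pq.2).order
    obtain ⟨M, hM⟩ := (Set.finite_range f).bddBelow
    refine ⟨M, fun p q k hk => HahnSeries.coeff_eq_zero_of_lt_order (hk.trans_le ?_)⟩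
    exact hM ⟨(p, q), rfl⟩
  -- Since a < e and b ≥ 0, a degree e·k + b − a below e·M − e forces k < M.
  refine ⟨e * M - e, mem_parahoric_iff_coeff.2 fun i j a b k hk => hM _ _ _ ?_⟩
  have h1 : ((a : ℕ) : ℤ) < e := by exact_mod_cast a.2
  have h3 : (e : ℤ) * k < e * M := by
    have : (0 : ℤ) ≤ (b : ℕ) := by positivity
    linarith
  exact lt_of_mul_lt_mul_left h3 (cast_pos_of_neZero e).le

/-! ### The product in terms of coefficients -/

/-- Integers correspond to pairs of a residue and a quotient relative to `α`. -/
def divModFrom (e : ℕ) [NeZero e] (α : ℤ) : ℤ ≃ Fin e × ℤ where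
  toFun p := (res e (α + p), (α + p) / e - α / e)
  invFun x := (x.1 : ℕ) + e * (x.2 + α / e) - α
  left_inv p := by
    have h2 := res_add_mul_ediv (e := e) (α + p)
    simp only
    rw [sub_add_cancel]
    linarith
  right_inv x := by
    have : α + (((x.1 : ℕ) : ℤ) + e * (x.2 + α / e) - α) = (x.1 : ℕ) + e * (x.2 + α / e) := by
      ring
    ext
    · simp only [this, res_fin_add]
    · simp only [this, fin_add_ediv, add_sub_cancel_right]

/-- Relative to a fixed row α, the intermediate position in Fin e and the exponent of z are
remainder and quotient of a single integer (`divModFrom`), so matrix product and Cauchy product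
merge into one convolution, twisted by the row. -/
theorem cf_mul_apply_finsum (X Y : Mat S m e) (ℓ α : ℤ) (i k : Fin m) :
    cf (X * Y) ℓ α i k =
      ∑ j, ∑ᶠ p : ℤ, cf X p α i j * cf Y (ℓ - p) (α + p) j k := by
  classical
  rw [cf_apply, Matrix.mul_apply, HahnSeries.coeff_sum, Fintype.sum_prod_type]
  refine Finset.sum_congr rfl fun j _ => ?_
  set n := (α + ℓ) / (e : ℤ) - α / e with hn
  let F : Fin e × ℤ → S := fun x => (X (i, res e α) (j, x.1)).coeff x.2 *
    (Y (j, x.1) (k, res e (α + ℓ))).coeff (n - x.2)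
  have hF : (Function.support F).Finite := by
    refine (Set.finite_iUnion fun b : Fin e => ((finite_support_coeff_mul
      (X (i, res e α) (j, b)) (Y (j, b) (k, res e (α + ℓ))) n).image (Prod.mk b))).subset ?_
    rintro ⟨b, u⟩ h
    exact Set.mem_iUnion.2 ⟨b, u, h, rfl⟩
  have h1 : ∑ᶠ x, F x = ∑ b, ∑ᶠ u, F (b, u) := by
    rw [finsum_curry F hF, finsum_eq_sum_of_fintype]
  have h2 : ∑ᶠ p, F (divModFrom e α p) = ∑ᶠ x, F x := finsum_comp_equiv (divModFrom e α)
  simp only [coeff_mul_eq_finsum]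
  refine h1.symm.trans (h2.symm.trans (finsum_congr fun p => ?_))
  simp only [F, divModFrom, Equiv.coe_fn_mk, cf_apply]
  have : α + p + (ℓ - p) = α + ℓ := by ring
  rw [this, hn, sub_sub_sub_cancel_right]

theorem cf_mul {X Y : Mat S m e} {M N : ℤ} (hX : X ∈ parahoric S m e M)
    (hY : Y ∈ parahoric S m e N) (ℓ α : ℤ) : cf (X * Y) ℓ α =
      ∑ p ∈ Finset.Icc M (ℓ - N), cf X p α * cf Y (ℓ - p) (α + p) := by
  ext i k
  rw [cf_mul_apply_finsum, Matrix.sum_apply]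
  simp only [Matrix.mul_apply]
  rw [Finset.sum_comm]
  refine Finset.sum_congr rfl fun j _ => finsum_eq_sum_of_support_subset _ ?_
  intro p hp
  rw [Function.mem_support] at hp
  rw [mem_parahoric_iff] at hX hY
  by_contra h
  rw [Finset.coe_Icc, Set.mem_Icc, not_and_or, not_le, not_le] at h
  rcases h with h | h
  · exact hp (by rw [hX p h]; simp)
  · exact hp (by rw [hY (ℓ - p) (by linarith)]; simp)

/-- The matrix with prescribed affine coefficients, vanishing in degrees `< N`. -/
def ofCf (m e : ℕ) [NeZero e] (N : ℤ) (D : ℤ → ℤ → Matrix (Fin m) (Fin m) S) : Mat S m e :=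
  Matrix.of fun p q => HahnSeries.ofSuppBddBelow
    (fun k => if e * k + (q.2 : ℕ) - (p.2 : ℕ) < N then 0
      else D (e * k + (q.2 : ℕ) - (p.2 : ℕ)) (p.2 : ℕ) p.1 q.1) (by
    have h0 := cast_pos_of_neZero e
    -- For k < 0 one has e·k ≤ k, so k < N − e brings the degree e·k + b − a below N.
    refine ⟨min (N - e) 0, fun k hk => ?_⟩
    by_contra h
    refine hk (if_pos ?_)
    rw [not_le, lt_min_iff] at h
    have h2 : ((q.2 : ℕ) : ℤ) < e := by exact_mod_cast q.2.2
    have h3 : (0 : ℤ) ≤ (p.2 : ℕ) := by positivity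
    have h4 : (e : ℤ) * k ≤ k := by nlinarith
    linarith)

theorem cf_ofCf (N : ℤ) {D : ℤ → ℤ → Matrix (Fin m) (Fin m) S}
    (hD : ∀ ℓ, Function.Periodic (D ℓ) (e : ℤ)) (ℓ α : ℤ) :
    cf (ofCf m e N D) ℓ α = if ℓ < N then 0 else D ℓ α := by
  ext i j
  have h1 := res_add_mul_ediv (e := e) α
  have h2 := res_add_mul_ediv (e := e) (α + ℓ)
  have h3 : (e : ℤ) * ((α + ℓ) / e - α / e) + (res e (α + ℓ) : ℕ) - (res e α : ℕ) = ℓ := by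
    have : (e : ℤ) * ((α + ℓ) / e - α / e) = e * ((α + ℓ) / e) - e * (α / e) := by ring
    linarith
  have h4 : D ℓ ((res e α : ℕ) : ℤ) = D ℓ α := by
    conv_rhs => rw [← h1, mul_comm]
    exact ((hD ℓ).int_mul _ _).symm
  simp only [cf_apply, ofCf, Matrix.of_apply]
  change (if _ then _ else _) = _
  simp only [h3, h4]
  split_ifs <;> rfl

theorem ofCf_mem_parahoric (N : ℤ) {D : ℤ → ℤ → Matrix (Fin m) (Fin m) S}
    (hD : ∀ ℓ, Function.Periodic (D ℓ) (e : ℤ)) : ofCf m e N D ∈ parahoric S m e N :=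
  mem_parahoric_iff.2 fun ℓ hℓ α => by rw [cf_ofCf N hD, if_pos hℓ]

end Coefficients

/-! ### Coefficients of the standard elements -/

section StandardElements

variable {S : Type*} [CommRing S] {m e : ℕ} [NeZero e]

theorem cf_diagonal (f : Fin m × Fin e → S) (ℓ α : ℤ) :
    cf (Matrix.diagonal fun p => HahnSeries.C (f p) : Mat S m e) ℓ α =
      if ℓ = 0 then Matrix.diagonal fun i => f (i, res e α) else 0 := by
  have h1 := res_add_mul_ediv (e := e) α
  have h2 := res_add_mul_ediv (e := e) (α + ℓ)
  ext i j
  rw [cf_apply]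
  by_cases hℓ : ℓ = 0
  · subst hℓ
    rw [if_pos rfl, add_zero, sub_self]
    by_cases hij : i = j
    · subst hij; simp
    · rw [Matrix.diagonal_apply_ne _ (by simp [hij]), Matrix.diagonal_apply_ne _ hij]; rfl
  · rw [if_neg hℓ]
    by_cases hij : (i, res e α) = (j, res e (α + ℓ))
    · rw [hij, Matrix.diagonal_apply_eq, HahnSeries.C_apply, HahnSeries.coeff_single_of_ne]
      · rfl
      · intro h
        rw [← (Prod.mk.inj hij).2] at h2
        have : (e : ℤ) * ((α + ℓ) / e) = e * (α / e) := by rw [sub_eq_zero.1 h]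
        exact hℓ (by linarith)
    · rw [Matrix.diagonal_apply_ne _ hij]; rfl

theorem cf_one (ℓ α : ℤ) : cf (1 : Mat S m e) ℓ α = if ℓ = 0 then 1 else 0 := by
  have : (1 : Mat S m e) = Matrix.diagonal fun p => HahnSeries.C ((fun _ => 1 : _ → S) p) := by
    simp
  rw [this, cf_diagonal]
  simp

theorem cf_flat (d : Fin m → S) (ℓ α : ℤ) :
    cf (flat d : Mat S m e) ℓ α = if ℓ = 0 then Matrix.diagonal d else 0 :=
  cf_diagonal (fun p => d p.1) ℓ α

theorem cf_diagonal_mul (f : Fin m × Fin e → S) (X : Mat S m e) (ℓ α : ℤ) :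
    cf ((Matrix.diagonal fun p => HahnSeries.C (f p)) * X) ℓ α =
      (Matrix.diagonal fun i => f (i, res e α)) * cf X ℓ α := by
  ext i j
  simp [cf_apply]

theorem cf_mul_diagonal (f : Fin m × Fin e → S) (X : Mat S m e) (ℓ α : ℤ) :
    cf (X * (Matrix.diagonal fun p => HahnSeries.C (f p))) ℓ α =
      cf X ℓ α * (Matrix.diagonal fun i => f (i, res e (α + ℓ))) := by
  ext i j
  rw [Matrix.mul_diagonal, cf_apply, cf_apply, Matrix.mul_diagonal, mul_comm,
    HahnSeries.C_mul_eq_smul, HahnSeries.coeff_smul, smul_eq_mul, mul_comm]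

theorem cf_flat_mul (d : Fin m → S) (X : Mat S m e) (ℓ α : ℤ) :
    cf (flat d * X) ℓ α = Matrix.diagonal d * cf X ℓ α :=
  cf_diagonal_mul (fun p => d p.1) X ℓ α

/-- The superdiagonal ones and the corner z are the same move, one step to the right: leaving the
last position of a block wraps around to its first position at the cost of a factor z. -/
theorem cf_varpi (ℓ α : ℤ) : cf (varpi S m e) ℓ α = if ℓ = 1 then 1 else 0 := by
  have h1 := res_add_mul_ediv (e := e) α
  have h2 := res_add_mul_ediv (e := e) (α + ℓ)
  have h0 := cast_pos_of_neZero e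
  ext i j
  rw [cf_apply]
  generalize res e α = a at *
  generalize res e (α + ℓ) = b at *
  generalize hk : (α + ℓ) / (e : ℤ) - α / e = k
  have h3 : (e : ℤ) * k + (b : ℕ) - (a : ℕ) = ℓ := by
    rw [← hk, mul_sub]; linarith
  have ha : ((a : ℕ) : ℤ) < e := by exact_mod_cast a.2
  have hb : ((b : ℕ) : ℤ) < e := by exact_mod_cast b.2
  have ha0 : (0 : ℤ) ≤ (a : ℕ) := by positivity
  have hb0 : (0 : ℤ) ≤ (b : ℕ) := by positivity
  simp only [varpi, Matrix.of_apply]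
  by_cases hij : i = j
  swap
  · rw [if_neg hij]
    split_ifs <;> simp [hij]
  subst hij
  rw [if_pos rfl]
  by_cases hab : (a : ℕ) + 1 = b
  · rw [if_pos hab, HahnSeries.coeff_one]
    have hab' : ((a : ℕ) : ℤ) + 1 = (b : ℕ) := by exact_mod_cast hab
    by_cases hk0 : k = 0
    · rw [if_pos hk0, if_pos (by rw [← h3, hk0, mul_zero]; linarith)]; simp
    · rw [if_neg hk0, if_neg]
      · rfl
      · intro h
        have : (e : ℤ) * k = 0 := by linarith
        rcases mul_eq_zero.1 this with h | h
        · exact h0.ne' h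
        · exact hk0 h
  · rw [if_neg hab]
    have hab' : ((a : ℕ) : ℤ) + 1 ≠ (b : ℕ) := by exact_mod_cast hab
    by_cases hc : (a : ℕ) + 1 = e ∧ (b : ℕ) = 0
    · rw [if_pos hc]
      have hc1 : ((a : ℕ) : ℤ) + 1 = e := by exact_mod_cast hc.1
      have hc2 : ((b : ℕ) : ℤ) = 0 := by exact_mod_cast hc.2
      by_cases hk1 : k = 1
      · rw [if_pos (by rw [← h3, hk1]; linarith), hk1]; simp [zVar]
      · rw [zVar, HahnSeries.coeff_single_of_ne hk1, if_neg]
        · rfl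
        · intro h
          have : (e : ℤ) * (k - 1) = 0 := by rw [mul_sub]; linarith
          rcases mul_eq_zero.1 this with h | h
          · exact h0.ne' h
          · exact hk1 (by linarith)
    · rw [if_neg hc, if_neg]
      · rfl
      · intro h
        rw [h] at h3
        have hk0 : 0 ≤ k := by
          by_contra hneg
          have : (e : ℤ) * k ≤ e * (-1) := mul_le_mul_of_nonneg_left (by omega) h0.le
          linarith
        have hk1 : k ≤ 1 := by
          by_contra hneg
          have : (e : ℤ) * 2 ≤ e * k := mul_le_mul_of_nonneg_left (by omega) h0.le
          linarith
        have hk2 : k = 0 ∨ k = 1 := by omega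
        rcases hk2 with rfl | rfl
        · exact hab' (by linarith)
        · exact hc ⟨by omega, by omega⟩

/-- The shift by `k`, i.e. `ϖ_T ^ k`. -/
def shift (S : Type*) [CommRing S] (m e : ℕ) [NeZero e] (k : ℤ) : Mat S m e :=
  ofCf m e k fun ℓ _ => if ℓ = k then 1 else 0

theorem cf_shift (k ℓ α : ℤ) : cf (shift S m e k) ℓ α = if ℓ = k then 1 else 0 := by
  rw [shift, cf_ofCf]
  · split_ifs with h1 h2 <;> first | rfl | omega
  · intro ℓ α; rfl

theorem shift_mem_parahoric (k : ℤ) : shift S m e k ∈ parahoric S m e k :=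
  ofCf_mem_parahoric _ fun _ _ => rfl

theorem shift_mul_shift (k l : ℤ) : shift S m e k * shift S m e l = shift S m e (k + l) := by
  refine cf_ext fun ℓ α => ?_
  rw [cf_mul (shift_mem_parahoric k) (shift_mem_parahoric l), cf_shift]
  by_cases h : ℓ = k + l
  · subst h
    rw [add_sub_cancel_right, Finset.Icc_self, Finset.sum_singleton, cf_shift, cf_shift]
    simp
  · rw [if_neg h]
    refine Finset.sum_eq_zero fun p _ => ?_
    rw [cf_shift, cf_shift]
    by_cases hp : p = k
    · rw [if_neg (show ¬ℓ - p = l by omega), mul_zero]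
    · rw [if_neg hp, zero_mul]

theorem shift_zero : shift S m e 0 = 1 := cf_ext fun ℓ α => by rw [cf_shift, cf_one]

theorem shift_one : shift S m e 1 = varpi S m e := cf_ext fun ℓ α => by rw [cf_shift, cf_varpi]

theorem varpi_pow (k : ℕ) : varpi S m e ^ k = shift S m e k := by
  induction k with
  | zero => rw [pow_zero, Nat.cast_zero, shift_zero]
  | succ k ih => rw [pow_succ, ih, ← shift_one, shift_mul_shift]; norm_num

theorem varpi_zpow_neg (k : ℕ) : varpi S m e ^ (-(k : ℤ)) = shift S m e (-k) := by
  rw [Matrix.zpow_neg_natCast, varpi_pow]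
  exact Matrix.inv_eq_right_inv (by rw [shift_mul_shift, add_neg_cancel, shift_zero])

theorem cf_flat_mul_shift (d : Fin m → S) (k ℓ α : ℤ) :
    cf (flat d * shift S m e k) ℓ α = if ℓ = k then Matrix.diagonal d else 0 := by
  rw [cf_flat_mul, cf_shift]
  split_ifs <;> simp

theorem flat_mem_parahoric (d : Fin m → S) : (flat d : Mat S m e) ∈ parahoric S m e 0 :=
  mem_parahoric_iff.2 fun ℓ hℓ α => by rw [cf_flat, if_neg hℓ.ne]

theorem coeff_zVar_mul (f : S⸨X⸩) (k : ℤ) : (zVar S * f).coeff k = f.coeff (k - 1) := by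
  rw [zVar, HahnSeries.coeff_single_mul, one_mul]

theorem coeff_zDeriv (f : S⸨X⸩) (k : ℤ) : (zDeriv f).coeff k = (k : S) * f.coeff k := by
  rw [zDeriv, coeff_zVar_mul, LaurentSeries.derivative_apply, LaurentSeries.hasseDeriv_coeff]
  simp

theorem zDeriv_zero : zDeriv (0 : S⸨X⸩) = 0 := by simp [zDeriv]

theorem zDeriv_C (c : S) : zDeriv (HahnSeries.C c : S⸨X⸩) = 0 := by
  ext k
  rw [coeff_zDeriv, HahnSeries.C_apply]
  by_cases hk : k = 0
  · simp [hk]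
  · rw [HahnSeries.coeff_single_of_ne hk, mul_zero]; rfl

theorem map_zDeriv_diagonal (f : Fin m × Fin e → S) :
    (Matrix.diagonal fun p => HahnSeries.C (f p) : Mat S m e).map zDeriv = 0 := by
  rw [Matrix.diagonal_map zDeriv_zero]
  simp only [zDeriv_C]
  exact Matrix.diagonal_zero

theorem map_zDeriv_mem_parahoric {X : Mat S m e} {l : ℤ} (h : X ∈ parahoric S m e l) :
    X.map zDeriv ∈ parahoric S m e l := by
  rw [mem_parahoric_iff_coeff] at *
  intro i j a b k hk
  rw [Matrix.map_apply, coeff_zDeriv, h i j a b k hk, mul_zero]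

end StandardElements

/-! ### The grading derivation -/

section Grading

variable {S : Type*} [CommRing S] [Algebra ℂ S] {m e : ℕ} [NeZero e]

theorem cf_HT (ℓ α : ℤ) : cf (HT S m e) ℓ α = if ℓ = 0 then
    Matrix.diagonal fun _ => algebraMap ℂ S (((e : ℂ) - 1 - 2 * ((res e α : ℕ) : ℂ)) / (2 * (e : ℂ)))
    else 0 :=
  cf_diagonal (fun p => algebraMap ℂ S (((e : ℂ) - 1 - 2 * ((p.2 : ℕ) : ℂ)) / (2 * (e : ℂ)))) ℓ α

theorem HT_mem_parahoric : HT S m e ∈ parahoric S m e 0 :=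
  mem_parahoric_iff.2 fun ℓ hℓ α => by rw [cf_HT, if_neg hℓ.ne]

/-- The derivation `z ∂_z + ad H_T`, which multiplies the component of degree `ℓ` by `ℓ / e`. -/
def gradDeriv (X : Mat S m e) : Mat S m e := X.map zDeriv + (HT S m e * X - X * HT S m e)

/-- On the monomial z^k in position (a, b), z∂_z contributes k and ad H_T contributes (b − a)/e; the
sum is ℓ/e. -/
theorem cf_gradDeriv (X : Mat S m e) (ℓ α : ℤ) :
    cf (gradDeriv X) ℓ α = algebraMap ℂ S ((ℓ : ℂ) / e) • cf X ℓ α := by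
  have he : (e : ℂ) ≠ 0 := by exact_mod_cast NeZero.ne e
  have h1 := res_add_mul_ediv (e := e) α
  have h2 := res_add_mul_ediv (e := e) (α + ℓ)
  rw [gradDeriv, cf_add, cf_sub, HT, cf_diagonal_mul, cf_mul_diagonal]
  ext i j
  rw [Matrix.add_apply, Matrix.sub_apply, Matrix.diagonal_mul, Matrix.mul_diagonal,
    Matrix.smul_apply, smul_eq_mul]
  have h3 : cf (X.map zDeriv) ℓ α i j =
      algebraMap ℂ S (((α + ℓ) / (e : ℤ) - α / e : ℤ) : ℂ) * cf X ℓ α i j := by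
    rw [cf_apply, cf_apply, Matrix.map_apply, coeff_zDeriv, map_intCast]
  rw [h3, mul_comm (cf X ℓ α i j), ← sub_mul, ← add_mul, ← map_sub, ← map_add]
  congr 2
  have h4 : (e : ℤ) * ((α + ℓ) / e - α / e) + (res e (α + ℓ) : ℕ) - (res e α : ℕ) = ℓ := by
    rw [mul_sub]; linarith
  have h5 : (e : ℂ) * (((α + ℓ) / (e : ℤ) - α / e : ℤ) : ℂ) + ((res e (α + ℓ) : ℕ) : ℂ)
      - ((res e α : ℕ) : ℂ) = ℓ := by exact_mod_cast h4
  rw [← h5]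
  field_simp
  ring

theorem gradDeriv_mem_parahoric {X : Mat S m e} {l : ℤ} (h : X ∈ parahoric S m e l) :
    gradDeriv X ∈ parahoric S m e l := by
  rw [mem_parahoric_iff] at *
  intro ℓ hℓ α
  rw [cf_gradDeriv, h ℓ hℓ, smul_zero]

/-- Degrees add under multiplication, so an operator that scales linearly in the degree is a
derivation. The Leibniz rule for z∂_z is deduced from this one. -/
theorem gradDeriv_mul (X Y : Mat S m e) :
    gradDeriv (X * Y) = gradDeriv X * Y + X * gradDeriv Y := by
  obtain ⟨M, hX⟩ := exists_mem_parahoric X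
  obtain ⟨N, hY⟩ := exists_mem_parahoric Y
  refine cf_ext fun ℓ α => ?_
  rw [cf_gradDeriv, cf_add, cf_mul hX hY, cf_mul (gradDeriv_mem_parahoric hX) hY,
    cf_mul hX (gradDeriv_mem_parahoric hY), ← Finset.sum_add_distrib, Finset.smul_sum]
  refine Finset.sum_congr rfl fun p _ => ?_
  rw [cf_gradDeriv, cf_gradDeriv, Matrix.smul_mul, Matrix.mul_smul, ← add_smul, ← map_add]
  congr 2
  push_cast
  ring

theorem map_zDeriv_eq (X : Mat S m e) :
    X.map zDeriv = gradDeriv X - (HT S m e * X - X * HT S m e) := by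
  rw [gradDeriv, add_sub_cancel_right]

theorem map_zDeriv_mul (X Y : Mat S m e) :
    (X * Y).map zDeriv = X.map zDeriv * Y + X * Y.map zDeriv := by
  rw [map_zDeriv_eq, map_zDeriv_eq, map_zDeriv_eq, gradDeriv_mul]
  noncomm_ring

end Grading

/-! ### Toral matrices -/

section Toral

variable {S : Type*} [CommRing S] {m e : ℕ} [NeZero e]

/-- Matrices all of whose affine coefficients are constant diagonal matrices: these are the
elements of the Cartan subalgebra. -/
def IsToral (X : Mat S m e) : Prop := ∃ c : ℤ → Fin m → S, ∀ ℓ α, cf X ℓ α = Matrix.diagonal (c ℓ)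

/-- Coefficients independent of the row remove the twist from the convolution, and diagonal matrices
commute. -/
theorem IsToral.commute {X Y : Mat S m e} (hX : IsToral X) (hY : IsToral Y) : X * Y = Y * X := by
  obtain ⟨c, hc⟩ := hX
  obtain ⟨d, hd⟩ := hY
  obtain ⟨M, hM⟩ := exists_mem_parahoric X
  obtain ⟨N, hN⟩ := exists_mem_parahoric Y
  refine cf_ext fun ℓ α => ?_
  rw [cf_mul hM hN, cf_mul hN hM]
  refine Finset.sum_nbij' (fun p => ℓ - p) (fun p => ℓ - p) ?_ ?_ ?_ ?_ ?_
  · intro p hp; rw [Finset.mem_Icc] at *; omega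
  · intro p hp; rw [Finset.mem_Icc] at *; omega
  · intro p _; ring
  · intro p _; ring
  · intro p _
    rw [hc, hd, hd, hc, sub_sub_cancel, Matrix.diagonal_mul_diagonal, Matrix.diagonal_mul_diagonal]
    simp only [mul_comm]

theorem IsToral.add {X Y : Mat S m e} (hX : IsToral X) (hY : IsToral Y) : IsToral (X + Y) := by
  obtain ⟨c, hc⟩ := hX
  obtain ⟨d, hd⟩ := hY
  exact ⟨fun ℓ i => c ℓ i + d ℓ i, fun ℓ α => by
    rw [cf_add, hc, hd, Matrix.diagonal_add]⟩

theorem IsToral.zero : IsToral (0 : Mat S m e) :=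
  ⟨0, fun ℓ α => by rw [cf_zero]; simp⟩

theorem IsToral.mul {X Y : Mat S m e} (hX : IsToral X) (hY : IsToral Y) : IsToral (X * Y) := by
  obtain ⟨c, hc⟩ := hX
  obtain ⟨d, hd⟩ := hY
  obtain ⟨M, hM⟩ := exists_mem_parahoric X
  obtain ⟨N, hN⟩ := exists_mem_parahoric Y
  refine ⟨fun ℓ i => ∑ p ∈ Finset.Icc M (ℓ - N), c p i * d (ℓ - p) i, fun ℓ α => ?_⟩
  rw [cf_mul hM hN]
  ext i j
  rw [Matrix.sum_apply]
  by_cases hij : i = j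
  · subst hij
    simp [hc, hd]
  · simp [hc, hd, hij]

theorem isToral_flat (d : Fin m → S) : IsToral (flat d : Mat S m e) :=
  ⟨fun ℓ => if ℓ = 0 then d else 0, fun ℓ α => by
    dsimp only; rw [cf_flat]; split_ifs <;> simp⟩

theorem isToral_shift (k : ℤ) : IsToral (shift S m e k) :=
  ⟨fun ℓ => if ℓ = k then 1 else 0, fun ℓ α => by
    dsimp only; rw [cf_shift]; split_ifs <;> simp⟩

end Toral

/-! ### The Cartan subalgebra over ℂ((z)) in terms of coefficients. -/

section Torus

variable {m e : ℕ} [NeZero e]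

theorem C_smul_eq (s : ℂ) (X : Mat ℂ m e) (k ℓ α : ℤ) :
    cf ((HahnSeries.single (k : ℤ) s : ℂ⸨X⸩) • X) ℓ α = s • cf X (ℓ - e * k) α := by
  have h0 := (cast_pos_of_neZero e).ne'
  have h1 : α + ℓ = (α + (ℓ - e * k)) + e * k := by ring
  ext i j
  rw [Matrix.smul_apply, cf_apply, cf_apply, Matrix.smul_apply, smul_eq_mul, smul_eq_mul,
    HahnSeries.coeff_single_mul]
  have h2 : res e (α + ℓ) = res e (α + (ℓ - e * k)) := by
    apply Fin.ext
    have : (((res e (α + ℓ) : Fin e) : ℕ) : ℤ) = (res e (α + (ℓ - e * k)) : ℕ) := by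
      rw [coe_res, coe_res, h1, Int.add_mul_emod_self_left]
    exact_mod_cast this
  have h3 : (α + ℓ) / (e : ℤ) = (α + (ℓ - e * k)) / e + k := by
    rw [h1, Int.add_mul_ediv_left _ _ h0]
  rw [h2, h3]
  congr 2
  ring

/-- Since ϖ_T^e = z, a scalar series is itself toral: its coefficient at z^k sits in degree e·k, and
degrees not divisible by e are empty. -/
theorem isToral_smul (f : ℂ⸨X⸩) {X : Mat ℂ m e} (hX : IsToral X) : IsToral (f • X) := by
  have : f • X = (f • (1 : Mat ℂ m e)) * X := by
    ext p q : 1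
    simp [Matrix.mul_apply, Matrix.smul_apply, Matrix.one_apply]
  rw [this]
  refine IsToral.mul ?_ hX
  refine ⟨fun ℓ _ => if (e : ℤ) ∣ ℓ then f.coeff (ℓ / e) else 0, fun ℓ α => ?_⟩
  have h0 := (cast_pos_of_neZero e).ne'
  have h1 := res_add_mul_ediv (e := e) α
  have h2 := res_add_mul_ediv (e := e) (α + ℓ)
  ext i j
  rw [cf_apply, Matrix.smul_apply, smul_eq_mul, Matrix.one_apply, Matrix.diagonal_apply]
  by_cases hij : i = j
  swap
  · rw [if_neg (by simp [hij]), if_neg hij, mul_zero]; rfl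
  subst hij
  rw [if_pos rfl]
  by_cases hd : (e : ℤ) ∣ ℓ
  · obtain ⟨k, rfl⟩ := hd
    have h3 : res e α = res e (α + e * k) := by
      apply Fin.ext
      have : (((res e α : Fin e) : ℕ) : ℤ) = (res e (α + e * k) : ℕ) := by
        rw [coe_res, coe_res, Int.add_mul_emod_self_left]
      exact_mod_cast this
    dsimp only
    rw [if_pos (by rw [← h3]), if_pos (dvd_mul_right _ _), mul_one, Int.add_mul_ediv_left _ _ h0,
      Int.mul_ediv_cancel_left _ h0, add_sub_cancel_left]
  · dsimp only
    rw [if_neg, if_neg hd, mul_zero]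
    · rfl
    · intro h
      rw [← (Prod.mk.inj h).2] at h2
      exact hd ⟨(α + ℓ) / e - α / e, by rw [mul_sub]; linarith⟩

theorem torusBasis_eq (p : Fin m × Fin e) :
    torusBasis m e p = flat (Pi.single p.1 1) * shift ℂ m e ((p.2 : ℕ) : ℤ) := by
  rw [torusBasis, varpi_pow]

theorem isToral_of_mem_torus {X : Mat ℂ m e} (hX : X ∈ torus m e) : IsToral X := by
  induction hX using Submodule.span_induction with
  | mem x hx =>
    obtain ⟨p, rfl⟩ := hx
    rw [torusBasis_eq]
    exact (isToral_flat _).mul (isToral_shift _)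
  | zero => exact IsToral.zero
  | add x y _ _ hx hy => exact hx.add hy
  | smul a x _ hx => exact isToral_smul a hx

theorem flat_mul_shift_mem_torus (d : Fin m → ℂ) (k : ℤ) :
    flat d * shift ℂ m e k ∈ torus m e := by
  have h1 := res_add_mul_ediv (e := e) k
  -- Division with remainder k = eq + s turns ϖ_T^k into z^q ϖ_T^s with 0 ≤ s < e, including for
  -- negative k.
  have : flat d * shift ℂ m e k = ∑ j, (HahnSeries.single (k / (e : ℤ)) (d j) : ℂ⸨X⸩) •
      torusBasis m e (j, res e k) := by
    refine cf_ext fun ℓ α => ?_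
    rw [cf_sum, cf_flat_mul_shift]
    simp only [C_smul_eq, torusBasis_eq, cf_flat_mul_shift]
    by_cases hℓ : ℓ = k
    · have h2 : ℓ - e * (k / e) = ((res e k : ℕ) : ℤ) := by linarith
      simp only [if_pos hℓ, if_pos h2]
      ext i j
      rw [Matrix.sum_apply]
      by_cases hij : i = j
      · subst hij
        rw [Matrix.diagonal_apply_eq, Finset.sum_eq_single i]
        · simp
        · intro j _ hj; simp [Pi.single_eq_of_ne hj.symm]
        · simp
      · simp [hij]
    · rw [if_neg hℓ]
      refine (Finset.sum_eq_zero fun j _ => ?_).symm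
      have h2 : ¬ ℓ - e * (k / e) = ((res e k : ℕ) : ℤ) := fun h => hℓ (by linarith)
      rw [if_neg h2, smul_zero]
  rw [this]
  exact Submodule.sum_mem _ fun j _ => Submodule.smul_mem _ _ (Submodule.subset_span ⟨_, rfl⟩)

end Torus

/-! ### Cyclic difference operators -/

section Cyclic

variable {S : Type*} [CommRing S] {e r : ℕ}

theorem periodic_sub_mul {β : Type*} {f : ℤ → β} {c : ℤ}
    (hf : Function.Periodic f c) (k : ℕ) (α : ℤ) : f (α - k * c) = f α := by
  have := (hf.nat_mul k).sub_eq α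
  simpa using this

/-- By Bézout, 1 is an integer combination of the two periods. -/
theorem eq_const_of_periodic {β : Type*} {f : ℤ → β} (h : Nat.gcd r e = 1)
    (hr : Function.Periodic f (r : ℤ)) (he : Function.Periodic f (e : ℤ)) (α : ℤ) : f α = f 0 := by
  have hb : (1 : ℤ) = r * Nat.gcdA r e + e * Nat.gcdB r e := by
    rw [← Nat.gcd_eq_gcd_ab, h]; rfl
  have h1 : Function.Periodic f 1 := by
    rw [hb, mul_comm (r : ℤ), mul_comm (e : ℤ)]
    exact (hr.int_mul _).add_period (he.int_mul _)
  have := h1.int_mul α 0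
  simpa using this

/-- If `u ^ e - v ^ e` is invertible then so is `D ↦ u D - v D(· - r)` on `e`-periodic functions. -/
theorem exists_twisted_difference {u v : S} (h : IsUnit (u ^ e - v ^ e)) {D : ℤ → S}
    (hD : Function.Periodic D (e : ℤ)) :
    ∃ E : ℤ → S, Function.Periodic E (e : ℤ) ∧ ∀ α, u * E α - v * E (α - r) = D α := by
  obtain ⟨w, hw⟩ := h.exists_left_inv
  -- With T the translation by r, T^e = 1 on e-periodic functions, so u^e − v^e = u^e − (vT)^e
  -- factors as (u − vT) ∑ u^(e−1−k) (vT)^k. The inverse of u − vT is this sum times the inverse w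
  -- of the unit.
  refine ⟨fun α => w * ∑ k ∈ Finset.range e, u ^ (e - 1 - k) * v ^ k * D (α - k * r), ?_, ?_⟩
  · intro α
    simp only
    congr 1
    refine Finset.sum_congr rfl fun k _ => ?_
    rw [add_sub_right_comm, hD]
  · intro α
    have h1 : ∑ k ∈ Finset.range e, (u ^ (e - k) * v ^ k * D (α - k * r) -
        u ^ (e - (k + 1)) * v ^ (k + 1) * D (α - (k + 1 : ℕ) * r)) =
        u ^ (e - 0) * v ^ 0 * D (α - (0 : ℕ) * r) - u ^ (e - e) * v ^ e * D (α - (e : ℕ) * r) :=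
      Finset.sum_range_sub' (fun k => u ^ (e - k) * v ^ k * D (α - k * r)) e
    have h2 : D (α - (e : ℕ) * r) = D α := by
      rw [mul_comm]; exact periodic_sub_mul hD r α
    rw [h2] at h1
    calc _ = w * ∑ k ∈ Finset.range e, (u ^ (e - k) * v ^ k * D (α - k * r) -
        u ^ (e - (k + 1)) * v ^ (k + 1) * D (α - (k + 1 : ℕ) * r)) := by
          simp only [mul_left_comm _ w, ← mul_sub, Finset.mul_sum, ← Finset.sum_sub_distrib]
          refine Finset.sum_congr rfl fun k hk => ?_
          rw [Finset.mem_range] at hk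
          have h3 : e - k = (e - 1 - k) + 1 := by omega
          have h4 : e - (k + 1) = e - 1 - k := by omega
          have h5 : α - ((k + 1 : ℕ) : ℤ) * r = α - r - k * r := by push_cast; ring
          rw [h3, h4, h5]
          ring
      _ = (w * (u ^ e - v ^ e)) * D α := by rw [h1]; simp; ring
      _ = D α := by rw [hw, one_mul]

/-- After e iterations of the relation, periodicity returns to the starting point, leaving (u^e −
v^e) D = 0. -/
theorem eq_zero_of_twisted_difference {u v : S} (h : IsUnit (u ^ e - v ^ e)) {D : ℤ → S}
    (hD : Function.Periodic D (e : ℤ)) (hE : ∀ α, u * D α = v * D (α - r)) (α : ℤ) : D α = 0 := by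
  have h1 : ∀ k : ℕ, ∀ α, u ^ k * D α = v ^ k * D (α - k * r) := by
    intro k
    induction k with
    | zero => intro α; simp
    | succ k ih =>
      intro α
      have h5 : α - ((k + 1 : ℕ) : ℤ) * r = α - r - k * r := by push_cast; ring
      rw [pow_succ, mul_assoc, hE, h5, mul_left_comm, ih (α - r)]
      ring
  have h2 : D (α - (e : ℕ) * r) = D α := by
    rw [mul_comm]; exact periodic_sub_mul hD r α
  have h3 := h1 e α
  rw [h2] at h3
  exact h.mul_right_eq_zero.1 (by rw [sub_mul, h3, sub_self])

variable [Algebra ℂ S] [NeZero e]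

theorem isUnit_natCast (e : ℕ) [NeZero e] : IsUnit (e : S) := by
  have : IsUnit (e : ℂ) := IsUnit.mk0 _ (by exact_mod_cast NeZero.ne e)
  simpa using this.map (algebraMap ℂ S)

/-- The only obstruction to solving E − E(· − r) = D is the mean of D along the orbit of translation
by r, which is a constant because gcd(r, e) = 1. The constant d is this mean, and the weights e − 1
− k come from summation by parts. -/
theorem exists_cyclic_difference (h : Nat.gcd r e = 1) {D : ℤ → S}
    (hD : Function.Periodic D (e : ℤ)) :
    ∃ E : ℤ → S, Function.Periodic E (e : ℤ) ∧ ∃ d : S, ∀ α, E α - E (α - r) + d = D α := by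
  obtain ⟨w, hw⟩ := (isUnit_natCast (S := S) e).exists_left_inv
  have h2 : ∀ α, D (α - (e : ℕ) * r) = D α := fun α => by
    rw [mul_comm]; exact periodic_sub_mul hD r α
  let N : ℤ → S := fun α => ∑ k ∈ Finset.range e, D (α - k * r)
  have hN1 : ∀ α, ∑ k ∈ Finset.range e, D (α - (k + 1 : ℕ) * r) = N α := by
    intro α
    have := Finset.sum_range_succ' (fun k : ℕ => D (α - k * r)) e
    rw [Finset.sum_range_succ, h2] at this
    simpa using this.symm
  have hNe : Function.Periodic N (e : ℤ) := by
    intro α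
    refine Finset.sum_congr rfl fun k _ => ?_
    rw [add_sub_right_comm, hD]
  have hNr : Function.Periodic N (r : ℤ) := by
    intro α
    rw [← hN1]
    refine Finset.sum_congr rfl fun k _ => ?_
    congr 1
    push_cast
    ring
  have hN := eq_const_of_periodic h hNr hNe
  refine ⟨fun α => w * ∑ k ∈ Finset.range e, ((e : S) - 1 - k) * D (α - k * r), ?_, w * N 0, ?_⟩
  · intro α
    simp only
    congr 1
    refine Finset.sum_congr rfl fun k _ => ?_
    rw [add_sub_right_comm, hD]
  · intro α
    have h1 : ∑ k ∈ Finset.range e, (((e : S) - 1 - k) * D (α - k * r) -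
        ((e : S) - 1 - (k + 1 : ℕ)) * D (α - (k + 1 : ℕ) * r)) =
        ((e : S) - 1 - (0 : ℕ)) * D (α - (0 : ℕ) * r) - ((e : S) - 1 - e) * D (α - (e : ℕ) * r) :=
      Finset.sum_range_sub' (fun k : ℕ => ((e : S) - 1 - k) * D (α - k * r)) e
    rw [h2] at h1
    have h3 : ∑ k ∈ Finset.range e, (((e : S) - 1 - k) * D (α - k * r) -
        ((e : S) - 1 - k) * D (α - r - k * r)) = e * D α - N α := by
      have : ∀ k : ℕ, (((e : S) - 1 - k) * D (α - k * r) - ((e : S) - 1 - k) * D (α - r - k * r)) =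
          (((e : S) - 1 - k) * D (α - k * r) -
        ((e : S) - 1 - (k + 1 : ℕ)) * D (α - (k + 1 : ℕ) * r)) - D (α - (k + 1 : ℕ) * r) := by
        intro k
        have h5 : α - ((k + 1 : ℕ) : ℤ) * r = α - r - k * r := by push_cast; ring
        rw [h5]
        push_cast
        ring
      simp only [this]
      rw [Finset.sum_sub_distrib, h1, hN1]
      simp
      ring
    calc _ = w * ∑ k ∈ Finset.range e, (((e : S) - 1 - k) * D (α - k * r) -
        ((e : S) - 1 - k) * D (α - r - k * r)) + w * N 0 := by
          rw [Finset.sum_sub_distrib, mul_sub]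
      _ = (w * e) * D α := by rw [h3, hN α]; ring
      _ = D α := by rw [hw, one_mul]

/-- Summing over a full orbit gives e·d = 0, hence d = 0 since e is invertible; then D has both r
and e as periods. -/
theorem const_of_cyclic_difference (h : Nat.gcd r e = 1) {D : ℤ → S}
    (hD : Function.Periodic D (e : ℤ)) {d : S} (hd : ∀ α, D α - D (α - r) = d) (α : ℤ) :
    D α = D 0 := by
  have h1 : ∀ k : ℕ, ∀ α, D α - D (α - k * r) = k * d := by
    intro k
    induction k with
    | zero => intro α; simp
    | succ k ih =>
      intro α
      have h5 : α - ((k + 1 : ℕ) : ℤ) * r = α - r - k * r := by push_cast; ring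
      rw [h5]
      have := ih (α - r)
      have h6 := hd α
      push_cast
      linear_combination this + h6
  have h2 : D (0 - (e : ℕ) * r) = D 0 := by
    rw [mul_comm]; exact periodic_sub_mul hD r 0
  have h3 := h1 e 0
  rw [h2, sub_self] at h3
  have h4 : d = 0 := (isUnit_natCast e).mul_right_eq_zero.1 h3.symm
  refine eq_const_of_periodic h (fun β => ?_) hD α
  have := hd (β + r)
  rw [add_sub_cancel_right, h4, sub_eq_zero] at this
  exact this

end Cyclic

/-! ### The adjoint action of a regular leading term -/

section Leading

variable {S : Type*} [CommRing S] {m e r : ℕ}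

/-- The contribution of the grading derivation to the equation in degree `ℓ - r`, which is of
leading order only if `r = 0`. -/
def gradTerm (S : Type*) [CommRing S] (r : ℕ) (ℓ : ℤ) : S := if r = 0 then (ℓ : S) else 0

/-- The conditions on `c` that make `∑ c_j χ_j ϖ_T^{-r}` a regular leading term. -/
structure RegularLeading (r e : ℕ) (c : Fin m → S) : Prop where
  coprime : Nat.gcd r e = 1
  isUnit_sub : ∀ i j, i ≠ j → ∀ ℓ : ℤ, IsUnit ((c j - gradTerm S r ℓ) ^ e - c i ^ e)
  isUnit : e ≠ 1 → ∀ i, IsUnit (c i)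

variable [Algebra ℂ S] [NeZero e]

theorem RegularLeading.eq_one {c : Fin m → S} (hc : RegularLeading r e c) (hr : r = 0) :
    e = 1 := by
  have := hc.coprime
  rwa [hr, Nat.gcd_zero_left] at this

/-- The equation decouples into matrix entries. Off the diagonal it is an invertible twisted
difference. On the diagonal it is c_i times a cyclic difference, and the missing constant is
supplied by d. If e = 1, in particular if r = 0, diagonal entries are already constant and go
entirely into d, so c_i need not be a unit. -/
theorem RegularLeading.exists_preimage {c : Fin m → S} (hc : RegularLeading r e c) (ℓ : ℤ)
    {X : ℤ → Matrix (Fin m) (Fin m) S} (hX : Function.Periodic X (e : ℤ)) :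
    ∃ Y : ℤ → Matrix (Fin m) (Fin m) S, Function.Periodic Y (e : ℤ) ∧ ∃ d : Fin m → S, ∀ α,
      Y α * Matrix.diagonal c - Matrix.diagonal c * Y (α - r) - gradTerm S r ℓ • Y α
        + Matrix.diagonal d = X α := by
  have key : ∀ i j, ∃ E : ℤ → S, Function.Periodic E (e : ℤ) ∧ ∃ d : S, ∀ α,
      E α * c j - c i * E (α - r) - gradTerm S r ℓ * E α + (if i = j then d else 0) = X α i j := by
    intro i j
    have hXij : Function.Periodic (fun α => X α i j) (e : ℤ) := fun α => by
      simp only [hX α]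
    by_cases hij : i = j
    · subst hij
      simp only [if_true]
      by_cases he : e = 1
      · refine ⟨0, fun _ => rfl, X 0 i i, fun α => ?_⟩
        have h1 : X α = X 0 := eq_const_of_periodic (r := 1) (e := e) (by simp)
          (by rw [he] at hX; exact hX) hX α
        simp [h1]
      · have hr : r ≠ 0 := fun h => he (hc.eq_one h)
        obtain ⟨w, hw⟩ := (hc.isUnit he i).exists_left_inv
        obtain ⟨E, hE, d, hd⟩ := exists_cyclic_difference hc.coprime hXij
        refine ⟨fun α => w * E α, fun α => by simp only [hE α], d, fun α => ?_⟩
        rw [gradTerm, if_neg hr, zero_mul, sub_zero, ← hd α]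
        linear_combination (E α - E (α - r)) * hw
    · simp only [if_neg hij]
      obtain ⟨E, hE, hd⟩ := exists_twisted_difference (r := r) (hc.isUnit_sub i j hij ℓ) hXij
      refine ⟨E, hE, 0, fun α => ?_⟩
      rw [← hd α]
      ring
  choose E hE d hd using key
  refine ⟨fun α => Matrix.of fun i j => E i j α, fun α => ?_, fun i => d i i, fun α => ?_⟩
  · ext i j; exact hE i j α
  · ext i j
    rw [← hd i j α]
    simp only [Matrix.add_apply, Matrix.sub_apply, Matrix.mul_diagonal, Matrix.diagonal_mul,
      Matrix.of_apply, Matrix.smul_apply, smul_eq_mul, Matrix.diagonal_apply]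
    by_cases hij : i = j
    · subst hij; rfl
    · simp [hij]

/-- This is the uniqueness counterpart of `RegularLeading.exists_preimage`, with the same case
split: off-diagonal entries die by invertibility, and a diagonal entry whose cyclic difference is
constant is itself constant. -/
theorem RegularLeading.eq_diagonal {c : Fin m → S} (hc : RegularLeading r e c) (ℓ : ℤ)
    {Y : ℤ → Matrix (Fin m) (Fin m) S} (hY : Function.Periodic Y (e : ℤ)) {d : Fin m → S}
    (h : ∀ α, Y α * Matrix.diagonal c - Matrix.diagonal c * Y (α - r) - gradTerm S r ℓ • Y α
        = Matrix.diagonal d) (α : ℤ) : Y α = Matrix.diagonal fun i => Y 0 i i := by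
  have h1 : ∀ α i j, Y α i j * c j - c i * Y (α - r) i j - gradTerm S r ℓ * Y α i j =
      Matrix.diagonal d i j := by
    intro α i j
    rw [← h α]
    simp only [Matrix.sub_apply, Matrix.mul_diagonal, Matrix.diagonal_mul, Matrix.smul_apply,
      smul_eq_mul]
  ext i j
  have hYij : Function.Periodic (fun α => Y α i j) (e : ℤ) := fun α => by
    simp only [hY α]
  by_cases hij : i = j
  · subst hij
    rw [Matrix.diagonal_apply_eq]
    by_cases he : e = 1
    · rw [eq_const_of_periodic (r := 1) (e := e) (by simp) (by rw [he] at hY; exact hY) hY α]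
    · have hr : r ≠ 0 := fun h => he (hc.eq_one h)
      obtain ⟨w, hw⟩ := (hc.isUnit he i).exists_left_inv
      refine const_of_cyclic_difference (d := w * d i) hc.coprime hYij (fun β => ?_) α
      have := h1 β i i
      rw [gradTerm, if_neg hr, zero_mul, sub_zero, Matrix.diagonal_apply_eq] at this
      linear_combination w * this - (Y β i i - Y (β - r) i i) * hw
  · rw [Matrix.diagonal_apply_ne _ hij]
    refine eq_zero_of_twisted_difference (r := r) (hc.isUnit_sub i j hij ℓ) hYij (fun β => ?_) α
    have := h1 β i j
    rw [Matrix.diagonal_apply_ne _ hij] at this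
    linear_combination this

end Leading

/-! ### Recursive construction of matrices -/

section Recursion

/-- Recursion where each stage makes a choice depending on all earlier ones. As `Q n` sees only
terms of index at most n, successive finite solutions can be extended and the n-th term read off at
stage n + 1. -/
theorem exists_seq {X : Type*} [Nonempty X] (Q : ℕ → (ℕ → X) → Prop)
    (hcongr : ∀ n p q, (∀ i ≤ n, p i = q i) → Q n p → Q n q)
    (hex : ∀ n p, (∀ k < n, Q k p) → ∃ x, Q n (Function.update p n x)) :
    ∃ p, ∀ n, Q n p := by
  classical
  have step : ∀ n (p : {p : ℕ → X // ∀ k < n, Q k p}),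
      ∃ p' : {p : ℕ → X // ∀ k < n + 1, Q k p}, ∀ k < n, p'.1 k = p.1 k := by
    rintro n ⟨p, hp⟩
    obtain ⟨x, hx⟩ := hex n p hp
    refine ⟨⟨Function.update p n x, fun k hk => ?_⟩, fun k hk => ?_⟩
    · rcases Nat.lt_succ_iff_lt_or_eq.1 hk with hk | rfl
      · refine hcongr k p _ (fun i hi => ?_) (hp k hk)
        rw [Function.update_of_ne (by omega)]
      · exact hx
    · exact Function.update_of_ne (by omega) _ _
  choose next hnext using step
  let P : ∀ n, {p : ℕ → X // ∀ k < n, Q k p} := fun n =>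
    Nat.rec ⟨fun _ => Classical.arbitrary X, fun k hk => absurd hk (Nat.not_lt_zero k)⟩ next n
  have hP : ∀ n k, k < n → ∀ l, n ≤ l → (P l).1 k = (P n).1 k := by
    intro n k hk l hl
    induction l, hl using Nat.le_induction with
    | base => rfl
    | succ l hl ih => rw [← ih]; exact hnext l (P l) k (by omega)
  refine ⟨fun n => (P (n + 1)).1 n, fun n => ?_⟩
  refine hcongr n _ _ (fun i hi => ?_) ((P (n + 1)).2 n (Nat.lt_succ_self n))
  exact hP (i + 1) i (Nat.lt_succ_self i) (n + 1) (by omega)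

theorem sum_Icc_eq_sum_range {M : Type*} [AddCommMonoid M] (N : ℤ) (n : ℕ) (f : ℤ → M) :
    ∑ p ∈ Finset.Icc N (N + n), f p = ∑ k ∈ Finset.range (n + 1), f (N + k) := by
  refine (Finset.sum_nbij (fun k : ℕ => N + k) ?_ ?_ ?_ ?_).symm
  · intro k hk
    rw [Finset.mem_range] at hk
    rw [Finset.mem_Icc]
    omega
  · intro a _ b _ h
    simp only at h
    omega
  · intro p hp
    rw [Finset.coe_Icc, Set.mem_Icc] at hp
    refine ⟨(p - N).toNat, ?_, ?_⟩
    · rw [Finset.coe_range, Set.mem_Iio]; omega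
    · simp only; omega
  · intro k _; rfl

variable {S : Type*} [CommRing S] {m e : ℕ} [NeZero e]

/-- Periodic functions with values in `m × m` matrices. -/
abbrev PeriodicMat (S : Type*) [CommRing S] (m e : ℕ) : Type _ :=
  {D : ℤ → Matrix (Fin m) (Fin m) S // Function.Periodic D (e : ℤ)}

instance : Nonempty (PeriodicMat S m e) := ⟨⟨0, fun _ => rfl⟩⟩

/-- The matrix with given components in degrees `N, N + 1, …`. -/
def ofSeq (N : ℤ) (u : ℕ → PeriodicMat S m e) : Mat S m e :=
  ofCf m e N fun ℓ => (u (ℓ - N).toNat).1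

theorem cf_ofSeq (N : ℤ) (u : ℕ → PeriodicMat S m e) (k : ℕ) (α : ℤ) :
    cf (ofSeq N u) (N + k) α = (u k).1 α := by
  rw [ofSeq, cf_ofCf _ fun ℓ => (u _).2, if_neg (by omega), add_sub_cancel_left, Int.toNat_natCast]

theorem ofSeq_mem_parahoric (N : ℤ) (u : ℕ → PeriodicMat S m e) :
    ofSeq N u ∈ parahoric S m e N := ofCf_mem_parahoric _ fun _ => (u _).2

theorem cf_mul_range {X Y : Mat S m e} {M N : ℤ} (hX : X ∈ parahoric S m e M)
    (hY : Y ∈ parahoric S m e N) (n : ℕ) (α : ℤ) : cf (X * Y) (M + N + n) α =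
      ∑ k ∈ Finset.range (n + 1), cf X (M + k) α * cf Y (N + (n - k : ℤ)) (α + (M + k)) := by
  have h : M + N + n - N = M + n := by ring
  rw [cf_mul hX hY, h, sum_Icc_eq_sum_range]
  refine Finset.sum_congr rfl fun k _ => ?_
  congr 2
  ring

theorem ext_of_mem_parahoric {X Y : Mat S m e} {N : ℤ} (hX : X ∈ parahoric S m e N)
    (hY : Y ∈ parahoric S m e N) (h : ∀ (n : ℕ) α, cf X (N + n) α = cf Y (N + n) α) : X = Y := by
  refine cf_ext fun ℓ α => ?_
  by_cases hℓ : ℓ < N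
  · rw [mem_parahoric_iff.1 hX ℓ hℓ, mem_parahoric_iff.1 hY ℓ hℓ]
  · have := h (ℓ - N).toNat α
    rwa [show N + ((ℓ - N).toNat : ℤ) = ℓ by omega] at this

theorem cf_zero_of_sub_one_mem {X : Mat S m e} (hX : X - 1 ∈ parahoric S m e 1) (α : ℤ) :
    cf X 0 α = 1 := by
  have := mem_parahoric_iff.1 hX 0 (by norm_num) α
  rwa [cf_sub, cf_one, if_pos rfl, sub_eq_zero] at this

theorem mem_parahoric_of_sub_one_mem {X : Mat S m e} (hX : X - 1 ∈ parahoric S m e 1) :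
    X ∈ parahoric S m e 0 := by
  have := Submodule.add_mem _ (parahoric_anti (by norm_num) hX) (one_mem_parahoric (S := S))
  rwa [sub_add_cancel] at this

theorem sub_one_mem_of_cf {X : Mat S m e} (hX : X ∈ parahoric S m e 0) (h : ∀ α, cf X 0 α = 1) :
    X - 1 ∈ parahoric S m e 1 := by
  rw [mem_parahoric_iff] at *
  intro ℓ hℓ α
  rw [cf_sub, cf_one]
  rcases (Int.lt_add_one_iff.1 hℓ : ℓ ≤ 0).lt_or_eq with h0 | rfl
  · rw [hX ℓ h0, if_neg h0.ne, sub_zero]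
  · rw [h, if_pos rfl, sub_self]

/-- Elements of `1 + 𝔓^1` are invertible. -/
theorem exists_GLF {X : Mat S m e} (hX : X - 1 ∈ parahoric S m e 1) :
    ∃ p : GLF S m e, (p : Mat S m e) = X ∧ InP1 p ∧
      ((p⁻¹ : GLF S m e) : Mat S m e) - 1 ∈ parahoric S m e 1 := by
  have hX0 := mem_parahoric_of_sub_one_mem hX
  -- The degree-zero part of X is 1, so XY = 1 in degree n expresses the degree n part of Y through
  -- the lower ones.
  obtain ⟨y, hy⟩ := exists_seq (X := PeriodicMat S m e)
    (fun n y => ∀ α, (y n).1 α = (if n = 0 then 1 else 0)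
      - ∑ j ∈ Finset.range n, cf X (n - j : ℤ) α * (y j).1 (α + (n - j : ℤ)))
    (fun n p q hpq h α => by
      rw [← hpq n le_rfl, h α]
      congr 1
      refine Finset.sum_congr rfl fun j hj => ?_
      rw [hpq j (Finset.mem_range.1 hj).le])
    (fun n p _ => by
      refine ⟨⟨fun α => (if n = 0 then 1 else 0)
        - ∑ j ∈ Finset.range n, cf X (n - j : ℤ) α * (p j).1 (α + (n - j : ℤ)), fun α => ?_⟩, ?_⟩
      · simp only
        congr 1
        refine Finset.sum_congr rfl fun j _ => ?_
        rw [cf_periodic, add_right_comm, (p j).2]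
      · intro α
        rw [Function.update_self]
        simp only
        congr 1
        refine Finset.sum_congr rfl fun j hj => ?_
        rw [Function.update_of_ne (Finset.mem_range.1 hj).ne])
  have hY := ofSeq_mem_parahoric 0 y
  have hXY : X * ofSeq 0 y = 1 := by
    refine ext_of_mem_parahoric (N := 0 + 0) (mul_mem_parahoric hX0 hY)
      (by simpa using one_mem_parahoric) fun n α => ?_
    rw [cf_mul_range hX0 hY, ← Finset.sum_range_reflect, Finset.sum_range_succ, cf_one]
    have h1 : ∀ j ∈ Finset.range n, cf X (0 + ((n + 1 - 1 - j : ℕ) : ℤ)) α *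
        cf (ofSeq 0 y) (0 + (n - ((n + 1 - 1 - j : ℕ) : ℤ) : ℤ))
          (α + (0 + ((n + 1 - 1 - j : ℕ) : ℤ))) =
        cf X (n - j : ℤ) α * (y j).1 (α + (n - j : ℤ)) := by
      intro j hj
      rw [Finset.mem_range] at hj
      have h2 : ((n + 1 - 1 - j : ℕ) : ℤ) = n - j := by omega
      rw [h2, sub_sub_cancel, cf_ofSeq, zero_add]
    have h2 : ((n + 1 - 1 - n : ℕ) : ℤ) = 0 := by omega
    rw [Finset.sum_congr rfl h1, h2, add_zero, add_zero, sub_zero, cf_ofSeq,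
      cf_zero_of_sub_one_mem hX, one_mul, hy n α]
    by_cases hn : n = 0
    · subst hn; simp
    · simp [hn]
  refine ⟨⟨X, ofSeq 0 y, hXY, mul_eq_one_comm.1 hXY⟩, rfl, hX, ?_⟩
  refine sub_one_mem_of_cf hY fun α => ?_
  have := cf_ofSeq 0 y 0 α
  rw [Nat.cast_zero, add_zero] at this
  change cf (ofSeq 0 y) 0 α = 1
  rw [this, hy 0 α]
  simp

end Recursion

/-! ### Formal reduction to the Cartan subalgebra -/

section Reduction

variable {S : Type*} [CommRing S] [Algebra ℂ S] {m e r : ℕ} [NeZero e]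

theorem RegularLeading.algebraMap_eq {c : Fin m → S} (hc : RegularLeading r e c) (hr : r = 0)
    (ℓ : ℤ) : algebraMap ℂ S ((ℓ : ℂ) / e) = gradTerm S r ℓ := by
  rw [hc.eq_one hr, gradTerm, if_pos hr]
  simp

/-- A connection matrix with regular leading term is gauge equivalent to a toral one. -/
theorem RegularLeading.exists_toral {c : Fin m → S} (hc : RegularLeading r e c) {a : Mat S m e}
    (ha : a ∈ parahoric S m e (-r)) (hac : ∀ α, cf a (-r) α = Matrix.diagonal c) :
    ∃ X A : Mat S m e, X - 1 ∈ parahoric S m e 1 ∧ A ∈ parahoric S m e (-r) ∧ IsToral A ∧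
      (∀ α, cf A (-r) α = Matrix.diagonal c) ∧ X * a - gradDeriv X = A * X := by
  -- Stage n produces a pair: the degree n part of X and the diagonal value of A in degree n − r.
  -- The condition is Xa − δX = AX in degree n − r.
  obtain ⟨u, hu⟩ := exists_seq (X := PeriodicMat S m e × (Fin m → S))
    (fun n u => (n = 0 → (u 0).1.1 = 1 ∧ (u 0).2 = c) ∧ ∀ α,
      ∑ k ∈ Finset.range (n + 1), (u k).1.1 α * cf a (-r + (n - k : ℤ)) (α + k)
      - (if r ≤ n then algebraMap ℂ S (((n - r : ℤ) : ℂ) / e) • (u (n - r)).1.1 α else 0)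
      - ∑ k ∈ Finset.range (n + 1),
          Matrix.diagonal (u k).2 * (u (n - k)).1.1 (α + (-r + k : ℤ)) = 0)
    (fun n p q hpq h => by
      refine ⟨fun hn => by rw [← hpq 0 (Nat.zero_le n)]; exact h.1 hn, fun α => ?_⟩
      refine Eq.trans ?_ (h.2 α)
      rw [← hpq (n - r) (Nat.sub_le n r)]
      congr 1
      · congr 1
        refine Finset.sum_congr rfl fun k hk => ?_
        rw [hpq k (Nat.lt_succ_iff.1 (Finset.mem_range.1 hk))]
      · refine Finset.sum_congr rfl fun k hk => ?_
        rw [hpq k (Nat.lt_succ_iff.1 (Finset.mem_range.1 hk)), hpq (n - k) (Nat.sub_le n k)])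
    (fun n p hp => by
      rcases n with _ | n
      · refine ⟨(⟨1, fun _ => rfl⟩, c), fun _ => by rw [Function.update_self]; exact ⟨rfl, rfl⟩,
          fun α => ?_⟩
        simp only [zero_add, Finset.sum_range_one, Nat.zero_sub, Function.update_self]
        have h0 : (if r ≤ 0 then algebraMap ℂ S ((((0 : ℕ) - r : ℤ) : ℂ) / e) •
            (1 : ℤ → Matrix (Fin m) (Fin m) S) α else 0) = 0 := by
          split_ifs with h
          · rw [Nat.le_zero.1 h]; simp
          · rfl
        rw [h0]
        simp [hac]
      · have hp0 := (hp 0 (Nat.succ_pos n)).1 rfl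
        -- `S1`, `S2`, `S3` collect the contributions of earlier stages to Xa, δX and AX. `S2` is
        -- switched off when r = 0, where δ acts on the unknown part itself; that term is
        -- `gradTerm`.
        let S1 : ℤ → Matrix (Fin m) (Fin m) S := fun α => ∑ k ∈ Finset.range (n + 1),
          (p k).1.1 α * cf a (-r + ((n + 1 : ℕ) - k : ℤ)) (α + k)
        let S2 : ℤ → Matrix (Fin m) (Fin m) S := fun α => if r ≤ n + 1 ∧ r ≠ 0 then
          algebraMap ℂ S ((((n + 1 : ℕ) - r : ℤ) : ℂ) / e) • (p (n + 1 - r)).1.1 α else 0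
        let S3 : ℤ → Matrix (Fin m) (Fin m) S := fun α => ∑ k ∈ Finset.range n,
          Matrix.diagonal (p (k + 1)).2 *
            (p (n + 1 - (k + 1))).1.1 (α + (-r + (k + 1 : ℕ) : ℤ))
        have hG : Function.Periodic (fun α => S3 α + S2 α - S1 α) (e : ℤ) := by
          intro α
          have h1 : S1 (α + e) = S1 α := Finset.sum_congr rfl fun k _ => by
            rw [(p k).1.2, add_right_comm, cf_periodic]
          have h2 : S2 (α + e) = S2 α := by simp only [S2, (p (n + 1 - r)).1.2 α]
          have h3 : S3 (α + e) = S3 α := Finset.sum_congr rfl fun k _ => by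
            rw [add_right_comm, (p _).1.2]
          simp only [h1, h2, h3]
        obtain ⟨Y, hY, d, hd⟩ := hc.exists_preimage ((n + 1 : ℕ) : ℤ) hG
        -- The sign is negative because AX enters the equation with a minus sign.
        refine ⟨(⟨Y, hY⟩, -d), fun h => absurd h (Nat.succ_ne_zero n), fun α => ?_⟩
        set v := Function.update p (n + 1) (⟨Y, hY⟩, -d) with hv
        have hvn : v (n + 1) = (⟨Y, hY⟩, -d) := Function.update_self _ _ _
        have hvk : ∀ k, k ≠ n + 1 → v k = p k := fun k hk => Function.update_of_ne hk _ _
        have e1 : ∑ k ∈ Finset.range (n + 1 + 1),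
            (v k).1.1 α * cf a (-r + ((n + 1 : ℕ) - k : ℤ)) (α + k) =
            S1 α + Y α * Matrix.diagonal c := by
          rw [Finset.sum_range_succ, hvn, sub_self, add_zero, hac]
          congr 1
          refine Finset.sum_congr rfl fun k hk => ?_
          rw [hvk k (Finset.mem_range.1 hk).ne]
        have e2 : (if r ≤ n + 1 then algebraMap ℂ S ((((n + 1 : ℕ) - r : ℤ) : ℂ) / e) •
            (v (n + 1 - r)).1.1 α else 0) = S2 α + gradTerm S r ((n + 1 : ℕ) : ℤ) • Y α := by
          by_cases hr : r = 0
          · have h1 := hc.algebraMap_eq hr ((n + 1 : ℕ) : ℤ)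
            have h2 : ((n + 1 : ℕ) : ℤ) - (r : ℤ) = (n + 1 : ℕ) := by rw [hr]; simp
            have h3 : n + 1 - r = n + 1 := by omega
            simp only [S2]
            rw [if_pos (by omega), if_neg (by tauto), h2, h1, h3, hvn, zero_add]
          · simp only [S2, gradTerm, if_neg hr, zero_smul, add_zero]
            rw [hvk (n + 1 - r) (by omega)]
            simp [hr]
        have e3 : ∑ k ∈ Finset.range (n + 1 + 1),
            Matrix.diagonal (v k).2 * (v (n + 1 - k)).1.1 (α + (-r + k : ℤ)) =
            S3 α + Matrix.diagonal c * Y (α - r) - Matrix.diagonal d := by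
          rw [Finset.sum_range_succ, Finset.sum_range_succ', hvn, Nat.sub_self, Nat.sub_zero, hvn,
            hvk 0 (by omega), hp0.1, hp0.2]
          have h1 : ∀ k ∈ Finset.range n, Matrix.diagonal (v (k + 1)).2 *
              (v (n + 1 - (k + 1))).1.1 (α + (-r + (k + 1 : ℕ) : ℤ)) =
              Matrix.diagonal (p (k + 1)).2 *
              (p (n + 1 - (k + 1))).1.1 (α + (-r + (k + 1 : ℕ) : ℤ)) := by
            intro k hk
            rw [Finset.mem_range] at hk
            rw [hvk _ (by omega), hvk _ (by omega)]
          rw [Finset.sum_congr rfl h1, Nat.cast_zero, add_zero, ← sub_eq_add_neg, Pi.one_apply,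
            mul_one, sub_eq_add_neg _ (Matrix.diagonal d), Matrix.diagonal_neg]
          rfl
        have e4 := hd α
        rw [e1, e2, e3]
        rw [← sub_eq_zero] at e4
        rw [← e4]
        abel)
  let X : Mat S m e := ofSeq 0 fun n => (u n).1
  let A : Mat S m e := ofSeq (-r) fun n => ⟨fun _ => Matrix.diagonal (u n).2, fun _ => rfl⟩
  have hX0 : X ∈ parahoric S m e 0 := ofSeq_mem_parahoric _ _
  have hA : A ∈ parahoric S m e (-r) := ofSeq_mem_parahoric _ _
  have hXcf : ∀ (k : ℕ) α, cf X k α = (u k).1.1 α := fun k α => by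
    have := cf_ofSeq 0 (fun n => (u n).1) k α
    rwa [zero_add] at this
  have hAcf : ∀ (k : ℕ) α, cf A (-r + k) α = Matrix.diagonal (u k).2 := fun k α => cf_ofSeq _ _ k α
  obtain ⟨hu1, hu2⟩ := (hu 0).1 rfl
  refine ⟨X, A, sub_one_mem_of_cf hX0 fun α => ?_, hA, ?_, fun α => ?_, ?_⟩
  · have := hXcf 0 α
    rw [Nat.cast_zero] at this
    rw [this, hu1]; rfl
  · refine ⟨fun ℓ => if ℓ < -r then 0 else (u (ℓ + r).toNat).2, fun ℓ α => ?_⟩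
    by_cases h : ℓ < -r
    · rw [mem_parahoric_iff.1 hA ℓ h]
      simp [if_pos h]
    · have := hAcf (ℓ + r).toNat α
      rw [show -(r : ℤ) + ((ℓ + r).toNat : ℤ) = ℓ by omega] at this
      rw [this]
      simp [if_neg h]
  · have := hAcf 0 α
    rw [Nat.cast_zero, add_zero, hu2] at this
    exact this
  · have hXa := mul_mem_parahoric hX0 ha
    have hAX := mul_mem_parahoric hA hX0
    rw [zero_add] at hXa
    rw [add_zero] at hAX
    refine ext_of_mem_parahoric (Submodule.sub_mem _ hXa (gradDeriv_mem_parahoric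
      (parahoric_anti (by omega) hX0))) hAX fun n α => ?_
    have h1 := cf_mul_range hX0 ha n α
    have h2 := cf_mul_range hA hX0 n α
    rw [zero_add] at h1
    rw [add_zero] at h2
    rw [cf_sub, h1, h2, cf_gradDeriv, ← sub_eq_zero, ← (hu n).2 α]
    congr 1
    · congr 1
      · refine Finset.sum_congr rfl fun k _ => ?_
        rw [zero_add, hXcf]
      · split_ifs with h
        · have h3 : -(r : ℤ) + n = ((n - r : ℕ) : ℤ) := by omega
          have h4 : (n : ℤ) - r = ((n - r : ℕ) : ℤ) := by omega
          rw [h3, h4, hXcf]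
        · rw [mem_parahoric_iff.1 hX0 _ (by omega), smul_zero]
    · refine Finset.sum_congr rfl fun k hk => ?_
      rw [Finset.mem_range] at hk
      rw [hAcf, zero_add, show (n : ℤ) - k = ((n - k : ℕ) : ℤ) by omega, hXcf]

/-- A toral connection matrix is gauge equivalent to its part of degree `≤ 0`. -/
theorem exists_truncation {A : Mat S m e} (hA : A ∈ parahoric S m e (-r)) (hAt : IsToral A) :
    ∃ X B : Mat S m e, X - 1 ∈ parahoric S m e 1 ∧ B ∈ parahoric S m e (-r) ∧ IsToral B ∧
      (∀ ℓ ≤ 0, ∀ α, cf B ℓ α = cf A ℓ α) ∧ (∀ ℓ, 0 < ℓ → ∀ α, cf B ℓ α = 0) ∧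
      X * A - gradDeriv X = B * X := by
  obtain ⟨c, hc⟩ := hAt
  have hper : ∀ ℓ, Function.Periodic (fun _ : ℤ => if ℓ ≤ 0 then Matrix.diagonal (c ℓ) else 0)
    (e : ℤ) := fun _ _ => rfl
  let B : Mat S m e := ofCf m e (-r) fun ℓ _ => if ℓ ≤ 0 then Matrix.diagonal (c ℓ) else 0
  have hB : B ∈ parahoric S m e (-r) := ofCf_mem_parahoric _ hper
  have hBcf : ∀ ℓ α, cf B ℓ α = if ℓ ≤ 0 then cf A ℓ α else 0 := by
    intro ℓ α
    rw [cf_ofCf _ hper]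
    by_cases h : ℓ < -r
    · rw [if_pos h, mem_parahoric_iff.1 hA ℓ h]; simp
    · rw [if_neg h, hc]
  have hBt : IsToral B := ⟨fun ℓ => if ℓ ≤ 0 then c ℓ else 0, fun ℓ α => by
    rw [hBcf]; split_ifs with h <;> simp [h, hc]⟩
  have hAB : A - B ∈ parahoric S m e 1 := by
    rw [mem_parahoric_iff]
    intro ℓ hℓ α
    rw [cf_sub, hBcf, if_pos (by omega), sub_self]
  -- For commuting matrices the gauge equation reduces to δX = X(A − B) with A − B in degrees ≥ 1.
  -- In degree n it reads (n/e) x_n = ∑_{k<n} x_k c_{n−k}, which is solvable because n is invertible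
  -- for n ≥ 1.
  obtain ⟨x, hx⟩ := exists_seq (X := Fin m → S)
    (fun n x => x n = if n = 0 then 1 else
      algebraMap ℂ S ((e : ℂ) / n) • ∑ k ∈ Finset.range n, x k * c (n - k : ℤ))
    (fun n p q hpq h => by
      rw [← hpq n le_rfl, h]
      congr 2
      refine Finset.sum_congr rfl fun k hk => ?_
      rw [hpq k (Finset.mem_range.1 hk).le])
    (fun n p _ => ⟨if n = 0 then 1 else
      algebraMap ℂ S ((e : ℂ) / n) • ∑ k ∈ Finset.range n, p k * c (n - k : ℤ), by
      rw [Function.update_self]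
      congr 2
      refine Finset.sum_congr rfl fun k hk => ?_
      rw [Function.update_of_ne (Finset.mem_range.1 hk).ne]⟩)
  let X : Mat S m e := ofSeq 0 fun n => ⟨fun _ => Matrix.diagonal (x n), fun _ => rfl⟩
  have hX0 : X ∈ parahoric S m e 0 := ofSeq_mem_parahoric _ _
  have hXcf : ∀ (k : ℕ) α, cf X k α = Matrix.diagonal (x k) := fun k α => by
    have := cf_ofSeq 0 (fun n => (⟨fun _ => Matrix.diagonal (x n), fun _ => rfl⟩ :
      PeriodicMat S m e)) k α
    rwa [zero_add] at this
  have hXt : IsToral X := by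
    refine ⟨fun ℓ => if ℓ < 0 then 0 else x ℓ.toNat, fun ℓ α => ?_⟩
    by_cases h : ℓ < 0
    · rw [mem_parahoric_iff.1 hX0 ℓ h]
      simp [if_pos h]
    · have := hXcf ℓ.toNat α
      rw [show (ℓ.toNat : ℤ) = ℓ by omega] at this
      rw [this]
      simp [if_neg h]
  have hX1 : X - 1 ∈ parahoric S m e 1 := sub_one_mem_of_cf hX0 fun α => by
    have := hXcf 0 α
    rw [Nat.cast_zero, hx 0] at this
    rw [this]
    simp
  have key : gradDeriv X = X * (A - B) := by
    have hXAB := mul_mem_parahoric hX0 hAB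
    rw [zero_add] at hXAB
    refine ext_of_mem_parahoric (gradDeriv_mem_parahoric hX0) (parahoric_anti (by norm_num) hXAB)
      fun n α => ?_
    rw [zero_add, cf_gradDeriv, hXcf]
    rcases n with _ | n
    · rw [mem_parahoric_iff.1 hXAB _ (by norm_num)]; simp
    · have h1 := cf_mul_range hX0 hAB n α
      rw [show (0 : ℤ) + 1 + n = (n + 1 : ℕ) by push_cast; ring] at h1
      have hn : ((n + 1 : ℕ) : ℂ) ≠ 0 := by exact_mod_cast Nat.succ_ne_zero n
      have he : (e : ℂ) ≠ 0 := by exact_mod_cast NeZero.ne e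
      rw [h1, hx (n + 1), if_neg (Nat.succ_ne_zero n), ← Matrix.diagonal_smul, smul_smul,
        ← map_mul, Int.cast_natCast, div_mul_div_cancel₀ he, div_self hn, map_one, one_smul]
      have h2 : ∀ k ∈ Finset.range (n + 1), cf X (0 + k) α *
          cf (A - B) (1 + (n - k : ℤ)) (α + (0 + k)) =
          Matrix.diagonal (x k * c ((n + 1 : ℕ) - k : ℤ)) := by
        intro k hk
        rw [Finset.mem_range] at hk
        rw [zero_add, hXcf, cf_sub, hBcf, if_neg (by omega), sub_zero, hc,
          Matrix.diagonal_mul_diagonal, show 1 + ((n : ℤ) - k) = (n + 1 : ℕ) - k by push_cast; ring]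
        rfl
      rw [Finset.sum_congr rfl h2]
      exact map_sum (Matrix.diagonalAddMonoidHom (Fin m) S) _ _
  refine ⟨X, B, hX1, hB, hBt, fun ℓ hℓ α => by rw [hBcf, if_pos hℓ],
    fun ℓ hℓ α => by rw [hBcf, if_neg (by omega)], ?_⟩
  rw [key, mul_sub, sub_sub_cancel, hXt.commute hBt]

/-- Subtracting H_T from both source and target replaces z∂_z by z∂_z + ad H_T, which acts by a
scalar in each degree. -/
theorem gaugeZ_eq_iff (p : GLF S m e) (a A : Mat S m e) :
    gaugeZ p a = A + HT S m e ↔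
      (p : Mat S m e) * (a - HT S m e) - gradDeriv (p : Mat S m e) = A * (p : Mat S m e) := by
  have h1 : gaugeZ p a = ((p : Mat S m e) * a - (p : Mat S m e).map zDeriv) *
      ((p⁻¹ : GLF S m e) : Mat S m e) := by rw [gaugeZ, sub_mul]
  have h2 : (p : Mat S m e) * (a - HT S m e) - gradDeriv (p : Mat S m e) =
      ((p : Mat S m e) * a - (p : Mat S m e).map zDeriv) - HT S m e * p := by
    rw [gradDeriv]; noncomm_ring
  rw [h1, h2, sub_eq_iff_eq_add, ← add_mul, Units.mul_inv_eq_iff_eq_mul]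

/-- Formal reduction: a connection matrix with regular leading term is gauge equivalent, by an
element of `P^1`, to `A + H_T` with `A` toral of degrees between `-r` and `0`. -/
theorem RegularLeading.exists_gaugeZ {c : Fin m → S} (hc : RegularLeading r e c) {a : Mat S m e}
    (ha : a - HT S m e ∈ parahoric S m e (-r))
    (hac : ∀ α, cf (a - HT S m e) (-r) α = Matrix.diagonal c) :
    ∃ (p : GLF S m e) (A : Mat S m e), InP1 p ∧
      ((p⁻¹ : GLF S m e) : Mat S m e) - 1 ∈ parahoric S m e 1 ∧
      A ∈ parahoric S m e (-r) ∧ IsToral A ∧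
      (∀ α, cf A (-r) α = Matrix.diagonal c) ∧ (∀ ℓ, 0 < ℓ → ∀ α, cf A ℓ α = 0) ∧
      gaugeZ p a = A + HT S m e := by
  obtain ⟨X, A, hX, hA, hAt, hAc, hXA⟩ := hc.exists_toral ha hac
  obtain ⟨Y, B, hY, hB, hBt, hBc, hB0, hYB⟩ := exists_truncation hA hAt
  have hYX : Y * X - 1 ∈ parahoric S m e 1 := by
    have h1 := mul_mem_parahoric (mem_parahoric_of_sub_one_mem hY) hX
    rw [zero_add] at h1
    have := Submodule.add_mem _ h1 hY
    rwa [mul_sub, mul_one, sub_add_sub_cancel] at this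
  obtain ⟨p, hp, hp1, hp2⟩ := exists_GLF hYX
  refine ⟨p, B, hp1, hp2, hB, hBt, fun α => ?_, hB0, ?_⟩
  · rw [hBc _ (by omega), hAc]
  · rw [gaugeZ_eq_iff, hp, gradDeriv_mul]
    calc Y * X * (a - HT S m e) - (gradDeriv Y * X + Y * gradDeriv X) =
        Y * (X * (a - HT S m e) - gradDeriv X) - gradDeriv Y * X := by noncomm_ring
      _ = (Y * A - gradDeriv Y) * X := by rw [hXA]; noncomm_ring
      _ = B * (Y * X) := by rw [hYB, mul_assoc]

/-- A solution of `δ B + [A, B] = C` with `A`, `C` toral and `A` regular is toral. -/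
theorem RegularLeading.isToral_of_flat {c : Fin m → S} (hc : RegularLeading r e c)
    {A B C : Mat S m e} (hA : A ∈ parahoric S m e (-r)) (hAt : IsToral A)
    (hAc : ∀ α, cf A (-r) α = Matrix.diagonal c) (hC : IsToral C)
    (h : gradDeriv B + (A * B - B * A) = C) : IsToral B := by
  obtain ⟨d, hd⟩ := hC
  obtain ⟨N, hN⟩ := exists_mem_parahoric B
  have key : ∀ (k : ℕ) α, cf B (N + k) α = Matrix.diagonal fun i => cf B (N + k) 0 i i := by
    intro k
    induction k using Nat.strong_induction_on with
    | _ k ih =>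
      -- `B1` is the part of B in degrees below N + k, toral by induction, so it commutes with A.
      -- Hence only B − `B1` enters the commutator, and in degree N + k − r only its lowest term
      -- meets the leading term of A.
      let D : ℤ → ℤ → Matrix (Fin m) (Fin m) S := fun ℓ _ =>
        if ℓ < N + k then Matrix.diagonal fun i => cf B ℓ 0 i i else 0
      have hD : ∀ ℓ, Function.Periodic (D ℓ) (e : ℤ) := fun _ _ => rfl
      let B1 : Mat S m e := ofCf m e N D
      have hB1 : ∀ ℓ α, cf B1 ℓ α = if ℓ < N + k then cf B ℓ α else 0 := by
        intro ℓ α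
        rw [cf_ofCf N hD]
        by_cases h1 : ℓ < N
        · rw [if_pos h1, mem_parahoric_iff.1 hN ℓ h1]; simp
        · rw [if_neg h1]
          simp only [D]
          by_cases h2 : ℓ < N + k
          · rw [if_pos h2, if_pos h2]
            have := ih (ℓ - N).toNat (by omega) α
            rw [show N + ((ℓ - N).toNat : ℤ) = ℓ by omega] at this
            exact this.symm
          · rw [if_neg h2, if_neg h2]
      have hB1t : IsToral B1 := by
        refine ⟨fun ℓ => if ℓ < N then 0 else if ℓ < N + k then fun i => cf B ℓ 0 i i else 0,
          fun ℓ α => ?_⟩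
        rw [cf_ofCf N hD]
        simp only [D]
        split_ifs <;> simp
      have hB2 : B - B1 ∈ parahoric S m e (N + k) := by
        rw [mem_parahoric_iff]
        intro ℓ hℓ α
        rw [cf_sub, hB1, if_pos hℓ, sub_self]
      have hcomm : A * B - B * A = A * (B - B1) - (B - B1) * A := by
        have := hAt.commute hB1t
        rw [mul_sub, sub_mul, this]; abel
      have hAB := fun α => cf_mul hA hB2 (N + k - r) α
      have hBA := fun α => cf_mul hB2 hA (N + k - r) α
      have i1 : N + k - r - (N + k) = -(r : ℤ) := by ring
      have i2 : N + k - r - -(r : ℤ) = N + k := by ring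
      simp only [i1, i2, Finset.Icc_self, Finset.sum_singleton, cf_sub B, hB1,
        lt_irrefl, if_false, sub_zero, hAc] at hAB hBA
      refine hc.eq_diagonal (N + k) (cf_periodic B (N + k)) (d := fun i =>
        (if r = 0 then 0 else algebraMap ℂ S (((N + k - r : ℤ) : ℂ) / e) * cf B (N + k - r) 0 i i)
          - d (N + k - r) i) ?_
      intro α
      have h1 := congrArg (fun M => cf M (N + k - r) α) h
      simp only [hcomm] at h1
      rw [cf_add, cf_sub, hAB, hBA, hd, cf_gradDeriv] at h1
      rw [← sub_eq_add_neg] at h1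
      -- For r > 0 the term δB in this degree involves a lower coefficient of B, already known to be
      -- a constant diagonal. For r = 0 it involves the coefficient under study and becomes the
      -- `gradTerm`.
      by_cases hr : r = 0
      · have i4 : N + k - (r : ℤ) = N + k := by rw [hr]; simp
        rw [i4, hc.algebraMap_eq hr] at h1
        simp only [if_pos hr, i4, zero_sub]
        have h2 : Matrix.diagonal (fun i => -d (N + k) i) = -Matrix.diagonal (d (N + k)) :=
          (Matrix.diagonal_neg _).symm
        rw [h2, ← h1]
        abel
      · simp only [gradTerm, if_neg hr, zero_smul, sub_zero]
        have h3 : cf B (N + k - r) α = Matrix.diagonal fun i => cf B (N + k - r) 0 i i := by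
          by_cases h4 : N + k - r < N
          · rw [mem_parahoric_iff.1 hN _ h4, mem_parahoric_iff.1 hN _ h4]; simp
          · have := ih (k - r) (by omega) α
            rw [show N + ((k - r : ℕ) : ℤ) = N + k - r by omega] at this
            exact this
        have h5 : Matrix.diagonal (fun i => algebraMap ℂ S (((N + k - r : ℤ) : ℂ) / e) *
            cf B (N + k - r) 0 i i - d (N + k - r) i) =
            algebraMap ℂ S (((N + k - r : ℤ) : ℂ) / e) • cf B (N + k - r) α -
            Matrix.diagonal (d (N + k - r)) := by
          rw [h3, ← Matrix.diagonal_smul, Matrix.diagonal_sub]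
          rfl
        rw [h5, ← h1]
        abel
  refine ⟨fun ℓ i => cf B ℓ 0 i i, fun ℓ α => ?_⟩
  by_cases hℓ : ℓ < N
  · simp [mem_parahoric_iff.1 hN ℓ hℓ]
  · have := key (ℓ - N).toNat α
    rwa [show N + ((ℓ - N).toNat : ℤ) = ℓ by omega] at this

end Reduction

/-! ### Holomorphic primitives -/

section Primitive

open Filter Topology

variable {E F : Type*} [NormedAddCommGroup E] [NormedSpace ℂ E] [NormedAddCommGroup F]
  [NormedSpace ℂ F] [CompleteSpace F]

/-- Termwise integration of the Taylor series of the derivative. -/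
theorem hasSum_of_hasFDerivAt {f : E → F} {f' : E → E →L[ℂ] F} {x y : E}
    {p : FormalMultilinearSeries ℂ E (E →L[ℂ] F)} {ρ : ENNReal}
    (hp : HasFPowerSeriesOnBall f' p x ρ)
    (hf : ∀ z ∈ Metric.eball x ρ, HasFDerivAt f (f' z) z) (hy : y ∈ Metric.eball (0 : E) ρ) :
    HasSum (fun n : ℕ => ((n : ℂ) + 1)⁻¹ • p n (fun _ => y) y) (f (x + y) - f x) := by
  have hmem : ∀ t : ℝ, t ∈ Set.uIcc (0 : ℝ) 1 → (t : ℂ) • y ∈ Metric.eball (0 : E) ρ := by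
    intro t ht
    rw [Set.uIcc_of_le zero_le_one] at ht
    rw [mem_eball_zero_iff] at hy ⊢
    refine lt_of_le_of_lt ?_ hy
    rw [enorm_smul]
    have h1 : ‖(t : ℂ)‖ₑ ≤ 1 := by
      have h2 : ‖(t : ℂ)‖ ≤ 1 := by
        rw [Complex.norm_real, Real.norm_eq_abs, abs_of_nonneg ht.1]; exact ht.2
      rw [← ofReal_norm]
      simpa using ENNReal.ofReal_le_ofReal h2
    calc _ ≤ 1 * ‖y‖ₑ := by gcongr
      _ = _ := one_mul _
  -- The derivative of t ↦ f(x + ty) is ∑ t^n p_n(y, …, y) y; integrating over [0, 1] yields the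
  -- factors 1/(n + 1).
  let G : ℕ → C(ℝ, F) := fun n =>
    ⟨fun t => ((t : ℂ) ^ n) • p n (fun _ => y) y, by fun_prop⟩
  have hG : ∀ t ∈ Set.uIcc (0 : ℝ) 1, HasSum (fun n => G n t) (f' (x + (t : ℂ) • y) y) := by
    intro t ht
    have h1 := hp.hasSum (hmem t ht)
    have h2 := (ContinuousLinearMap.apply ℂ F y).hasSum h1
    convert h2 using 1
    · funext n
      simp only [G, ContinuousMap.coe_mk, ContinuousLinearMap.apply_apply]
      rw [(p n).map_smul_univ (fun _ => (t : ℂ)) (fun _ => y)]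
      simp
    · rfl
  have hsum : Summable fun n => ‖(G n).restrict
      (⟨Set.uIcc 0 1, isCompact_uIcc⟩ : TopologicalSpace.Compacts ℝ)‖ := by
    have h1 := (p.summable_norm_apply (Metric.eball_subset_eball hp.r_le hy)).mul_right ‖y‖
    refine Summable.of_nonneg_of_le (fun _ => norm_nonneg _) (fun n => ?_) h1
    rw [ContinuousMap.norm_le _ (by positivity)]
    rintro ⟨t, ht⟩
    have ht' : t ∈ Set.uIcc (0 : ℝ) 1 := ht
    rw [Set.uIcc_of_le zero_le_one] at ht'
    simp only [ContinuousMap.restrict_apply, G, ContinuousMap.coe_mk]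
    rw [norm_smul, norm_pow, Complex.norm_real, Real.norm_eq_abs, abs_of_nonneg ht'.1]
    calc t ^ n * ‖(p n fun _ => y) y‖ ≤ 1 * ‖(p n fun _ => y) y‖ := by
          gcongr; exact pow_le_one₀ ht'.1 ht'.2
      _ ≤ ‖p n fun _ => y‖ * ‖y‖ := by
          rw [one_mul]; exact ContinuousLinearMap.le_opNorm _ _
  have h1 := intervalIntegral.hasSum_intervalIntegral_of_summable_norm (a := 0) (b := 1) hsum
  have h2 : ∀ n, ∫ t in (0 : ℝ)..1, G n t = ((n : ℂ) + 1)⁻¹ • p n (fun _ => y) y := by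
    intro n
    simp only [G, ContinuousMap.coe_mk]
    rw [intervalIntegral.integral_smul_const]
    congr 1
    have : ∀ t : ℝ, (t : ℂ) ^ n = ((t ^ n : ℝ) : ℂ) := fun t => by push_cast; rfl
    simp only [this]
    rw [intervalIntegral.integral_ofReal, integral_pow]
    simp
  have h3 : ∫ t in (0 : ℝ)..1, ∑' n, G n t = f (x + y) - f x := by
    have h4 : ∀ t ∈ Set.uIcc (0 : ℝ) 1,
        HasDerivAt (fun t : ℝ => f (x + (t : ℂ) • y)) (∑' n, G n t) t := by
      intro t ht
      rw [(hG t ht).tsum_eq]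
      have h5 : x + (t : ℂ) • y ∈ Metric.eball x ρ := by
        have := hmem t ht
        rw [mem_eball_zero_iff] at this
        rwa [Metric.mem_eball, edist_eq_enorm_sub, add_sub_cancel_left]
      have h6 : HasDerivAt (fun t : ℝ => x + (t : ℂ) • y) ((1 : ℂ) • y) t :=
        ((Complex.ofRealCLM.hasDerivAt (x := t)).smul_const y).const_add x
      rw [one_smul] at h6
      exact ((hf _ h5).restrictScalars ℝ).comp_hasDerivAt t h6
    rw [intervalIntegral.integral_eq_sub_of_hasDerivAt h4]
    · simp
    · have h7 : ContinuousOn (fun t : ℝ => ∑' n, G n t) (Set.uIcc 0 1) := by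
        refine ContinuousOn.congr (f := fun t : ℝ => f' (x + (t : ℂ) • y) y) ?_
          fun t ht => (hG t ht).tsum_eq
        refine ContinuousOn.clm_apply (ContinuousOn.comp hp.continuousOn ?_ ?_) continuousOn_const
        · exact Continuous.continuousOn (by fun_prop)
        · intro t ht
          have := hmem t ht
          rw [mem_eball_zero_iff] at this
          rwa [Metric.mem_eball, edist_eq_enorm_sub, add_sub_cancel_left]
      exact h7.intervalIntegrable
  rw [h3] at h1
  simpa only [h2] using h1

/-- A function whose derivative is analytic is analytic. -/
theorem analyticAt_of_hasFDerivAt {f : E → F} {f' : E → E →L[ℂ] F} {x : E}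
    (hf : ∀ᶠ y in 𝓝 x, HasFDerivAt f (f' y) y) (hf' : AnalyticAt ℂ f' x) : AnalyticAt ℂ f x := by
  obtain ⟨p, ρ₀, hp⟩ := hf'
  obtain ⟨ε, hε, hε'⟩ := EMetric.mem_nhds_iff.1 hf
  have hp := hp.mono (lt_min hp.r_pos hε) (min_le_left _ _)
  set ρ := min ρ₀ ε
  -- The factor 1 in degree 0 keeps the constant term f(x), which n⁻¹ would annihilate. All factors
  -- have norm at most 1, so the radius does not shrink.
  let q : FormalMultilinearSeries ℂ E F := fun n =>
    (if n = 0 then 1 else (n : ℂ)⁻¹) • p.unshift (f x) n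
  refine ⟨q, ρ, ?_, hp.r_pos, fun {y} hy => ?_⟩
  · have h1 : (p.unshift (f x)).radius ≤ q.radius := by
      refine FormalMultilinearSeries.radius_le_of_le fun n => ?_
      simp only [q]
      rw [norm_smul]
      refine mul_le_of_le_one_left (norm_nonneg _) ?_
      split_ifs with h
      · simp
      · rw [norm_inv, Complex.norm_natCast]
        exact inv_le_one_of_one_le₀ (by exact_mod_cast Nat.one_le_iff_ne_zero.2 h)
    rw [FormalMultilinearSeries.radius_unshift] at h1
    exact hp.r_le.trans h1
  · have h1 := hasSum_of_hasFDerivAt hp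
      (fun z hz => hε' (Metric.eball_subset_eball (min_le_right _ _) hz)) hy
    rw [← hasSum_nat_add_iff' 1]
    convert h1 using 1
    · funext n
      simp only [q, if_neg (Nat.succ_ne_zero n)]
      rw [smul_apply, FormalMultilinearSeries.unshift]
      push_cast
      rfl
    · simp [q, FormalMultilinearSeries.unshift]

end Primitive

/-! ### The ring of holomorphic functions -/

section HolRing

open TopologicalSpace

variable {d : ℕ} {Δ : Opens (Fin d → ℂ)}

theorem Hol.ext_iff_apply {f g : Hol Δ} : f = g ↔ ∀ y : Δ, (f : Δ → ℂ) y = (g : Δ → ℂ) y :=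
  ⟨fun h y => by rw [h], fun h => Subtype.ext (funext h)⟩

theorem pderiv_apply (s : Fin d) (f : Hol Δ) (y : Δ) :
    (pderiv s f : Δ → ℂ) y = fderiv ℂ (extend f) y (Pi.single s 1) := rfl

/-- The element of `R` given by a function that is holomorphic on `Δ`. -/
def Hol.mk (G : (Fin d → ℂ) → ℂ) (hG : AnalyticOnNhd ℂ G Δ) : Hol Δ :=
  ⟨fun y => G y, G, hG, fun _ => rfl⟩

theorem extend_eventuallyEq {f : Hol Δ} {G : (Fin d → ℂ) → ℂ}
    (h : ∀ y : Δ, (f : Δ → ℂ) y = G y) (y : Δ) : extend f =ᶠ[nhds (y : Fin d → ℂ)] G := by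
  filter_upwards [Δ.isOpen.mem_nhds y.2] with x hx
  rw [← h ⟨x, hx⟩]
  exact extend_apply f ⟨x, hx⟩

theorem pderiv_apply_of_eq {f : Hol Δ} {G : (Fin d → ℂ) → ℂ}
    (h : ∀ y : Δ, (f : Δ → ℂ) y = G y) (s : Fin d) (y : Δ) :
    (pderiv s f : Δ → ℂ) y = fderiv ℂ G y (Pi.single s 1) := by
  rw [pderiv_apply, (extend_eventuallyEq h y).fderiv_eq]

theorem pderiv_mul (s : Fin d) (f g : Hol Δ) :
    pderiv s (f * g) = pderiv s f * g + f * pderiv s g := by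
  rw [Hol.ext_iff_apply]
  intro y
  have hf := (extend_analytic f y y.2).differentiableAt
  have hg := (extend_analytic g y y.2).differentiableAt
  have h : ∀ x : Δ, ((f * g : Hol Δ) : Δ → ℂ) x = (extend f * extend g) x := fun x => by
    rw [Pi.mul_apply, extend_apply, extend_apply]; rfl
  rw [pderiv_apply_of_eq h, fderiv_mul hf hg]
  change (extend f y • fderiv ℂ (extend g) y + extend g y • fderiv ℂ (extend f) y) (Pi.single s 1) =
    (pderiv s f : Δ → ℂ) y * (g : Δ → ℂ) y + (f : Δ → ℂ) y * (pderiv s g : Δ → ℂ) y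
  rw [extend_apply, extend_apply, pderiv_apply, pderiv_apply]
  simp only [add_apply, smul_apply, smul_eq_mul]
  ring

theorem pderiv_algebraMap (s : Fin d) (a : ℂ) : pderiv s (algebraMap ℂ (Hol Δ) a) = 0 := by
  rw [Hol.ext_iff_apply]
  intro y
  rw [pderiv_apply_of_eq (G := fun _ => a) (fun _ => rfl)]
  simp

theorem pderiv_comm (s t : Fin d) (f : Hol Δ) : pderiv s (pderiv t f) = pderiv t (pderiv s f) := by
  rw [Hol.ext_iff_apply]
  intro y
  have hf := extend_analytic f y y.2
  have h : ∀ s t, (pderiv s (pderiv t f) : Δ → ℂ) y =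
      fderiv ℂ (fderiv ℂ (extend f)) y (Pi.single s 1) (Pi.single t 1) := by
    intro s t
    rw [pderiv_apply_of_eq (G := fun x => fderiv ℂ (extend f) x (Pi.single t 1)) (fun _ => rfl),
      fderiv_clm_apply hf.fderiv.differentiableAt (differentiableAt_const _)]
    simp
  rw [h, h]
  exact (ContDiffAt.isSymmSndFDerivAt_of_omega hf.contDiffAt) _ _

/-- This converts regularity at each point y into invertibility over R, so that the recursions can
be run over R directly. -/
theorem Hol.isUnit_of_forall_ne_zero {f : Hol Δ} (hf : ∀ y : Δ, evalAt y f ≠ 0) : IsUnit f := by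
  have h : AnalyticOnNhd ℂ (fun x => (extend f x)⁻¹) Δ := fun x hx =>
    (extend_analytic f x hx).inv (by
      rw [show extend f x = _ from extend_apply f ⟨x, hx⟩]; exact hf ⟨x, hx⟩)
  refine IsUnit.of_mul_eq_one (Hol.mk _ h) (Hol.ext_iff_apply.2 fun y => ?_)
  change (f : Δ → ℂ) y * (extend f y)⁻¹ = 1
  rw [extend_apply]
  exact mul_inv_cancel₀ (hf y)

/-- The exponential of a holomorphic function. -/
def Hol.exp (f : Hol Δ) : Hol Δ :=
  Hol.mk (fun x => Complex.exp (extend f x)) fun x hx => (extend_analytic f x hx).cexp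

theorem Hol.isUnit_exp (f : Hol Δ) : IsUnit (Hol.exp f) :=
  Hol.isUnit_of_forall_ne_zero fun _ => Complex.exp_ne_zero _

theorem pderiv_exp (s : Fin d) (f : Hol Δ) : pderiv s (Hol.exp f) = Hol.exp f * pderiv s f := by
  rw [Hol.ext_iff_apply]
  intro y
  rw [pderiv_apply_of_eq (G := fun x => Complex.exp (extend f x)) (fun _ => rfl),
    (extend_analytic f y y.2).differentiableAt.hasFDerivAt.cexp.fderiv]
  rfl

/-- The Poincaré lemma for holomorphic one-forms on a convex domain. -/
theorem exists_primitive (hΔ : Convex ℝ (Δ : Set (Fin d → ℂ))) (b : Fin d → Hol Δ)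
    (hb : ∀ s t, pderiv s (b t) = pderiv t (b s)) : ∃ f : Hol Δ, ∀ s, pderiv s f = b s := by
  let ω : (Fin d → ℂ) → (Fin d → ℂ) →L[ℂ] ℂ := fun x =>
    ∑ t, extend (b t) x • ContinuousLinearMap.proj t
  have hω : ∀ x ∈ Δ, AnalyticAt ℂ ω x := fun x hx =>
    Finset.analyticAt_fun_sum _ fun t _ => (extend_analytic (b t) x hx).smul analyticAt_const
  have hωd : ∀ x ∈ Δ, HasFDerivAt ω (∑ t, (fderiv ℂ (extend (b t)) x).smulRight
      (ContinuousLinearMap.proj t : (Fin d → ℂ) →L[ℂ] ℂ)) x := fun x hx =>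
    HasFDerivAt.fun_sum fun t _ =>
      (extend_analytic (b t) x hx).differentiableAt.hasFDerivAt.smul_const
        (ContinuousLinearMap.proj t : (Fin d → ℂ) →L[ℂ] ℂ)
  have hexp : ∀ (L : (Fin d → ℂ) →L[ℂ] ℂ) (v : Fin d → ℂ),
      L v = ∑ s, v s * L (Pi.single s 1) := by
    intro L v
    conv_lhs => rw [pi_eq_sum_univ' v]
    rw [map_sum]
    refine Finset.sum_congr rfl fun s _ => ?_
    rw [map_smul, smul_eq_mul]
  obtain ⟨f, hf⟩ := hΔ.exists_forall_hasFDerivAt_of_fderiv_symmetric (ω := ω) Δ.isOpen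
    (fun x hx => (((hωd x hx).restrictScalars ℝ).differentiableAt).differentiableWithinAt) (by
      intro x hx v w
      rw [((hωd x hx).restrictScalars ℝ).fderiv]
      simp only [ContinuousLinearMap.coe_restrictScalars', sum_apply,
        ContinuousLinearMap.smulRight_apply, smul_apply,
        ContinuousLinearMap.proj_apply, smul_eq_mul]
      have h1 : ∀ s t, fderiv ℂ (extend (b t)) x (Pi.single s 1) =
          fderiv ℂ (extend (b s)) x (Pi.single t 1) := fun s t =>
        Hol.ext_iff_apply.1 (hb s t) ⟨x, hx⟩
      have h2 : ∀ v w : Fin d → ℂ, ∑ t, fderiv ℂ (extend (b t)) x v * w t =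
          ∑ t, ∑ s, fderiv ℂ (extend (b t)) x (Pi.single s 1) * v s * w t := by
        intro v w
        refine Finset.sum_congr rfl fun t _ => ?_
        rw [hexp _ v, Finset.sum_mul]
        exact Finset.sum_congr rfl fun s _ => by ring
      rw [h2, h2, Finset.sum_comm]
      refine Finset.sum_congr rfl fun s _ => Finset.sum_congr rfl fun t _ => ?_
      rw [h1 s t]
      ring)
  -- The primitive is so far only known to be differentiable on Δ; its analyticity is inherited from
  -- that of its derivative ω.
  have hfa : AnalyticOnNhd ℂ f Δ := fun x hx => analyticAt_of_hasFDerivAt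
    (Filter.eventually_of_mem (Δ.isOpen.mem_nhds hx) hf) (hω x hx)
  refine ⟨Hol.mk f hfa, fun s => Hol.ext_iff_apply.2 fun y => ?_⟩
  rw [pderiv_apply_of_eq (G := f) (fun _ => rfl), (hf y y.2).fderiv]
  simp only [ω, sum_apply, smul_apply,
    ContinuousLinearMap.proj_apply, smul_eq_mul]
  rw [Finset.sum_eq_single s]
  · rw [Pi.single_eq_same, mul_one, extend_apply]
  · intro t _ ht; rw [Pi.single_eq_of_ne ht, mul_zero]
  · simp

theorem convex_polydisk (c : Fin d → ℂ) (ρ : Fin d → ℝ) :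
    Convex ℝ (polydisk c ρ : Set (Fin d → ℂ)) :=
  convex_pi fun s _ => convex_ball (c s) (ρ s)

end HolRing

/-! ### Regular strata: leading terms -/

section StratumLeading

variable {m e r : ℕ} [NeZero e]

/-- Elements of degree zero commuting with the leading term of a regular stratum are toral. -/
theorem IsRegularStratum.exists_eq_diagonal {b : Mat ℂ m e} (h : IsRegularStratum r b)
    {c : Fin m → ℂ} (hc : ∀ α, cf b (-r) α = Matrix.diagonal c)
    {D : ℤ → Matrix (Fin m) (Fin m) ℂ} (hD : Function.Periodic D (e : ℤ))
    (hcomm : ∀ α, D α * Matrix.diagonal c = Matrix.diagonal c * D (α - r)) :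
    ∃ x : Fin m → ℂ, ∀ α, D α = Matrix.diagonal x := by
  let Y : Mat ℂ m e := ofCf m e 0 fun _ => D
  have hY : Y ∈ parahoric ℂ m e 0 := ofCf_mem_parahoric _ fun _ => hD
  have hY0 : ∀ α, cf Y 0 α = D α := fun α => by
    rw [cf_ofCf _ fun _ => hD, if_neg (lt_irrefl _)]
  -- In degree −r the commutator of the degree-zero matrix Y with b is D·c − c·D(· − r). By `hcomm`
  -- it vanishes, so the kernel condition applies with s = 0.
  have key : Y * b - b * Y ∈ parahoric ℂ m e (0 - r + 1) := by
    have h1 := mul_mem_parahoric hY h.mem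
    have h2 := mul_mem_parahoric h.mem hY
    rw [zero_add] at h1
    rw [add_zero] at h2
    rw [mem_parahoric_iff]
    intro ℓ hℓ α
    rcases (Int.lt_add_one_iff.1 hℓ).lt_or_eq with h3 | rfl
    · exact mem_parahoric_iff.1 (Submodule.sub_mem _ h1 h2) ℓ (by omega) α
    · rw [zero_sub, cf_sub, cf_mul hY h.mem, cf_mul h.mem hY, sub_self, sub_zero, Finset.Icc_self,
        Finset.Icc_self, Finset.sum_singleton, Finset.sum_singleton, hY0, sub_zero, sub_self, hY0,
        hc, hc, hcomm, sub_eq_add_neg α, sub_self]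
  obtain ⟨t, ht, _, htY⟩ := (h.ker_ad 0 Y hY).1 key
  obtain ⟨x, hx⟩ := isToral_of_mem_torus ht
  refine ⟨x 0, fun α => ?_⟩
  have := mem_parahoric_iff.1 htY 0 (by norm_num) α
  rw [cf_sub, hY0, hx, sub_eq_zero] at this
  exact this

/-- As b commutes with itself, the kernel condition with s = −r puts b into 𝔱 + 𝔓^(−r+1). -/
theorem IsRegularStratum.exists_leading {b : Mat ℂ m e} (h : IsRegularStratum r b) :
    ∃ c : Fin m → ℂ, ∀ α, cf b (-r) α = Matrix.diagonal c := by
  obtain ⟨t, ht, _, htY⟩ := (h.ker_ad (-r) b h.mem).1 (by rw [sub_self]; exact Submodule.zero_mem _)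
  obtain ⟨x, hx⟩ := isToral_of_mem_torus ht
  refine ⟨x (-r), fun α => ?_⟩
  have := mem_parahoric_iff.1 htY (-r) (by omega) α
  rw [cf_sub, hx, sub_eq_zero] at this
  exact this

/-- If the powers agreed and c_j ≠ 0, μ = c_i/c_j would be an e-th root of unity, and an e-periodic
f with f(α) = μ f(α − r), placed in entry (i, j), would commute with the leading term without being
diagonal. If c_j = 0 then c_i = 0 and f = 1 does the same. -/
theorem IsRegularStratum.pow_ne {b : Mat ℂ m e} (h : IsRegularStratum r b)
    {c : Fin m → ℂ} (hc : ∀ α, cf b (-r) α = Matrix.diagonal c) {i j : Fin m} (hij : i ≠ j) :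
    c j ^ e ≠ c i ^ e := by
  intro heq
  have hb : (1 : ℤ) = r * Nat.gcdA r e + e * Nat.gcdB r e := by
    rw [← Nat.gcd_eq_gcd_ab, h.coprime]; rfl
  obtain ⟨f, hf0, hfe, hf⟩ : ∃ f : ℤ → ℂ, f 0 = 1 ∧ Function.Periodic f (e : ℤ) ∧
      ∀ α, f α * c j = c i * f (α - r) := by
    by_cases hj : c j = 0
    · have hi : c i = 0 := by
        rw [hj, zero_pow (NeZero.ne e)] at heq
        exact pow_eq_zero_iff (NeZero.ne e) |>.1 heq.symm
      exact ⟨fun _ => 1, rfl, fun _ => rfl, fun _ => by rw [hi, hj]; ring⟩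
    · set μ := c i / c j with hμ
      have hμe : μ ^ (e : ℤ) = 1 := by
        rw [zpow_natCast, hμ, div_pow, heq, div_self]
        rw [← heq]; exact pow_ne_zero _ hj
      have hμ0 : μ ≠ 0 := by
        intro h0
        rw [h0, zero_zpow _ (by exact_mod_cast NeZero.ne e)] at hμe
        exact zero_ne_one hμe
      -- `Nat.gcdA r e` is an inverse of r modulo e, so translation by r changes the exponent by 1
      -- modulo e.
      refine ⟨fun α => μ ^ (Nat.gcdA r e * α), by simp, fun α => ?_, fun α => ?_⟩
      · simp only
        rw [mul_add, zpow_add₀ hμ0, mul_comm _ (e : ℤ), zpow_mul μ e, hμe, one_zpow, mul_one]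
      · have h1 : μ ^ (Nat.gcdA r e * α) = μ * μ ^ (Nat.gcdA r e * (α - r)) := by
          have h2 : 1 + Nat.gcdA r e * (α - r) = Nat.gcdA r e * α + e * Nat.gcdB r e := by
            linear_combination hb
          rw [← zpow_one_add₀ hμ0, h2, zpow_add₀ hμ0, zpow_mul μ e, hμe, one_zpow, mul_one]
        have h3 : μ * c j = c i := div_mul_cancel₀ _ hj
        simp only
        rw [h1, ← h3]
        ring
  obtain ⟨x, hx⟩ := h.exists_eq_diagonal hc
    (D := fun α => Matrix.of fun p q => if p = i ∧ q = j then f α else 0)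
    (fun α => by simp only [hfe α]) (fun α => by
      ext p q
      rw [Matrix.mul_diagonal, Matrix.diagonal_mul]
      simp only [Matrix.of_apply]
      split_ifs with hpq
      · rw [hpq.1, hpq.2, hf]
      · simp)
  have := congrFun (congrFun (hx 0) i) j
  rw [Matrix.diagonal_apply_ne _ hij, Matrix.of_apply, if_pos ⟨rfl, rfl⟩, hf0] at this
  exact one_ne_zero this

/-- If c_i = 0, any e-periodic function in entry (i, i) commutes with the leading term. For e ≠ 1
the indicator of eℤ is not constant, against regularity. -/
theorem IsRegularStratum.leading_ne_zero {b : Mat ℂ m e} (h : IsRegularStratum r b)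
    {c : Fin m → ℂ} (hc : ∀ α, cf b (-r) α = Matrix.diagonal c) (he : e ≠ 1) (i : Fin m) :
    c i ≠ 0 := by
  intro hi
  obtain ⟨x, hx⟩ := h.exists_eq_diagonal hc
    (D := fun α => Matrix.of fun p q => if p = i ∧ q = i then (if (e : ℤ) ∣ α then 1 else 0) else 0)
    (fun α => by simp only [dvd_add_self_right]) (fun α => by
      ext p q
      rw [Matrix.mul_diagonal, Matrix.diagonal_mul]
      simp only [Matrix.of_apply]
      split_ifs with hpq <;> simp [hpq, hi])
  have h0 := congrFun (congrFun (hx 0) i) i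
  have h1 := congrFun (congrFun (hx 1) i) i
  have h2 : ¬ (e : ℤ) ∣ 1 := by
    intro h
    exact he (Nat.dvd_one.1 (by exact_mod_cast h))
  simp [h2] at h0 h1
  exact one_ne_zero (h0.trans h1.symm)

/-- For r = 0 and e = 1 the element z^r b^e modulo 𝔓^1 is the diagonal matrix with entries c, so the
c_j are the eigenvalues in the nonresonance condition. -/
theorem IsRegularStratum.sub_ne_intCast {b : Mat ℂ m e} (h : IsRegularStratum r b)
    {c : Fin m → ℂ} (hc : ∀ α, cf b (-r) α = Matrix.diagonal c) (hr : r = 0) {i j : Fin m}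
    (hij : i ≠ j) (ℓ : ℤ) : c j - c i ≠ ℓ := by
  have he : e = 1 := by
    have := h.coprime
    rwa [hr, Nat.gcd_zero_left] at this
  subst he hr
  have h1 := h.nonresonant rfl
  have h2 : (zVar ℂ ^ 0 • b ^ 1).map (fun f : ℂ⸨X⸩ => f.coeff 0) =
      Matrix.diagonal fun p : Fin m × Fin 1 => c p.1 := by
    rw [pow_zero, pow_one, one_smul]
    ext ⟨i, a⟩ ⟨j, a'⟩
    rw [Subsingleton.elim a' a, Matrix.map_apply, coeff_eq_cf, mul_zero, zero_add, sub_self]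
    have := hc (a : ℕ)
    rw [Nat.cast_zero, neg_zero] at this
    rw [this, Matrix.diagonal_apply, Matrix.diagonal_apply]
    simp
  have h3 : (Matrix.diagonal fun p : Fin m × Fin 1 => c p.1).charpoly =
      (Multiset.map (fun a => Polynomial.X - Polynomial.C a)
        (Finset.univ.val.map fun p : Fin m × Fin 1 => c p.1)).prod := by
    rw [Matrix.charpoly_diagonal, Multiset.map_map]
    rfl
  rw [h2, h3, Polynomial.roots_multiset_prod_X_sub_C, Multiset.map_map] at h1
  intro h4
  have h5 := Multiset.inj_on_of_nodup_map h1 (i, 0) (Finset.mem_univ_val _) (j, 0)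
    (Finset.mem_univ_val _) (by
      rw [Function.comp_apply, Function.comp_apply, QuotientAddGroup.eq,
        AddSubgroup.mem_zmultiples_iff]
      exact ⟨ℓ, by rw [zsmul_one, ← h4]; ring⟩)
  exact hij (Prod.mk.inj h5).1

/-- The coefficients of the leading term of a regular stratum satisfy the regularity conditions. -/
theorem IsRegularStratum.regularLeading {b : Mat ℂ m e} (h : IsRegularStratum r b)
    {c : Fin m → ℂ} (hc : ∀ α, cf b (-r) α = Matrix.diagonal c) : RegularLeading r e c where
  coprime := h.coprime
  isUnit_sub i j hij ℓ := by
    rw [isUnit_iff_ne_zero, sub_ne_zero, gradTerm]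
    split_ifs with hr
    · have he : e = 1 := by
        have := h.coprime
        rwa [hr, Nat.gcd_zero_left] at this
      rw [he, pow_one, pow_one]
      intro h1
      exact h.sub_ne_intCast hc hr hij ℓ (by linear_combination h1)
    · rw [sub_zero]
      exact h.pow_ne hc hij
  isUnit he i := isUnit_iff_ne_zero.2 (h.leading_ne_zero hc he i)

end StratumLeading

/-! ### Dependence on the coset, containment of strata -/

section StratumCoset

variable {m e r : ℕ}

theorem lattice_anti {S : Type*} [CommRing S] {k l : ℤ} (h : k ≤ l) :
    lattice S m e l ≤ lattice S m e k :=
  fun _ hv p n hn => hv p n (hn.trans_le h)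

theorem zDeriv_mem_lattice {v : Fin m × Fin e → ℂ⸨X⸩} {i : ℤ} (hv : v ∈ lattice ℂ m e i) :
    (fun p => zDeriv (v p)) ∈ lattice ℂ m e i := fun p n hn => by
  rw [coeff_zDeriv, hv p n hn, mul_zero]

variable [NeZero e]

/-- For r ≥ 1, z∂_z preserves L^i, which lies in L^(i−r+1), so it is negligible. For r = 0 it
suffices to test on the constant basis vectors, which z∂_z kills. -/
theorem sub_mem_of_containsStratum {a b : Mat ℂ m e} (he : r = 0 → e = 1)
    (h : ContainsStratum r a b) : a - b ∈ parahoric ℂ m e (-r + 1) := by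
  by_cases hr : r = 0
  · have he := he hr
    subst he hr
    rw [mem_parahoric_iff_coeff]
    intro i j p q k hk
    have h1 := h.2 rfl _ (lattice_anti (l := (1 : ℕ) - 1 - ((q : ℕ) : ℤ)) (by simp)
      (single_mem_lattice j q)) (i, p) k (by
        have hp : ((p : ℕ) : ℤ) = 0 := by simp
        have hq : ((q : ℕ) : ℤ) = 0 := by simp
        simp only [hp]
        rw [hp, hq] at hk
        simpa using hk)
    have h2 : ∀ p', zDeriv ((Pi.single (j, q) 1 : Fin m × Fin 1 → ℂ⸨X⸩) p') = 0 := by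
      intro p'
      by_cases hp : p' = (j, q)
      · rw [hp, Pi.single_eq_same, ← map_one (HahnSeries.C : ℂ →+* ℂ⸨X⸩), zDeriv_C]
      · rw [Pi.single_eq_of_ne hp, zDeriv_zero]
    rw [nablaTau] at h1
    simpa only [Pi.sub_apply, Pi.add_apply, h2, zero_add, Matrix.mulVec_single_one,
      Matrix.col_apply, Matrix.sub_apply] using h1
  · intro i v hv
    have h1 := (h.1 (Nat.one_le_iff_ne_zero.2 hr) i v hv).2
    have h2 := lattice_anti (S := ℂ) (m := m) (e := e) (k := i - r + 1) (l := i) (by omega)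
      (zDeriv_mem_lattice hv)
    have h3 := Submodule.sub_mem _ h1 h2
    rw [nablaTau] at h3
    rw [Matrix.sub_mulVec, ← add_assoc, ← sub_eq_add_neg]
    convert h3 using 1
    abel

theorem containsStratum_of_sub_mem {a b : Mat ℂ m e} (he : r = 0 → e = 1)
    (hb : b ∈ parahoric ℂ m e (-r)) (h : a - b ∈ parahoric ℂ m e (-r + 1)) :
    ContainsStratum r a b := by
  refine ⟨fun hr i v hv => ?_, fun hr v hv => ?_⟩
  · have h2 := lattice_anti (S := ℂ) (m := m) (e := e) (k := i - r + 1) (l := i) (by omega)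
      (zDeriv_mem_lattice hv)
    have h3 := h i v hv
    rw [← add_assoc, ← sub_eq_add_neg, Matrix.sub_mulVec] at h3
    have h4 := Submodule.add_mem _ h2 h3
    have h5 : nablaTau a v - b *ᵥ v ∈ lattice ℂ m e (i - r + 1) := by
      rw [nablaTau]
      convert h4 using 1
      abel
    refine ⟨?_, h5⟩
    have h6 := hb i v hv
    rw [← sub_eq_add_neg] at h6
    have := Submodule.add_mem _ (lattice_anti (k := i - r) (by omega) h5) h6
    rwa [sub_add_cancel] at this
  · have he := he hr
    subst he hr
    have h3 := h 0 v hv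
    rw [Matrix.sub_mulVec] at h3
    -- z∂_z kills constant terms, so it sends 𝔬^n into z𝔬^n; on z^i 𝔬^n with i ≠ 0 no such step
    -- would be gained.
    have h2 : (fun p => zDeriv (v p)) ∈ lattice ℂ m 1 1 := by
      intro p k hk
      rw [coeff_zDeriv]
      have hp : ((p.2 : ℕ) : ℤ) = 0 := by simp
      rw [hp] at hk
      have hk' : k ≤ 0 := by push_cast at hk; omega
      rcases hk'.lt_or_eq with hk' | rfl
      · rw [hv p k (by rw [hp]; push_cast; omega), mul_zero]
      · simp
    have h4 := Submodule.add_mem _ h2 h3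
    rw [nablaTau]
    convert h4 using 1
    abel

theorem pow_mem_parahoric {S : Type*} [CommRing S] {X : Mat S m e} {k : ℤ}
    (hX : X ∈ parahoric S m e k) (n : ℕ) : X ^ n ∈ parahoric S m e (n * k) := by
  induction n with
  | zero => simpa using one_mem_parahoric (S := S) (m := m) (e := e)
  | succ n ih =>
    have := mul_mem_parahoric ih hX
    rw [pow_succ]
    convert this using 1
    push_cast
    ring_nf

theorem pow_sub_pow_mem_parahoric {S : Type*} [CommRing S] {X Y : Mat S m e} {k : ℤ}
    (hX : X ∈ parahoric S m e k) (hY : Y ∈ parahoric S m e k)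
    (hXY : X - Y ∈ parahoric S m e (k + 1)) (n : ℕ) :
    X ^ n - Y ^ n ∈ parahoric S m e (n * k + 1) := by
  induction n with
  | zero => simp
  | succ n ih =>
    have h1 := mul_mem_parahoric ih hX
    have h2 := mul_mem_parahoric (pow_mem_parahoric hY n) hXY
    have h3 : X ^ (n + 1) - Y ^ (n + 1) = (X ^ n - Y ^ n) * X + Y ^ n * (X - Y) := by
      rw [pow_succ, pow_succ]; noncomm_ring
    have h4 : ((n + 1 : ℕ) : ℤ) * k + 1 = n * k + 1 + k := by push_cast; ring
    have h5 : (n : ℤ) * k + (k + 1) = n * k + 1 + k := by ring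
    rw [h3, h4]
    rw [h5] at h2
    exact Submodule.add_mem _ h1 h2

theorem zVar_pow_smul_mem_parahoric {X : Mat ℂ m e} {k : ℤ}
    (hX : X ∈ parahoric ℂ m e k) (n : ℕ) :
    zVar ℂ ^ n • X ∈ parahoric ℂ m e (k + e * n) := by
  rw [mem_parahoric_iff] at *
  intro ℓ hℓ α
  rw [zVar, HahnSeries.single_pow, one_pow, nsmul_one, C_smul_eq, hX _ (by
    linarith), smul_zero]

theorem aeval_sub_aeval_mem_parahoric {X Y : Mat ℂ m e} (hX : X ∈ parahoric ℂ m e 0)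
    (hY : Y ∈ parahoric ℂ m e 0) (hXY : X - Y ∈ parahoric ℂ m e 1) (q : Polynomial ℂ) :
    Polynomial.aeval X (q.map (HahnSeries.C : ℂ →+* ℂ⸨X⸩)) -
      Polynomial.aeval Y (q.map (HahnSeries.C : ℂ →+* ℂ⸨X⸩)) ∈ parahoric ℂ m e 1 := by
  induction q using Polynomial.induction_on' with
  | add p q hp hq =>
    rw [Polynomial.map_add, map_add, map_add, add_sub_add_comm]
    exact Submodule.add_mem _ hp hq
  | monomial n a =>
    rw [Polynomial.map_monomial, Polynomial.aeval_monomial, Polynomial.aeval_monomial, ← mul_sub]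
    have h1 := pow_sub_pow_mem_parahoric hX hY (by simpa using hXY) n
    have h2 : algebraMap ℂ⸨X⸩ (Mat ℂ m e) (HahnSeries.C a) = flat fun _ => a := by
      rw [Matrix.algebraMap_eq_diagonal]
      rfl
    rw [h2]
    have := mul_mem_parahoric (flat_mem_parahoric (fun _ => a)) h1
    simpa using this

/-- Regularity of a stratum depends on the coset only. -/
theorem IsRegularStratum.congr {b A : Mat ℂ m e} (h : IsRegularStratum r b)
    (hA : A - b ∈ parahoric ℂ m e (-r + 1)) : IsRegularStratum r A where
  coprime := h.coprime
  mem := by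
    have := Submodule.add_mem _ (parahoric_anti (by omega) hA) h.mem
    rwa [sub_add_cancel] at this
  not_nilpotent Y hY := by
    have := h.not_nilpotent (A - b + Y) (Submodule.add_mem _ hA hY)
    rwa [← add_assoc, add_sub_cancel] at this
  torus_le := h.torus_le
  ker_ad s Y hY := by
    rw [← h.ker_ad s Y hY]
    have h1 := mul_mem_parahoric hY hA
    have h2 := mul_mem_parahoric hA hY
    rw [show s + (-(r : ℤ) + 1) = s - r + 1 by ring] at h1
    rw [show -(r : ℤ) + 1 + s = s - r + 1 by ring] at h2
    have h3 := Submodule.sub_mem _ h1 h2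
    have h4 : Y * A - A * Y = (Y * b - b * Y) + (Y * (A - b) - (A - b) * Y) := by noncomm_ring
    rw [h4]
    exact Submodule.add_mem_iff_left _ h3
  semisimple := by
    obtain ⟨q, hq, hqb⟩ := h.semisimple
    refine ⟨q, hq, ?_⟩
    have hAm : A ∈ parahoric ℂ m e (-r) := by
      have := Submodule.add_mem _ (parahoric_anti (by omega) hA) h.mem
      rwa [sub_add_cancel] at this
    have h1 := zVar_pow_smul_mem_parahoric (pow_mem_parahoric hAm e) r
    have h2 := zVar_pow_smul_mem_parahoric (pow_mem_parahoric h.mem e) r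
    have h3 := zVar_pow_smul_mem_parahoric (pow_sub_pow_mem_parahoric hAm h.mem hA e) r
    rw [show (e : ℤ) * -(r : ℤ) + e * r = 0 by ring] at h1 h2
    rw [show (e : ℤ) * -(r : ℤ) + 1 + e * r = 1 by ring, smul_sub] at h3
    have h4 := Submodule.add_mem _ (aeval_sub_aeval_mem_parahoric h1 h2 h3 q) hqb
    rwa [sub_add_cancel] at h4
  nonresonant hr := by
    have he : e = 1 := by
      have := h.coprime
      rwa [hr, Nat.gcd_zero_left] at this
    have h1 := h.nonresonant hr
    subst he hr
    have h2 : (zVar ℂ ^ 0 • A ^ 1).map (fun f : ℂ⸨X⸩ => f.coeff 0) =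
        (zVar ℂ ^ 0 • b ^ 1).map (fun f : ℂ⸨X⸩ => f.coeff 0) := by
      rw [pow_zero, pow_one, pow_one, one_smul, one_smul]
      ext ⟨i, p⟩ ⟨j, q⟩
      have := mem_parahoric_iff_coeff.1 hA i j p q 0 (by simp)
      rw [Matrix.sub_apply, HahnSeries.coeff_sub, sub_eq_zero] at this
      exact this
    rwa [h2]

end StratumCoset

/-! ### Gauge transformations -/

section Gauge

variable {𝔄 : Type*} [Ring 𝔄]

theorem gauge_comp {D : 𝔄 → 𝔄} (hD : ∀ X Y, D (X * Y) = D X * Y + X * D Y) (p q : 𝔄ˣ) (B : 𝔄) :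
    (q : 𝔄) * (p * B * (p⁻¹ : 𝔄ˣ) - D p * (p⁻¹ : 𝔄ˣ)) * (q⁻¹ : 𝔄ˣ) - D q * (q⁻¹ : 𝔄ˣ) =
      (q * p : 𝔄ˣ) * B * ((q * p)⁻¹ : 𝔄ˣ) - D (q * p : 𝔄ˣ) * ((q * p)⁻¹ : 𝔄ˣ) := by
  have h1 : D q * (q⁻¹ : 𝔄ˣ) = D q * (p * (p⁻¹ : 𝔄ˣ)) * (q⁻¹ : 𝔄ˣ) := by
    rw [Units.mul_inv, mul_one]
  rw [mul_inv_rev, Units.val_mul, Units.val_mul, hD, h1]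
  noncomm_ring

/-- Curvature is conjugated by a gauge transformation. The form with two commuting derivations
covers both the dz/z ∧ dy_s and the dy_s ∧ dy_t components. -/
theorem curvature_gauge {D₁ D₂ : 𝔄 → 𝔄} (a₁ : ∀ X Y, D₁ (X - Y) = D₁ X - D₁ Y)
    (a₂ : ∀ X Y, D₂ (X - Y) = D₂ X - D₂ Y) (m₁ : ∀ X Y, D₁ (X * Y) = D₁ X * Y + X * D₁ Y)
    (m₂ : ∀ X Y, D₂ (X * Y) = D₂ X * Y + X * D₂ Y) (hD : ∀ X, D₁ (D₂ X) = D₂ (D₁ X))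
    (p : 𝔄ˣ) {B₁ B₂ : 𝔄} (h : D₁ B₂ - D₂ B₁ + (B₁ * B₂ - B₂ * B₁) = 0) :
    D₁ (p * B₂ * (p⁻¹ : 𝔄ˣ) - D₂ p * (p⁻¹ : 𝔄ˣ)) - D₂ (p * B₁ * (p⁻¹ : 𝔄ˣ) - D₁ p * (p⁻¹ : 𝔄ˣ)) +
      ((p * B₁ * (p⁻¹ : 𝔄ˣ) - D₁ p * (p⁻¹ : 𝔄ˣ)) * (p * B₂ * (p⁻¹ : 𝔄ˣ) - D₂ p * (p⁻¹ : 𝔄ˣ)) -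
        (p * B₂ * (p⁻¹ : 𝔄ˣ) - D₂ p * (p⁻¹ : 𝔄ˣ)) * (p * B₁ * (p⁻¹ : 𝔄ˣ) - D₁ p * (p⁻¹ : 𝔄ˣ)))
      = 0 := by
  have hinv : ∀ D : 𝔄 → 𝔄, (∀ X Y, D (X * Y) = D X * Y + X * D Y) →
      D ((p⁻¹ : 𝔄ˣ) : 𝔄) = -((p⁻¹ : 𝔄ˣ) * (D p * (p⁻¹ : 𝔄ˣ))) := by
    intro D hD
    have h1 : D 1 = 0 := by
      have := hD 1 1
      rw [mul_one, mul_one, one_mul] at this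
      exact left_eq_add.1 this
    have h2 := hD (p⁻¹ : 𝔄ˣ) p
    rw [Units.inv_mul, h1] at h2
    have h3 : D ((p⁻¹ : 𝔄ˣ) : 𝔄) = (D ((p⁻¹ : 𝔄ˣ) : 𝔄) * p) * (p⁻¹ : 𝔄ˣ) := by
      rw [mul_assoc, Units.mul_inv, mul_one]
    rw [h3, eq_neg_of_add_eq_zero_left h2.symm]
    noncomm_ring
  have hp : ∀ X : 𝔄, X = X * (p⁻¹ : 𝔄ˣ) * p := fun X => by rw [mul_assoc, Units.inv_mul, mul_one]
  obtain ⟨X₁, hX₁⟩ : ∃ X₁, X₁ = D₁ p * (p⁻¹ : 𝔄ˣ) := ⟨_, rfl⟩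
  obtain ⟨X₂, hX₂⟩ : ∃ X₂, X₂ = D₂ p * (p⁻¹ : 𝔄ˣ) := ⟨_, rfl⟩
  have i₁ := hinv D₁ m₁
  have i₂ := hinv D₂ m₂
  rw [← hX₁] at i₁
  rw [← hX₂] at i₂
  have e₁ : D₁ p = X₁ * p := by rw [hX₁]; exact hp _
  have e₂ : D₂ p = X₂ * p := by rw [hX₂]; exact hp _
  -- Both mixed derivatives contain the same second-order term Y, which cancels; the remaining X₂X₁
  -- − X₁X₂ is offset by the quadratic part of the curvature.
  obtain ⟨Y, hY⟩ : ∃ Y, Y = D₁ (D₂ p) * (p⁻¹ : 𝔄ˣ) := ⟨_, rfl⟩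
  have f₁ : D₁ (D₂ p * (p⁻¹ : 𝔄ˣ)) = Y - X₂ * X₁ := by
    rw [m₁, i₁, ← hY, mul_neg, ← mul_assoc, ← hX₂, sub_eq_add_neg]
  have f₂ : D₂ (D₁ p * (p⁻¹ : 𝔄ˣ)) = Y - X₁ * X₂ := by
    rw [m₂, i₂, ← hD, ← hY, mul_neg, ← mul_assoc, ← hX₁, sub_eq_add_neg]
  have hcomm : (p : 𝔄) * (B₁ * B₂ - B₂ * B₁) * (p⁻¹ : 𝔄ˣ) =
      (p * B₁ * (p⁻¹ : 𝔄ˣ)) * (p * B₂ * (p⁻¹ : 𝔄ˣ)) -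
        (p * B₂ * (p⁻¹ : 𝔄ˣ)) * (p * B₁ * (p⁻¹ : 𝔄ˣ)) := by
    have : ∀ U V : 𝔄, (p * U * (p⁻¹ : 𝔄ˣ)) * (p * V * (p⁻¹ : 𝔄ˣ)) = p * (U * V) * (p⁻¹ : 𝔄ˣ) := by
      intro U V
      calc _ = p * U * ((p⁻¹ : 𝔄ˣ) * p) * (V * (p⁻¹ : 𝔄ˣ)) := by noncomm_ring
        _ = _ := by rw [Units.inv_mul]; noncomm_ring
    rw [this, this, mul_sub, sub_mul]
  have hF : (p : 𝔄) * (D₁ B₂ - D₂ B₁) * (p⁻¹ : 𝔄ˣ) = -((p * B₁ * (p⁻¹ : 𝔄ˣ)) *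
      (p * B₂ * (p⁻¹ : 𝔄ˣ)) - (p * B₂ * (p⁻¹ : 𝔄ˣ)) * (p * B₁ * (p⁻¹ : 𝔄ˣ))) := by
    rw [← hcomm, eq_neg_of_add_eq_zero_left h]
    noncomm_ring
  have g₁ : D₁ (p * B₂ * (p⁻¹ : 𝔄ˣ)) = X₁ * (p * B₂ * (p⁻¹ : 𝔄ˣ)) + p * D₁ B₂ * (p⁻¹ : 𝔄ˣ)
      - (p * B₂ * (p⁻¹ : 𝔄ˣ)) * X₁ := by
    rw [m₁, m₁, i₁, e₁]; noncomm_ring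
  have g₂ : D₂ (p * B₁ * (p⁻¹ : 𝔄ˣ)) = X₂ * (p * B₁ * (p⁻¹ : 𝔄ˣ)) + p * D₂ B₁ * (p⁻¹ : 𝔄ˣ)
      - (p * B₁ * (p⁻¹ : 𝔄ˣ)) * X₂ := by
    rw [m₂, m₂, i₂, e₂]; noncomm_ring
  rw [a₁, a₂, f₁, f₂, g₁, g₂, ← hX₁, ← hX₂]
  rw [mul_sub, sub_mul] at hF
  generalize (p : 𝔄) * B₁ * (p⁻¹ : 𝔄ˣ) = C₁ at *
  generalize (p : 𝔄) * B₂ * (p⁻¹ : 𝔄ˣ) = C₂ at *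
  generalize (p : 𝔄) * D₁ B₂ * (p⁻¹ : 𝔄ˣ) = E₁ at *
  generalize (p : 𝔄) * D₂ B₁ * (p⁻¹ : 𝔄ˣ) = E₂ at *
  have hE : E₁ = E₂ - (C₁ * C₂ - C₂ * C₁) := by
    rw [sub_eq_iff_eq_add.1 hF]; abel
  rw [hE]
  simp only [mul_sub, sub_mul]
  abel

end Gauge

/-! ### Families -/

section Families

open TopologicalSpace

variable {d : ℕ} {Δ : Opens (Fin d → ℂ)} {m e r : ℕ} [NeZero e]

theorem cf_matEval (y : Δ) (X : Mat (Hol Δ) m e) (ℓ α : ℤ) :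
    cf (matEval y X) ℓ α = (cf X ℓ α).map (evalAt y) := rfl

theorem cf_matPderiv (s : Fin d) (X : Mat (Hol Δ) m e) (ℓ α : ℤ) :
    cf (matPderiv s X) ℓ α = (cf X ℓ α).map (pderiv s) := rfl

theorem matEval_mem_parahoric (y : Δ) {X : Mat (Hol Δ) m e} {l : ℤ}
    (h : X ∈ parahoric (Hol Δ) m e l) : matEval y X ∈ parahoric ℂ m e l := by
  rw [mem_parahoric_iff] at *
  intro ℓ hℓ α
  rw [cf_matEval, h ℓ hℓ]
  simp

theorem mem_parahoric_of_matEval {X : Mat (Hol Δ) m e} {l : ℤ}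
    (h : ∀ y : Δ, matEval y X ∈ parahoric ℂ m e l) : X ∈ parahoric (Hol Δ) m e l := by
  rw [mem_parahoric_iff]
  intro ℓ hℓ α
  refine Matrix.ext fun i j => ?_
  rw [Matrix.zero_apply, Hol.ext_iff_apply]
  intro y
  have := congrFun (congrFun (mem_parahoric_iff.1 (h y) ℓ hℓ α) i) j
  rw [cf_matEval] at this
  exact this

theorem matEval_add (y : Δ) (X Y : Mat (Hol Δ) m e) :
    matEval y (X + Y) = matEval y X + matEval y Y := by
  refine cf_ext fun ℓ α => ?_
  rw [cf_add, cf_matEval, cf_matEval, cf_matEval, cf_add, Matrix.map_add _ (map_add _)]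

theorem matEval_sub (y : Δ) (X Y : Mat (Hol Δ) m e) :
    matEval y (X - Y) = matEval y X - matEval y Y := by
  refine cf_ext fun ℓ α => ?_
  rw [cf_sub, cf_matEval, cf_matEval, cf_matEval, cf_sub, Matrix.map_sub _ (map_sub _)]

theorem matEval_sum {ι : Type*} (y : Δ) (s : Finset ι) (X : ι → Mat (Hol Δ) m e) :
    matEval y (∑ i ∈ s, X i) = ∑ i ∈ s, matEval y (X i) := by
  classical
  induction s using Finset.induction_on with
  | empty =>
    refine cf_ext fun ℓ α => ?_
    rw [cf_matEval]; simp
  | insert a s ha ih => rw [Finset.sum_insert ha, Finset.sum_insert ha, matEval_add, ih]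

theorem matEval_mul (y : Δ) (X Y : Mat (Hol Δ) m e) :
    matEval y (X * Y) = matEval y X * matEval y Y := by
  obtain ⟨M, hX⟩ := exists_mem_parahoric X
  obtain ⟨N, hY⟩ := exists_mem_parahoric Y
  refine cf_ext fun ℓ α => ?_
  rw [cf_matEval, cf_mul hX hY, cf_mul (matEval_mem_parahoric y hX) (matEval_mem_parahoric y hY)]
  change (evalAt y).mapMatrix _ = _
  rw [map_sum]
  exact Finset.sum_congr rfl fun p _ => map_mul _ _ _

theorem matEval_one (y : Δ) : matEval y (1 : Mat (Hol Δ) m e) = 1 := by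
  refine cf_ext fun ℓ α => ?_
  rw [cf_matEval, cf_one, cf_one]
  split_ifs
  · rw [Matrix.map_one _ (map_zero _) (map_one _)]
  · rw [Matrix.map_zero _ (map_zero _)]

theorem matEval_map_zDeriv (y : Δ) (X : Mat (Hol Δ) m e) :
    matEval y (X.map zDeriv) = (matEval y X).map zDeriv := by
  ext p q k
  change evalAt y ((zDeriv (X p q)).coeff k) = _
  rw [coeff_zDeriv, map_mul, map_intCast, Matrix.map_apply, coeff_zDeriv]
  rfl

theorem matEval_flat_mul_shift (y : Δ) (f : Fin m → Hol Δ) (k : ℤ) :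
    matEval y (flat f * shift (Hol Δ) m e k) = flat (fun j => evalAt y (f j)) * shift ℂ m e k := by
  refine cf_ext fun ℓ α => ?_
  rw [cf_matEval, cf_flat_mul_shift, cf_flat_mul_shift]
  split_ifs
  · rw [Matrix.diagonal_map (map_zero _)]
  · rw [Matrix.map_zero _ (map_zero _)]

theorem matPderiv_sub (s : Fin d) (X Y : Mat (Hol Δ) m e) :
    matPderiv s (X - Y) = matPderiv s X - matPderiv s Y := by
  refine cf_ext fun ℓ α => ?_
  rw [cf_sub, cf_matPderiv, cf_matPderiv, cf_matPderiv, cf_sub, Matrix.map_sub _ (map_sub _)]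

theorem matPderiv_add (s : Fin d) (X Y : Mat (Hol Δ) m e) :
    matPderiv s (X + Y) = matPderiv s X + matPderiv s Y := by
  refine cf_ext fun ℓ α => ?_
  rw [cf_add, cf_matPderiv, cf_matPderiv, cf_matPderiv, cf_add, Matrix.map_add _ (map_add _)]

theorem matPderiv_mem_parahoric (s : Fin d) {X : Mat (Hol Δ) m e} {l : ℤ}
    (h : X ∈ parahoric (Hol Δ) m e l) : matPderiv s X ∈ parahoric (Hol Δ) m e l := by
  rw [mem_parahoric_iff] at *
  intro ℓ hℓ α
  rw [cf_matPderiv, h ℓ hℓ, Matrix.map_zero _ (map_zero _)]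

theorem matPderiv_mul (s : Fin d) (X Y : Mat (Hol Δ) m e) :
    matPderiv s (X * Y) = matPderiv s X * Y + X * matPderiv s Y := by
  obtain ⟨M, hX⟩ := exists_mem_parahoric X
  obtain ⟨N, hY⟩ := exists_mem_parahoric Y
  refine cf_ext fun ℓ α => ?_
  rw [cf_add, cf_matPderiv, cf_mul hX hY, cf_mul (matPderiv_mem_parahoric s hX) hY,
    cf_mul hX (matPderiv_mem_parahoric s hY), ← Finset.sum_add_distrib]
  refine Matrix.ext fun i k => ?_
  rw [Matrix.map_apply, Matrix.sum_apply, Matrix.sum_apply, map_sum]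
  refine Finset.sum_congr rfl fun p _ => ?_
  rw [Matrix.add_apply, Matrix.mul_apply, Matrix.mul_apply, Matrix.mul_apply, map_sum,
    ← Finset.sum_add_distrib]
  refine Finset.sum_congr rfl fun j _ => ?_
  rw [pderiv_mul]
  rfl

theorem matPderiv_map_zDeriv (s : Fin d) (X : Mat (Hol Δ) m e) :
    matPderiv s (X.map zDeriv) = (matPderiv s X).map zDeriv := by
  ext p q k : 3
  change pderiv s ((zDeriv (X p q)).coeff k) = _
  rw [coeff_zDeriv, Matrix.map_apply, coeff_zDeriv, ← zsmul_eq_mul, map_zsmul, zsmul_eq_mul]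
  rfl

theorem matPderiv_comm (s t : Fin d) (X : Mat (Hol Δ) m e) :
    matPderiv s (matPderiv t X) = matPderiv t (matPderiv s X) := by
  ext p q k : 3
  exact pderiv_comm s t _

theorem matPderiv_HT (s : Fin d) : matPderiv s (HT (Hol Δ) m e) = 0 := by
  refine cf_ext fun ℓ α => ?_
  rw [cf_matPderiv, cf_HT, cf_zero]
  split_ifs
  · rw [Matrix.diagonal_map (map_zero _)]
    simp only [pderiv_algebraMap]
    exact Matrix.diagonal_zero
  · rw [Matrix.map_zero _ (map_zero _)]

theorem map_zDeriv_sub {S : Type*} [CommRing S] (X Y : Mat S m e) :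
    (X - Y).map zDeriv = X.map zDeriv - Y.map zDeriv := by
  ext p q k
  simp [coeff_zDeriv, mul_sub]

theorem Conn.gauge_gauge (p q : GLF (Hol Δ) m e) (N : Conn Δ m e) :
    (N.gauge p).gauge q = N.gauge (q * p) := by
  apply Conn.ext
  · exact gauge_comp (D := fun X : Mat (Hol Δ) m e => X.map zDeriv) map_zDeriv_mul p q _
  · funext s
    exact gauge_comp (D := matPderiv s) (matPderiv_mul s) p q _

theorem Conn.IsFlat.gauge {N : Conn Δ m e} (hN : N.IsFlat) (p : GLF (Hol Δ) m e) :
    (N.gauge p).IsFlat :=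
  ⟨fun s => curvature_gauge (D₁ := fun X : Mat (Hol Δ) m e => X.map zDeriv) (D₂ := matPderiv s)
      map_zDeriv_sub (matPderiv_sub s) map_zDeriv_mul (matPderiv_mul s)
      (fun X => (matPderiv_map_zDeriv s X).symm) p (hN.1 s),
    fun s t => curvature_gauge (D₁ := matPderiv s) (D₂ := matPderiv t)
      (matPderiv_sub s) (matPderiv_sub t) (matPderiv_mul s) (matPderiv_mul t)
      (matPderiv_comm s t) p (hN.2 s t)⟩

theorem cf_sum_flat_mul_varpi {S : Type*} [CommRing S] (f : ℕ → Fin m → S) (ℓ α : ℤ) :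
    cf (∑ k ∈ Finset.Icc 1 r, flat (f k) * varpi S m e ^ (-(k : ℤ))) ℓ α =
      if -(r : ℤ) ≤ ℓ ∧ ℓ < 0 then Matrix.diagonal (f (-ℓ).toNat) else 0 := by
  rw [cf_sum]
  simp only [varpi_zpow_neg, cf_flat_mul_shift]
  split_ifs with h
  · rw [Finset.sum_eq_single (-ℓ).toNat]
    · rw [if_pos (by omega)]
    · intro k _ hk
      rw [if_neg (by omega)]
    · intro hk
      exact absurd (Finset.mem_Icc.2 ⟨by omega, by omega⟩) hk
  · refine Finset.sum_eq_zero fun k hk => ?_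
    rw [Finset.mem_Icc] at hk
    rw [if_neg (by omega)]

theorem matEval_formalTypeRep_mem_torus (y : Δ) (t : ℕ → Fin m → Hol Δ) :
    matEval y (formalTypeRep r t : Mat (Hol Δ) m e) ∈ torus m e := by
  rw [formalTypeRep, matEval_add, matEval_sum]
  refine Submodule.add_mem _ ?_ (Submodule.sum_mem _ fun k _ => ?_)
  · rw [← mul_one (flat (t 0)), ← shift_zero, matEval_flat_mul_shift]
    exact flat_mul_shift_mem_torus _ _
  · rw [varpi_zpow_neg, matEval_flat_mul_shift]
    exact flat_mul_shift_mem_torus _ _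

end Families

/-! ### Removing `H_T` -/

section RemoveHT

variable {S : Type*} [CommRing S] [Algebra ℂ S] {m e r : ℕ} [NeZero e]

theorem sum_range_sub_of_periodic {M : Type*} [AddCommGroup M] {f : ℤ → M}
    (hf : Function.Periodic f (e : ℤ)) (k : ℕ) :
    ∑ α ∈ Finset.range e, f (α - k) = ∑ α ∈ Finset.range e, f α := by
  induction k with
  | zero => simp
  | succ k ih =>
    rw [← ih]
    have h1 := Finset.sum_range_succ' (fun α : ℕ => f (α - (k + 1 : ℕ))) e
    rw [Finset.sum_range_succ] at h1
    have h2 : f ((e : ℤ) - (k + 1 : ℕ)) = f (((0 : ℕ) : ℤ) - (k + 1 : ℕ)) := by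
      rw [← hf (((0 : ℕ) : ℤ) - (k + 1 : ℕ))]
      congr 1
    rw [h2, add_left_inj] at h1
    rw [h1]
    refine Finset.sum_congr rfl fun α _ => ?_
    congr 1
    push_cast
    ring

/-- The entries (e−1)/2e, …, (1−e)/2e are symmetric about 0. Having mean zero is what places H_T in
the image of the cyclic difference operator. -/
theorem sum_range_cf_HT (i : Fin m) :
    ∑ α ∈ Finset.range e, cf (HT S m e) 0 (α : ℕ) i i = 0 := by
  have h1 : ∀ n : ℕ, ∑ α ∈ Finset.range n, 2 * (α : ℂ) = n * (n - 1) := by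
    intro n
    induction n with
    | zero => simp
    | succ n ih => rw [Finset.sum_range_succ, ih]; push_cast; ring
  have h2 : ∀ α ∈ Finset.range e, cf (HT S m e) 0 (α : ℕ) i i =
      algebraMap ℂ S ((((e : ℂ) - 1) - 2 * (α : ℂ)) / (2 * e)) := by
    intro α hα
    rw [Finset.mem_range] at hα
    have : (res e (α : ℤ) : ℕ) = α := by
      have h3 : (((res e (α : ℤ) : Fin e) : ℕ) : ℤ) = α := by
        rw [coe_res, Int.emod_eq_of_lt (by positivity) (by exact_mod_cast hα)]
      exact_mod_cast h3
    rw [cf_HT, if_pos rfl, Matrix.diagonal_apply_eq, this]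
  rw [Finset.sum_congr rfl h2, ← map_sum, ← Finset.sum_div, Finset.sum_sub_distrib, h1,
    Finset.sum_const, Finset.card_range, nsmul_eq_mul, sub_self, zero_div, map_zero]

/-- For r ≥ 1, degree 0 lies above −r; for r = 0 the blocks have size 1 and H_T = 0. Hence
subtracting H_T leaves the stratum unchanged. -/
theorem HT_mem_parahoric_neg (he : r = 0 → e = 1) : HT S m e ∈ parahoric S m e (-r + 1) := by
  by_cases hr : r = 0
  · have he := he hr
    subst he
    have : HT S m 1 = 0 := by
      refine cf_ext fun ℓ α => ?_
      rw [cf_HT, cf_zero]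
      split_ifs
      · simp
      · rfl
    rw [this]
    exact Submodule.zero_mem _
  · exact parahoric_anti (by omega) HT_mem_parahoric

/-- Modulo `𝔓^1`, the matrix `H_T` can be removed from `A + H_T` by an element of `P^1`. -/
theorem RegularLeading.exists_remove_HT {c : Fin m → S} (hc : RegularLeading r e c) {A : Mat S m e}
    (hA : A ∈ parahoric S m e (-r)) (hAc : ∀ α, cf A (-r) α = Matrix.diagonal c) :
    ∃ X : Mat S m e, X - 1 ∈ parahoric S m e 1 ∧
      X * (A + HT S m e) - X.map zDeriv - A * X ∈ parahoric S m e 1 := by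
  have h1z : (1 : Mat S m e).map zDeriv = 0 := by
    have := map_zDeriv_diagonal (S := S) (m := m) (e := e) fun _ => 1
    simpa using this
  by_cases hr : r = 0
  · refine ⟨1, by simp, ?_⟩
    have := HT_mem_parahoric_neg (S := S) (m := m) (r := r) (e := e) hc.eq_one
    rw [hr] at this
    rw [h1z]
    simpa using this
  have hper : Function.Periodic (fun α => -cf (HT S m e) 0 α) (e : ℤ) := fun α => by
    simp only [cf_periodic (HT S m e) 0 α]
  -- The gauge is 1 + Z with Z of degree r; in degree 0 it must satisfy H_T + [Z, A] = 0. This is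
  -- solvable up to a constant diagonal x, and averaging over one period shows x = 0.
  obtain ⟨Y, hY, x, hx⟩ := hc.exists_preimage r hper
  have hx0 : Matrix.diagonal x = 0 := by
    have : x = 0 := by
      funext i
      have h1 : ∀ α : ℤ, Y α i i * c i - c i * Y (α - r) i i + x i = -cf (HT S m e) 0 α i i := by
        intro α
        have := congrFun (congrFun (hx α) i) i
        rw [gradTerm, if_neg hr, zero_smul, sub_zero] at this
        simpa only [Matrix.add_apply, Matrix.sub_apply, Matrix.mul_diagonal, Matrix.diagonal_mul,
          Matrix.diagonal_apply_eq, Matrix.neg_apply] using this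
      have h2 : ∑ α ∈ Finset.range e, (Y (α : ℕ) i i * c i - c i * Y ((α : ℕ) - r) i i + x i) =
          e * x i := by
        have h3 := sum_range_sub_of_periodic (e := e) (f := fun α => Y α i i)
          (fun α => by simp only [hY α]) r
        rw [Finset.sum_add_distrib, Finset.sum_sub_distrib, ← Finset.sum_mul, ← Finset.mul_sum, h3]
        simp
        ring
      simp only [h1] at h2
      rw [Finset.sum_neg_distrib, sum_range_cf_HT, neg_zero] at h2
      exact (isUnit_natCast e).mul_right_eq_zero.1 h2.symm
    rw [this]
    exact Matrix.diagonal_zero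
  let Z : Mat S m e := ofCf m e r fun _ => Y
  have hZ : Z ∈ parahoric S m e r := ofCf_mem_parahoric _ fun _ => hY
  have hZ0 : ∀ α, cf Z r α = Y α := fun α => by
    rw [cf_ofCf _ fun _ => hY, if_neg (lt_irrefl _)]
  have hZ1 : Z ∈ parahoric S m e 1 := parahoric_anti (by omega) hZ
  refine ⟨1 + Z, by simpa using hZ1, ?_⟩
  have h1 : (1 + Z).map zDeriv ∈ parahoric S m e 1 := by
    have h2 := map_zDeriv_sub (1 + Z) 1
    rw [add_sub_cancel_left, h1z, sub_zero] at h2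
    rw [← h2]
    exact map_zDeriv_mem_parahoric hZ1
  have h2 : Z * HT S m e ∈ parahoric S m e 1 := by
    simpa using mul_mem_parahoric hZ1 HT_mem_parahoric
  have hZA := mul_mem_parahoric hZ hA
  have hAZ := mul_mem_parahoric hA hZ
  rw [add_neg_cancel] at hZA
  rw [neg_add_cancel] at hAZ
  have h3 : HT S m e + (Z * A - A * Z) ∈ parahoric S m e 1 := by
    rw [mem_parahoric_iff]
    intro ℓ hℓ α
    rcases (Int.lt_add_one_iff.1 hℓ : ℓ ≤ 0).lt_or_eq with h0 | rfl
    · exact mem_parahoric_iff.1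
        (Submodule.add_mem _ HT_mem_parahoric (Submodule.sub_mem _ hZA hAZ)) ℓ h0 α
    · have := hx α
      rw [gradTerm, if_neg hr, zero_smul, sub_zero, hx0, add_zero] at this
      rw [cf_add, cf_sub, cf_mul hZ hA, cf_mul hA hZ, zero_sub, neg_neg, zero_sub,
        Finset.Icc_self, Finset.Icc_self, Finset.sum_singleton, Finset.sum_singleton, hZ0,
        zero_sub, zero_sub, neg_neg, hZ0, hAc, hAc, ← sub_eq_add_neg, this, add_neg_cancel]
  have h4 : (1 + Z) * (A + HT S m e) - (1 + Z).map zDeriv - A * (1 + Z) =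
      (HT S m e + (Z * A - A * Z)) + Z * HT S m e - (1 + Z).map zDeriv := by noncomm_ring
  rw [h4]
  exact Submodule.sub_mem _ (Submodule.add_mem _ h3 h2) h1

end RemoveHT

/-! ### Good framings -/

section GoodFraming

open TopologicalSpace

variable {d : ℕ} {Δ : Opens (Fin d → ℂ)} {m e r : ℕ} [NeZero e]

/-- The diagonal element of `GL_n(R)` that is constant on blocks. -/
def blockGL (e : ℕ) (u : Fin m → (Hol Δ)ˣ) : GL (Fin m × Fin e) (Hol Δ) where
  val := Matrix.diagonal fun p => (u p.1 : Hol Δ)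
  inv := Matrix.diagonal fun p => ((u p.1)⁻¹ : (Hol Δ)ˣ)
  val_inv := by simp
  inv_val := by simp

theorem coe_constGL_blockGL (u : Fin m → (Hol Δ)ˣ) :
    (constGL (blockGL e u) : Mat (Hol Δ) m e) = flat fun j => (u j : Hol Δ) :=
  Matrix.diagonal_map (map_zero _)

theorem coe_constGL_blockGL_inv (u : Fin m → (Hol Δ)ˣ) :
    (((constGL (blockGL e u))⁻¹ : GLF (Hol Δ) m e) : Mat (Hol Δ) m e) =
      flat fun j => (((u j)⁻¹ : (Hol Δ)ˣ) : Hol Δ) := by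
  rw [constGL, ← map_inv]
  exact Matrix.diagonal_map (map_zero _)

theorem constGL_mul (g h : GL (Fin m × Fin e) (Hol Δ)) :
    constGL (g * h) = constGL g * constGL h := map_mul _ g h

theorem map_zDeriv_flat (f : Fin m → Hol Δ) : (flat f : Mat (Hol Δ) m e).map zDeriv = 0 :=
  map_zDeriv_diagonal fun p => f p.1

theorem matPderiv_flat (s : Fin d) (f : Fin m → Hol Δ) :
    matPderiv s (flat f : Mat (Hol Δ) m e) = flat fun j => pderiv s (f j) := by
  refine cf_ext fun ℓ α => ?_
  rw [cf_matPderiv, cf_flat, cf_flat]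
  split_ifs
  · rw [Matrix.diagonal_map (map_zero _)]
  · rw [Matrix.map_zero _ (map_zero _)]

theorem flat_mul_flat {S : Type*} [CommRing S] (f g : Fin m → S) :
    (flat f * flat g : Mat S m e) = flat fun j => f j * g j := by
  rw [flat, flat, Matrix.diagonal_mul_diagonal]
  simp only [flat, map_mul]

theorem flat_mul_HT {S : Type*} [CommRing S] [Algebra ℂ S] (f : Fin m → S) :
    (flat f : Mat S m e) * HT S m e = HT S m e * flat f := by
  rw [flat, HT, Matrix.diagonal_mul_diagonal, Matrix.diagonal_mul_diagonal]
  simp only [mul_comm]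

/-- The leading coefficients of a compatible framing. -/
theorem Conn.IsCompatibleFraming.exists_leading [Nonempty Δ] {N : Conn Δ m e}
    {g : GL (Fin m × Fin e) (Hol Δ)} (hg : N.IsCompatibleFraming r g) :
    ∃ c : Fin m → Hol Δ, RegularLeading r e c ∧
      (N.inFrame g).dzPart - HT (Hol Δ) m e ∈ parahoric (Hol Δ) m e (-r) ∧
      ∀ α, cf ((N.inFrame g).dzPart - HT (Hol Δ) m e) (-r) α = Matrix.diagonal c := by
  set a := (N.inFrame g).dzPart with ha
  have hgcd : Nat.gcd r e = 1 := by
    obtain ⟨b, hb, _⟩ := hg (Classical.arbitrary Δ)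
    exact hb.coprime
  have he : r = 0 → e = 1 := fun hr => by rwa [hr, Nat.gcd_zero_left] at hgcd
  have hH := HT_mem_parahoric_neg (S := Hol Δ) (m := m) he
  choose b hb hba using hg
  have h1 : ∀ y, matEval y (a - HT (Hol Δ) m e) - b y ∈ parahoric ℂ m e (-r + 1) := by
    intro y
    have h2 := sub_mem_of_containsStratum he (hba y)
    have h3 := Submodule.sub_mem _ h2 (matEval_mem_parahoric y hH)
    rw [matEval_sub]
    convert h3 using 1
    abel
  have h2 : a - HT (Hol Δ) m e ∈ parahoric (Hol Δ) m e (-r) := by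
    refine mem_parahoric_of_matEval fun y => ?_
    have := Submodule.add_mem _ (parahoric_anti (by omega) (h1 y)) (hb y).mem
    rwa [sub_add_cancel] at this
  have h3 : ∀ y α, (cf (a - HT (Hol Δ) m e) (-r) α).map (evalAt y) = cf (b y) (-r) α := by
    intro y α
    have := mem_parahoric_iff.1 (h1 y) (-r) (by omega) α
    rwa [cf_sub, cf_matEval, sub_eq_zero] at this
  -- The representatives `b y` are chosen fibre by fibre, with no control in y, but their leading
  -- coefficients are the values of those of a − H_T, which are holomorphic.
  let c : Fin m → Hol Δ := fun j => cf (a - HT (Hol Δ) m e) (-r) 0 j j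
  have h4 : ∀ y α, cf (b y) (-r) α = Matrix.diagonal fun j => evalAt y (c j) := by
    intro y α
    obtain ⟨x, hx⟩ := (hb y).exists_leading
    have h5 : ∀ j, evalAt y (c j) = x j := by
      intro j
      have := congrFun (congrFun ((h3 y 0).trans (hx 0)) j) j
      rwa [Matrix.diagonal_apply_eq] at this
    simp only [h5, hx]
  have h5 : ∀ y, RegularLeading r e fun j => evalAt y (c j) := fun y =>
    (hb y).regularLeading (h4 y)
  refine ⟨c, ⟨hgcd, fun i j hij ℓ => ?_, fun he i => ?_⟩, h2, fun α => ?_⟩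
  · refine Hol.isUnit_of_forall_ne_zero fun y => ?_
    have h6 : evalAt y (gradTerm (Hol Δ) r ℓ) = gradTerm ℂ r ℓ := by
      rw [gradTerm, gradTerm]
      split_ifs
      · exact map_intCast _ _
      · exact map_zero _
    rw [map_sub, map_pow, map_pow, map_sub, h6]
    exact ((h5 y).isUnit_sub i j hij ℓ).ne_zero
  · exact Hol.isUnit_of_forall_ne_zero fun y => ((h5 y).isUnit he i).ne_zero
  · refine Matrix.ext fun i j => Hol.ext_iff_apply.2 fun y => ?_
    have := congrFun (congrFun ((h3 y α).trans (h4 y α)) i) j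
    rw [Matrix.diagonal_apply] at this
    rw [Matrix.diagonal_apply]
    split_ifs at this ⊢ with hij
    · exact this
    · exact this

/-- The fibre condition of a good framing. -/
theorem isFormalType_of_gauge {a A : Mat (Hol Δ) m e} {c : Fin m → Hol Δ}
    (hc : RegularLeading r e c) (hA : A ∈ parahoric (Hol Δ) m e (-r))
    (hAc : ∀ α, cf A (-r) α = Matrix.diagonal c)
    (haA : a - A ∈ parahoric (Hol Δ) m e (-r + 1)) {p : GLF (Hol Δ) m e} (hp : InP1 p)
    (hpa : gaugeZ p a = A + HT (Hol Δ) m e) (y : Δ) (hreg : IsRegularStratum r (matEval y A))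
    (htor : matEval y A ∈ torus m e) : IsFormalType r (matEval y a) (matEval y A) := by
  refine ⟨hreg, containsStratum_of_sub_mem hc.eq_one (matEval_mem_parahoric y hA) ?_,
    ⟨_, htor, by rw [sub_self]; exact Submodule.zero_mem _⟩, ?_⟩
  · rw [← matEval_sub]
    exact matEval_mem_parahoric y haA
  -- The given p reaches A + H_T, whereas the formal type asks for A modulo 𝔓^1. The correction X is
  -- composed with p over R, and the product is then restricted to the fibre.
  obtain ⟨X, hX, hXA⟩ := hc.exists_remove_HT hA hAc
  have h1 : (p : Mat (Hol Δ) m e) * a - (p : Mat (Hol Δ) m e).map zDeriv =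
      (A + HT (Hol Δ) m e) * p := by
    rw [← hpa, gaugeZ, ← sub_mul, mul_assoc, Units.inv_mul, mul_one]
  have hp0 := mem_parahoric_of_sub_one_mem hp
  have h2 : (X * (p : Mat (Hol Δ) m e)) * a - (X * (p : Mat (Hol Δ) m e)).map zDeriv - A * (X * (p : Mat (Hol Δ) m e)) ∈ parahoric (Hol Δ) m e 1 := by
    have h3 := mul_mem_parahoric hXA hp0
    rw [add_zero] at h3
    have h4 : (X * (p : Mat (Hol Δ) m e)) * a - (X * (p : Mat (Hol Δ) m e)).map zDeriv - A * (X * (p : Mat (Hol Δ) m e)) =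
        X * (p * a - (p : Mat (Hol Δ) m e).map zDeriv) - X.map zDeriv * p - A * X * p := by
      rw [map_zDeriv_mul]; noncomm_ring
    rw [h4, h1]
    convert h3 using 1
    noncomm_ring
  have hXp : X * (p : Mat (Hol Δ) m e) - 1 ∈ parahoric (Hol Δ) m e 1 := by
    have h3 := mul_mem_parahoric (mem_parahoric_of_sub_one_mem hX) hp
    rw [zero_add] at h3
    have := Submodule.add_mem _ h3 hX
    rwa [mul_sub, mul_one, sub_add_sub_cancel] at this
  have h5 : matEval y (X * (p : Mat (Hol Δ) m e)) - 1 ∈ parahoric ℂ m e 1 := by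
    rw [← matEval_one y, ← matEval_sub]
    exact matEval_mem_parahoric y hXp
  obtain ⟨q, hq, hq1, hq2⟩ := exists_GLF h5
  refine ⟨q, hq1, ?_⟩
  have h6 := matEval_mem_parahoric y h2
  rw [matEval_sub, matEval_sub, matEval_mul, matEval_map_zDeriv, matEval_mul y A, ← hq] at h6
  have h7 := mul_mem_parahoric h6 (mem_parahoric_of_sub_one_mem hq2)
  rw [add_zero, sub_mul, sub_mul, mul_assoc (matEval y A), Units.mul_inv, mul_one] at h7
  exact h7

/-- The normal form of a flat connection whose `dz / z`-part is `A + H_T` with `A` toral: up to a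
gauge transformation by a diagonal element of `GL_n(R)`, it is determined by `A`. -/
theorem exists_gauge_eq_normalForm (hΔ : Convex ℝ (Δ : Set (Fin d → ℂ))) {N : Conn Δ m e}
    (hN : N.IsFlat) {c : Fin m → Hol Δ} (hc : RegularLeading r e c) {A : Mat (Hol Δ) m e}
    (hA : A ∈ parahoric (Hol Δ) m e (-r)) (hAt : IsToral A)
    (hAc : ∀ α, cf A (-r) α = Matrix.diagonal c) (hA0 : ∀ ℓ, 0 < ℓ → ∀ α, cf A ℓ α = 0)
    (hNA : N.dzPart = A + HT (Hol Δ) m e) :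
    ∃ (t : ℕ → Fin m → Hol Δ) (u : Fin m → (Hol Δ)ˣ), A = formalTypeRep r t ∧
      N.gauge (constGL (blockGL e u)) = normalForm r t := by
  obtain ⟨x, hx⟩ := hAt
  have hAt : IsToral A := ⟨x, hx⟩
  have he : (e : ℂ) ≠ 0 := by exact_mod_cast NeZero.ne e
  -- The scaling inverts the factor −k/e in front of t_k.
  let t : ℕ → Fin m → Hol Δ := fun k j => if k = 0 then x 0 j else (-((e : ℂ) / k)) • x (-k) j
  have hAt' : A = formalTypeRep r t := by
    refine cf_ext fun ℓ α => ?_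
    rw [formalTypeRep, cf_add, cf_flat,
      cf_sum_flat_mul_varpi fun k j => (-(k : ℂ) / (e : ℂ)) • t k j]
    rcases lt_trichotomy ℓ 0 with h | rfl | h
    · rw [if_neg h.ne, zero_add]
      by_cases h2 : -(r : ℤ) ≤ ℓ
      · rw [if_pos ⟨h2, h⟩, hx]
        congr 1
        funext j
        have h3 : (-ℓ).toNat ≠ 0 := by omega
        have h4 : (((-ℓ).toNat : ℕ) : ℂ) ≠ 0 := by exact_mod_cast h3
        have h5 : -(((-ℓ).toNat : ℕ) : ℤ) = ℓ := by omega
        simp only [t, if_neg h3, smul_smul, h5]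
        have h6 : -(((-ℓ).toNat : ℕ) : ℂ) / (e : ℂ) * -((e : ℂ) / ((-ℓ).toNat : ℕ)) = 1 := by
          field_simp
        rw [h6, one_smul]
      · rw [if_neg (fun h => h2 h.1), mem_parahoric_iff.1 hA ℓ (by omega)]
    · simp [hx, t]
    · rw [if_neg h.ne', if_neg (fun h2 => by omega), hA0 ℓ h, zero_add]
  -- In the dz/z ∧ dy_s component H_T does not depend on y, and its commutator with B_s completes
  -- z∂_z to δ.
  have hflat : ∀ s, gradDeriv (N.dyPart s) + (A * N.dyPart s - N.dyPart s * A) = matPderiv s A := by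
    intro s
    have := hN.1 s
    rw [hNA, matPderiv_add, matPderiv_HT, add_zero] at this
    rw [gradDeriv, ← sub_eq_zero, ← this]
    noncomm_ring
  have hder : ∀ s, IsToral (matPderiv s A) := fun s => ⟨fun ℓ j => pderiv s (x ℓ j), fun ℓ α => by
    rw [cf_matPderiv, hx, Matrix.diagonal_map (map_zero _)]⟩
  have hB : ∀ s, IsToral (N.dyPart s) := fun s =>
    hc.isToral_of_flat hA hAt hAc (hder s) (hflat s)
  have hBcf : ∀ s (ℓ : ℤ) α, algebraMap ℂ (Hol Δ) ((ℓ : ℂ) / e) • cf (N.dyPart s) ℓ α =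
      (cf A ℓ α).map (pderiv s) := by
    intro s ℓ α
    rw [← cf_gradDeriv, ← cf_matPderiv, ← hflat, hAt.commute (hB s), sub_self, add_zero]
  have hBcf' : ∀ s (ℓ : ℤ) α, ℓ ≠ 0 → cf (N.dyPart s) ℓ α = ((e : ℂ) / ℓ) • (cf A ℓ α).map (pderiv s) := by
    intro s ℓ α hℓ
    have hℓ' : (ℓ : ℂ) ≠ 0 := by exact_mod_cast hℓ
    have h2 : (e : ℂ) / ℓ * (ℓ / e) = 1 := by field_simp
    rw [← hBcf, algebraMap_smul, smul_smul, h2, one_smul]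
  choose b hb using hB
  -- In degree ℓ, flatness has become (ℓ/e) B_ℓ = ∂_s A_ℓ. Degree −k gives ∂_s t_k, positive degrees
  -- give 0, and only degree 0 stays free.
  have hBt : ∀ s, N.dyPart s = flat (b s 0) + ADelta r t s := by
    intro s
    refine cf_ext fun ℓ α => ?_
    rw [ADelta, cf_add, cf_flat, cf_sum_flat_mul_varpi fun k j => pderiv s (t k j)]
    by_cases h0 : ℓ = 0
    · subst h0
      rw [if_pos rfl, if_neg (fun h => by omega), add_zero, hb]
    · rw [if_neg h0, zero_add, hBcf' s ℓ α h0]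
      by_cases h2 : -(r : ℤ) ≤ ℓ ∧ ℓ < 0
      · have h3 : (-ℓ).toNat ≠ 0 := by omega
        have h5 : -(((-ℓ).toNat : ℕ) : ℤ) = ℓ := by omega
        have h4 : (((-ℓ).toNat : ℕ) : ℂ) = -ℓ := by
          have : (((-ℓ).toNat : ℕ) : ℤ) = -ℓ := by omega
          exact_mod_cast this
        rw [if_pos h2, hx, Matrix.diagonal_map (map_zero _), ← Matrix.diagonal_smul]
        congr 1
        funext j
        simp only [t, if_neg h3, h5, h4, Pi.smul_apply, map_smul, div_neg, neg_neg]
      · rw [if_neg h2]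
        have h3 : cf A ℓ α = 0 := by
          by_cases h4 : ℓ < 0
          · exact mem_parahoric_iff.1 hA ℓ (by omega) α
          · exact hA0 ℓ (by omega) α
        rw [h3, Matrix.map_zero _ (map_zero _), smul_zero]
  -- The toral B_s commute, so the quadratic part of the curvature drops out and each block carries
  -- a closed one-form in degree zero.
  have hclosed : ∀ j s s', pderiv s (b s' 0 j) = pderiv s' (b s 0 j) := by
    intro j s s'
    have h1 := hN.2 s s'
    rw [IsToral.commute ⟨_, hb s⟩ ⟨_, hb s'⟩, sub_self, add_zero, sub_eq_zero] at h1
    have h2 := congrFun (congrFun (congrArg (fun M => cf M 0 0) h1) j) j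
    simp only [cf_matPderiv, hb, Matrix.map_apply, Matrix.diagonal_apply_eq] at h2
    exact h2
  choose f hf using fun j => exists_primitive hΔ (fun s => b s 0 j) (hclosed j)
  -- The term (∂_s u) u⁻¹ is exactly the degree-zero part of B_s, while u commutes with A, H_T and
  -- B_s.
  let u : Fin m → (Hol Δ)ˣ := fun j => (Hol.isUnit_exp (f j)).unit
  refine ⟨t, u, hAt', ?_⟩
  have hu : ∀ M : Mat (Hol Δ) m e, (flat fun j => (u j : Hol Δ)) * M = M * flat (fun j => (u j : Hol Δ)) →
      (flat fun j => (u j : Hol Δ)) * M * (flat fun j => (((u j)⁻¹ : (Hol Δ)ˣ) : Hol Δ)) = M := by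
    intro M hM
    rw [hM, mul_assoc, flat_mul_flat]
    simp only [Units.mul_inv]
    rw [flat]
    simp
  apply Conn.ext
  · change gaugeZ _ _ = _
    rw [gaugeZ, coe_constGL_blockGL, coe_constGL_blockGL_inv, map_zDeriv_flat, zero_mul, sub_zero,
      hNA, normalForm, ← hAt', hu]
    rw [mul_add, add_mul, flat_mul_HT, (isToral_flat _).commute hAt]
  · funext s
    change _ * _ * _ - _ * _ = ADelta r t s
    have h1 : (flat fun j => pderiv s (u j : Hol Δ)) * (flat fun j => (((u j)⁻¹ : (Hol Δ)ˣ) : Hol Δ)) =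
        (flat (b s 0) : Mat (Hol Δ) m e) := by
      rw [flat_mul_flat]
      congr 1
      funext j
      have h2 : pderiv s (u j : Hol Δ) = (u j : Hol Δ) * b s 0 j := by
        rw [← hf j s]; exact pderiv_exp s (f j)
      rw [h2, mul_right_comm, Units.mul_inv, one_mul]
    rw [coe_constGL_blockGL, coe_constGL_blockGL_inv, matPderiv_flat, h1,
      hu _ ((isToral_flat _).commute ⟨_, hb s⟩), hBt, add_sub_cancel_left]

/-- A framed flat deformation over a nonempty convex domain has a good framing. -/
theorem Conn.IsFramedFlatDeformation.exists_isGoodFraming [Nonempty Δ]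
    (hΔ : Convex ℝ (Δ : Set (Fin d → ℂ))) {N : Conn Δ m e} (hN : N.IsFramedFlatDeformation r) :
    ∃ g, N.IsGoodFraming r g := by
  obtain ⟨hflat, g, hg⟩ := hN
  obtain ⟨c, hc, ha, hac⟩ := hg.exists_leading
  obtain ⟨p, A, hp, -, hA, hAt, hAc, hA0, hpA⟩ := hc.exists_gaugeZ ha hac
  obtain ⟨t, u, rfl, hu⟩ := exists_gauge_eq_normalForm hΔ ((hflat.gauge (constGL g)).gauge p) hc
    hA hAt hAc hA0 hpA
  set h : GLF (Hol Δ) m e := constGL (blockGL e u) with hh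
  have hv : (h : Mat (Hol Δ) m e) = flat fun j => (u j : Hol Δ) := coe_constGL_blockGL u
  have hv' : ((h⁻¹ : GLF (Hol Δ) m e) : Mat (Hol Δ) m e) = flat fun j => (((u j)⁻¹ : (Hol Δ)ˣ) : Hol Δ) :=
    coe_constGL_blockGL_inv u
  have hconj : ∀ {l : ℤ} {X : Mat (Hol Δ) m e}, X ∈ parahoric (Hol Δ) m e l →
      (h : Mat (Hol Δ) m e) * X * ((h⁻¹ : GLF (Hol Δ) m e) : Mat (Hol Δ) m e) ∈
        parahoric (Hol Δ) m e l := by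
    intro l X hX
    rw [hv, hv']
    simpa using mul_mem_parahoric (mul_mem_parahoric (flat_mem_parahoric _) hX)
      (flat_mem_parahoric _)
  -- Moving h into the framing and replacing p by h p h⁻¹ keeps the total gauge transformation, as
  -- (h p h⁻¹) h = h p; the conjugate is still in P^1.
  have hframe : N.inFrame (blockGL e u * g) = (N.inFrame g).gauge h := by
    rw [Conn.inFrame, constGL_mul, Conn.inFrame, Conn.gauge_gauge]
  set A := formalTypeRep r t with hAdef
  have hp' : InP1 (h * p * h⁻¹) := by
    have h1 : ((h * p * h⁻¹ : GLF (Hol Δ) m e) : Mat (Hol Δ) m e) - 1 =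
        h * ((p : Mat (Hol Δ) m e) - 1) * ((h⁻¹ : GLF (Hol Δ) m e) : Mat (Hol Δ) m e) := by
      rw [mul_sub, sub_mul, mul_one, Units.mul_inv, Units.val_mul, Units.val_mul]
    rw [InP1, h1]
    exact hconj hp
  have hnf : (N.inFrame (blockGL e u * g)).gauge (h * p * h⁻¹) = normalForm r t := by
    rw [hframe, Conn.gauge_gauge, inv_mul_cancel_right, ← Conn.gauge_gauge]
    exact hu
  have hH := HT_mem_parahoric_neg (S := Hol Δ) (m := m) hc.eq_one
  have haA : (N.inFrame g).dzPart - A ∈ parahoric (Hol Δ) m e (-r + 1) := by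
    have h1 : (N.inFrame g).dzPart - HT (Hol Δ) m e - A ∈ parahoric (Hol Δ) m e (-r + 1) := by
      rw [mem_parahoric_iff]
      intro ℓ hℓ α
      rcases (Int.lt_add_one_iff.1 hℓ).lt_or_eq with h1 | rfl
      · exact mem_parahoric_iff.1 (Submodule.sub_mem _ ha hA) ℓ h1 α
      · rw [cf_sub, hac, hAc, sub_self]
    have h2 := Submodule.add_mem _ h1 hH
    convert h2 using 1
    abel
  -- Since h commutes with A and is constant in z, the change of frame preserves the leading coset.
  have hnew : (N.inFrame (blockGL e u * g)).dzPart - A ∈ parahoric (Hol Δ) m e (-r + 1) := by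
    have h1 : (N.inFrame (blockGL e u * g)).dzPart - A =
        h * ((N.inFrame g).dzPart - A) * ((h⁻¹ : GLF (Hol Δ) m e) : Mat (Hol Δ) m e) := by
      have h2 : (h : Mat (Hol Δ) m e) * A * ((h⁻¹ : GLF (Hol Δ) m e) : Mat (Hol Δ) m e) = A := by
        rw [Units.mul_inv_eq_iff_eq_mul, hv, (isToral_flat _).commute hAt]
      rw [mul_sub, sub_mul, h2, hframe]
      change gaugeZ h _ - A = _
      rw [gaugeZ, hv, map_zDeriv_flat, zero_mul, sub_zero]
    rw [h1]
    exact hconj haA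
  have hft : ∀ y : Δ, IsFormalType r (matEval y (N.inFrame (blockGL e u * g)).dzPart)
      (matEval y A) := by
    intro y
    refine isFormalType_of_gauge hc hA hAc hnew hp' (congrArg Conn.dzPart hnf) y ?_
      (matEval_formalTypeRep_mem_torus y t)
    -- A(y) lies in the same coset as the stratum given by the original framing, so its regularity
    -- carries over.
    obtain ⟨b, hb, hba⟩ := hg y
    refine hb.congr ?_
    have h1 := sub_mem_of_containsStratum hc.eq_one hba
    have h2 := matEval_mem_parahoric y haA
    rw [matEval_sub] at h2
    have h3 := Submodule.sub_mem _ h1 h2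
    rwa [sub_sub_sub_cancel_left] at h3
  exact ⟨blockGL e u * g, fun y => ⟨_, (hft y).1, (hft y).2.1⟩, t, hft, h * p * h⁻¹, hp', hnf⟩

end GoodFraming

end

end FormalDeformation

theorem proposition4p4 {d m e r : ℕ} (he : 0 < e)
    (c : Fin d → ℂ) (ρ : Fin d → ℝ) (hρ : ∀ s, 0 < ρ s)
    (N : FormalDeformation.Conn (FormalDeformation.polydisk c ρ) m e)
    (hN : N.IsFramedFlatDeformation r) :
    ∃ g, N.IsGoodFraming r g := by
  have : NeZero e := ⟨he.ne'⟩
  have : Nonempty (FormalDeformation.polydisk c ρ) :=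
    ⟨⟨c, fun s _ => Metric.mem_ball_self (hρ s)⟩⟩
  exact hN.exists_isGoodFraming (FormalDeformation.convex_polydisk c ρ)
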